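/- **Problem (COFL-Circ).** An instance consists of demand points $p_1,\dots,p_n\in\mathbb R^2$ ($n\ge 1$), a circle with center $o\in\mathbb R^2$ and radius $r_c>0$, a coefficient $\alpha>0$, and an integer $k\ge 1$. A placement is a $k$-tuple $c_1,\dots,c_k$ of points of the circle (repetitions allowed), listed in counterclockwise order around it; put $c_{k+1}=c_1$. The problem is to compute the maximum, over all placements, of $$\lambda(c)=\min\Bigl\{\min_{1\le i\le n}\min_{1\le j\le k} d(p_i,c_j),\ \ \alpha\cdot\min_{1\le i\le k} d(c_i,c_{i+1})\Bigr\},$$ where $d$ is the Euclidean distance. **Machine.** A unit-cost real RAM: programs are while-programs over integer and real registers and integer-addressed arrays, with integer and rational constants. At unit cost it reads or writes a memory cell, performs $+,-,\cdot,/$ on integers (floor division) or reals, compares two numbers, performs a Boolean operation or a branch, converts an integer to a real, takes $\lfloor x\rfloor$, evaluates $\sqrt{\phantom x},\sin,\cos,\arcsin,\arccos$, and evaluates an entry of a candidate array, that is, from numbers $\omega,d_1,d_2,r,\alpha\in\mathbb R$ and $t\in\mathbb Z$ it computes the largest root $x\in[0,2\alpha r]$ (or $0$ if there is none) of $$\arccos\frac{d_1^2+r^2-x^2}{2d_1r}+\arccos\frac{d_2^2+r^2-x^2}{2d_2r}+2t\arcsin\frac{x}{2\alpha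 r}=\omega .$$ (Partial functions are made total: $y/0=0$, the square root of a negative number is $0$, and arguments of $\arcsin$ and $\arccos$ are clamped to $[-1,1]$.) The equation says that $t$ steps of chord length $x/\alpha$ on a circle of radius $r$ lead from the end of the forbidden arc $\{c: d(p,c)<x\}$ of one demand point $p$ exactly to the start of the forbidden arc of another, where $d_1,d_2$ are the distances of these two points from the center and $\omega$ is the angle from the direction of the first to that of the second. The input is $n$, $k$, $\alpha$, $r_c$ and the coordinates of $o,p_1,\dots,p_n$; the output is one real number. **Theorem.** There are a single program for this machine and a constant $C$ such that, on every instance of COFL-Circ, the maximum of $\lambda(c)$ exists and the program halts, outputs exactly this maximum, and uses at most $$C\cdot\Bigl(1+n^2\log k+n(\log^2 n+\log k)\log(n^2+k)\Bigr)$$ units of time. Thus COFL-Circ can be solved in $O\bigl(n^2\log k+n(\log^2 n+\log k)\log(n^2+k)\bigr)$ time. -/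

import Mathlib

open Real

/-! ## The optimization problem -/

noncomputable section

/-- The Euclidean plane. -/
abbrev Plane : Type := EuclideanSpace ℝ (Fin 2)

/-- The point at angle `θ` on the circle with center `o` and radius `r`. -/
def circlePoint (o : Plane) (r θ : ℝ) : Plane := o + !₂[r * cos θ, r * sin θ]

/-- `c 0, …, c (k-1)` lie on the circle with center `o` and radius `r`, and are listed in
counterclockwise order around it, so that `c (i+1)` (cyclically) is the neighbor of `c i`. -/
def IsCircPlacement (o : Plane) (r : ℝ) {k : ℕ} (c : Fin k → Plane) : Prop :=
  ∃ θ : Fin k → ℝ, Monotone θ ∧ (∀ i j, θ j ≤ θ i + 2 * π) ∧ ∀ j, c j = circlePoint o r (θ j)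

/-- The objective `min { min_{i,j} d(p_i, c_j), α * min_i d(c_i, c_{i+1}) }` with cyclic indices:
`finRotate k` is the map `i ↦ i + 1` modulo `k`. -/
def circObjective (α : ℝ) {n k : ℕ} (p : Fin n → Plane) (c : Fin k → Plane) : ℝ :=
  min (⨅ i, ⨅ j, dist (p i) (c j)) (α * ⨅ i, dist (c i) (c (finRotate k i)))

/-- `v` is the optimal value of the instance: the maximum of the objective over all placements. -/
def IsCircOptimum (α : ℝ) (o : Plane) (r : ℝ) {n : ℕ} (p : Fin n → Plane) (k : ℕ) (v : ℝ) : Prop :=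
  IsGreatest {x | ∃ c : Fin k → Plane, IsCircPlacement o r c ∧ x = circObjective α p c} v

/-! ## The machine: a unit-cost real RAM -/

namespace RealRAM

/-- A demand point at distance `d > 0` from the center of a circle of radius `r`, in direction `φ`,
is nearer than `x` exactly to the points of that circle whose angles lie strictly between
`φ - halfArc d r x` and `φ + halfArc d r x` (its forbidden arc for the radius `x`). -/
def halfArc (d r x : ℝ) : ℝ := arccos ((d ^ 2 + r ^ 2 - x ^ 2) / (2 * d * r))

/-- The angle between two points of a circle of radius `r` at Euclidean distance `x / α`. -/
def stepAngle (r α x : ℝ) : ℝ := 2 * arcsin (x / (2 * α * r))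

/-- The candidate radius: the largest root `x` in `[0, 2αr]` (and `0` if there is none) of
`halfArc d₁ r x + halfArc d₂ r x + t * stepAngle r α x = ω`. This equation says that `t` steps of
chord length `x / α` lead from the end of the forbidden arc of a first demand point exactly to
the start of the forbidden arc of a second one, whose direction is `ω` ahead of the first. -/
def candidateRoot (ω d₁ d₂ r α : ℝ) (t : ℤ) : ℝ :=
  sSup {x | 0 ≤ x ∧ x ≤ 2 * α * r ∧ halfArc d₁ r x + halfArc d₂ r x + t * stepAngle r α x = ω}

/-- The two kinds of memory cells. -/
inductive Ty where
  | int
  | real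

/-- Contents of a memory cell. -/
abbrev Ty.Val : Ty → Type
  | .int => ℤ
  | .real => ℝ

/-- The memory: registers and arrays of both kinds, named by natural numbers; arrays are
addressed by integers. A program mentions only finitely many registers and arrays. -/
structure Store where
  var : (s : Ty) → ℕ → s.Val
  arr : (s : Ty) → ℕ → ℤ → s.Val

/-- Arithmetic operations (`div` on integers is floor division). -/
inductive ArithOp where
  | add
  | sub
  | mul
  | div

def ArithOp.onInt : ArithOp → ℤ → ℤ → ℤ
  | .add, a, b => a + b
  | .sub, a, b => a - b
  | .mul, a, b => a * b
  | .div, a, b => Int.fdiv a b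

def ArithOp.onReal : ArithOp → ℝ → ℝ → ℝ
  | .add, a, b => a + b
  | .sub, a, b => a - b
  | .mul, a, b => a * b
  | .div, a, b => a / b

/-- Elementary functions. -/
inductive ElemFn where
  | sqrt
  | sin
  | cos
  | arcsin
  | arccos

def ElemFn.apply : ElemFn → ℝ → ℝ
  | .sqrt => Real.sqrt
  | .sin => Real.sin
  | .cos => Real.cos
  | .arcsin => Real.arcsin
  | .arccos => Real.arccos

/-- Expressions. Constants are integers and rationals only. -/
inductive Expr : Ty → Type where
  | intConst (m : ℤ) : Expr .int
  | ratConst (q : ℚ) : Expr .real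
  | var {s : Ty} (x : ℕ) : Expr s
  | get {s : Ty} (a : ℕ) (i : Expr .int) : Expr s
  | iop (op : ArithOp) (e₁ e₂ : Expr .int) : Expr .int
  | rop (op : ArithOp) (e₁ e₂ : Expr .real) : Expr .real
  | fn (f : ElemFn) (e : Expr .real) : Expr .real
  | toReal (e : Expr .int) : Expr .real
  | floor (e : Expr .real) : Expr .int
  | root (ω d₁ d₂ r α : Expr .real) (t : Expr .int) : Expr .real

/-- The value of an expression. -/
def Expr.val (σ : Store) : {s : Ty} → Expr s → s.Val
  | _, .intConst m => m
  | _, .ratConst q => (q : ℝ)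
  | s, .var x => σ.var s x
  | s, .get a i => σ.arr s a (i.val σ)
  | _, .iop op e₁ e₂ => op.onInt (e₁.val σ) (e₂.val σ)
  | _, .rop op e₁ e₂ => op.onReal (e₁.val σ) (e₂.val σ)
  | _, .fn f e => f.apply (e.val σ)
  | _, .toReal e => ((e.val σ : ℤ) : ℝ)
  | _, .floor e => ⌊(e.val σ : ℝ)⌋
  | _, .root ω d₁ d₂ r α t =>
      candidateRoot (ω.val σ) (d₁.val σ) (d₂.val σ) (r.val σ) (α.val σ) (t.val σ)

/-- The time for evaluating an expression: one unit for each operation, constant and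
memory access. -/
def Expr.cost : {s : Ty} → Expr s → ℕ
  | _, .intConst _ => 1
  | _, .ratConst _ => 1
  | _, .var _ => 1
  | _, .get _ i => i.cost + 1
  | _, .iop _ e₁ e₂ => e₁.cost + e₂.cost + 1
  | _, .rop _ e₁ e₂ => e₁.cost + e₂.cost + 1
  | _, .fn _ e => e.cost + 1
  | _, .toReal e => e.cost + 1
  | _, .floor e => e.cost + 1
  | _, .root ω d₁ d₂ r α t => ω.cost + d₁.cost + d₂.cost + r.cost + α.cost + t.cost + 1

/-- Branching conditions. -/
inductive Test where
  | intLe (e₁ e₂ : Expr .int)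
  | realLe (e₁ e₂ : Expr .real)
  | not (b : Test)
  | and (b₁ b₂ : Test)

def Test.Holds (σ : Store) : Test → Prop
  | .intLe e₁ e₂ => (e₁.val σ : ℤ) ≤ e₂.val σ
  | .realLe e₁ e₂ => (e₁.val σ : ℝ) ≤ e₂.val σ
  | .not b => ¬ b.Holds σ
  | .and b₁ b₂ => b₁.Holds σ ∧ b₂.Holds σ

def Test.cost : Test → ℕ
  | .intLe e₁ e₂ => e₁.cost + e₂.cost + 1
  | .realLe e₁ e₂ => e₁.cost + e₂.cost + 1
  | .not b => b.cost + 1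
  | .and b₁ b₂ => b₁.cost + b₂.cost + 1

/-- Programs. -/
inductive Program where
  | skip
  | assign (s : Ty) (x : ℕ) (e : Expr s)
  | store (s : Ty) (a : ℕ) (i : Expr .int) (e : Expr s)
  | seq (P Q : Program)
  | ite (b : Test) (P Q : Program)
  | loop (b : Test) (P : Program)

open Classical in
/-- Write `v` into register `x` of kind `s`. -/
def Store.setVar (σ : Store) (s : Ty) (x : ℕ) (v : s.Val) : Store :=
  ⟨Function.update σ.var s (Function.update (σ.var s) x v), σ.arr⟩

open Classical in
/-- Write `v` into entry `i` of array `a` of kind `s`. -/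
def Store.setArr (σ : Store) (s : Ty) (a : ℕ) (i : ℤ) (v : s.Val) : Store :=
  ⟨σ.var, Function.update σ.arr s
    (Function.update (σ.arr s) a (Function.update (σ.arr s a) i v))⟩

/-- `Runs P σ τ m`: started in the memory `σ`, the program `P` halts with the memory `τ` after
`m` units of time (`loop b P` is a while-loop). -/
inductive Runs : Program → Store → Store → ℕ → Prop where
  | skip (σ : Store) : Runs .skip σ σ 1
  | assign (σ : Store) (s : Ty) (x : ℕ) (e : Expr s) :
      Runs (.assign s x e) σ (σ.setVar s x (e.val σ)) (e.cost + 1)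
  | store (σ : Store) (s : Ty) (a : ℕ) (i : Expr .int) (e : Expr s) :
      Runs (.store s a i e) σ (σ.setArr s a (i.val σ) (e.val σ)) (i.cost + e.cost + 1)
  | seq {P Q : Program} {σ τ υ : Store} {m m' : ℕ} :
      Runs P σ τ m → Runs Q τ υ m' → Runs (.seq P Q) σ υ (m + m')
  | iteTrue {b : Test} {P Q : Program} {σ τ : Store} {m : ℕ} :
      b.Holds σ → Runs P σ τ m → Runs (.ite b P Q) σ τ (b.cost + 1 + m)
  | iteFalse {b : Test} {P Q : Program} {σ τ : Store} {m : ℕ} :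
      ¬ b.Holds σ → Runs Q σ τ m → Runs (.ite b P Q) σ τ (b.cost + 1 + m)
  | loopStop {b : Test} {P : Program} {σ : Store} :
      ¬ b.Holds σ → Runs (.loop b P) σ σ (b.cost + 1)
  | loopStep {b : Test} {P : Program} {σ τ υ : Store} {m m' : ℕ} :
      b.Holds σ → Runs P σ τ m → Runs (.loop b P) τ υ m' →
        Runs (.loop b P) σ υ (b.cost + 1 + m + m')

/-- The memory holding an instance: `n` and `k` in the integer registers 0 and 1; `α`, `r` and the
coordinates of the center in the real registers 0, 1, 2, 3; the coordinates of the demand points in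
entries `0, …, n-1` of the real arrays 0 and 1. All other cells are zero. -/
def inputStore (α : ℝ) (o : Plane) (r : ℝ) {n : ℕ} (p : Fin n → Plane) (k : ℕ) : Store where
  var
    | .int, 0 => (n : ℤ)
    | .int, 1 => (k : ℤ)
    | .int, _ => (0 : ℤ)
    | .real, 0 => α
    | .real, 1 => r
    | .real, 2 => o 0
    | .real, 3 => o 1
    | .real, _ => (0 : ℝ)
  arr
    | .int, _, _ => (0 : ℤ)
    | .real, 0, i => if h : 0 ≤ i ∧ i < n then p ⟨i.toNat, by omega⟩ 0 else 0
    | .real, 1, i => if h : 0 ≤ i ∧ i < n then p ⟨i.toNat, by omega⟩ 1 else 0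
    | .real, _, _ => (0 : ℝ)

/-- The output of a halted program: the contents of the real register 0. -/
def Store.output (σ : Store) : ℝ := σ.var .real 0

end RealRAM

/-- The running time `n² log k + n (log² n + log k) log (n² + k)`. -/
def circTime (n k : ℕ) : ℝ :=
  (n : ℝ) ^ 2 * log k + n * (log n ^ 2 + log k) * log ((n : ℝ) ^ 2 + k)

end

set_option linter.unusedSimpArgs false

/-! Chains. For a radius `x`, every demand point forbids an open arc of the circle, and neighboring
facilities must differ in angle by at least `stepAngle r α x`, in both directions around. Two bounds
on the optimum are immediate: `2αr sin(π/k)`, because the angular steps add up to one turn, and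
`dist (p i) o + r`, by the triangle inequality. Let `X` be their minimum. For `0 < x ≤ X`, a
placement of value at least `x` exists iff the closed `freeSet` contains a cyclic chain of `k`
points with these differences (`IsReduction.hasChain_iff`).

Deciding a radius. A chain can be rotated back rigidly until one of its points is the start of a gap
between arcs, and from there the greedy sequence is never ahead of it
(`ArcSystem.exists_greedy_of_hasChain`). So one greedy run from the start of each of `n` gaps
decides a radius. Inside a gap a run jumps by one division and floor; the next usable gap is found
with strides of about `√n` followed by unit steps. A run costs O(min(k√n, n)), and a decision costs
T = O(n · min(k√n, n)).

Candidates. Every point of a greedy chain lies some `t < k` steps after the end of an arc. If none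
of them is exactly at the start of an arc ahead, all inequalities towards the arcs ahead are strict;
below `X` the `k` steps do not fill the turn, so somewhere there is slack where the chain can be
cut. Hence the chain survives a small increase of the radius (`Demands.eventually_hasChain`), and an
optimum strictly between 0 and `X` must be a `candidateRoot`.

Search. The program keeps a bracket `lo < hi` with `hi` infeasible and `lo` feasible or zero. The
roughly `3n²k` candidates are too many to list. But for a fixed pair of demand points the candidates
below `hi` decrease in `t` (`threshold_candidateRoot`), so those in the bracket with `q ∣ t` belong
to consecutive multiples of `q`; there are at most twice as many as for `2q`, plus one. Let `q` run
down through the powers of two, starting at one that is at least `k`. If at most `3n²` candidates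
are left for `2q`, then at most `9n²` are left for `q`. They are listed; deciding an approximate
median discards a fixed fraction, so O(1) decisions bring the list down to `3n²`. For `q = 1` the
list is emptied by O(log n) decisions, and then `lo` is the optimum
(`IsReduction.isCircOptimum_of_no_candidate`).

Time. The O(log k) stages cost O(n²) each, and the last one adds T log n. If `log n ≤ 4 log k`, then
T = O(n²) suffices. Otherwise `k < n^(1/4)`, so T = O(n^(7/4)), and `log n ≤ 4 n^(1/4)`
(`testCost_mul_log_le`). In total this is O(1 + n² log k), which involves only the first summand of
`circTime`; of the second, nonnegativity is enough.

Correctness and time are proved together by weakest preconditions `WP`; the time of a loop is paid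
by a potential (`WP_loop`). -/

noncomputable section

/-! ## Systems of arcs on a circle -/

/-- Arcs with centers `φ u` and half-lengths `h u`, where `u` and `u + n` describe the same arc
after one turn. -/
structure ArcSystem (n : ℕ) (φ h : ℤ → ℝ) : Prop where
  pos : 0 < n
  mono : Monotone φ
  center_add : ∀ u, φ (u + n) = φ u + 2 * π
  half_add : ∀ u, h (u + n) = h u
  half_nonneg : ∀ u, 0 ≤ h u

/-- The points in none of the open arcs. -/
def freeSet (φ h : ℤ → ℝ) : Set ℝ := {θ | ∀ u, θ ≤ φ u - h u ∨ φ u + h u ≤ θ}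

/-- Cyclic sequences of `k` points of `F` with consecutive differences at least `s`. -/
def HasChain (F : Set ℝ) (s : ℝ) (k : ℕ) : Prop :=
  ∃ θ : ℤ → ℝ, (∀ j, θ (j + k) = θ j + 2 * π) ∧ (∀ j, θ j + s ≤ θ (j + 1)) ∧ ∀ j, θ j ∈ F

/-- The first point of `F` from `p` on. -/
def nextPoint (F : Set ℝ) (p : ℝ) : ℝ := sInf (F ∩ Set.Ici p)

/-- The greedy sequence in `F` with step `s` that starts in `a`. -/
def greedy (F : Set ℝ) (s a : ℝ) : ℕ → ℝ
  | 0 => a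
  | m + 1 => nextPoint F (greedy F s a m + s)

namespace ArcSystem

variable {n : ℕ} {φ h : ℤ → ℝ}

theorem _root_.apply_add_mul {f : ℤ → ℝ} {n : ℕ} {c : ℝ} (hf : ∀ u, f (u + n) = f u + c)
    (u z : ℤ) : f (u + z * n) = f u + z * c := by
  induction z using Int.induction_on with
  | zero => simp
  | succ i ih =>
    have := hf (u + i * n)
    rw [show u + ((i:ℤ) + 1) * n = u + i * n + n by ring, this, ih]; push_cast; ring
  | pred i ih =>
    have := hf (u + (-i - 1) * n)
    rw [show u + (-(i:ℤ) - 1) * n + n = u + -i * n by ring, ih] at this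
    push_cast at *; linarith

theorem center_add_mul (H : ArcSystem n φ h) (u z : ℤ) : φ (u + z * n) = φ u + z * (2 * π) :=
  apply_add_mul H.center_add u z

theorem half_add_mul (H : ArcSystem n φ h) (u z : ℤ) : h (u + z * n) = h u := by
  simpa using apply_add_mul (c := 0) (fun u => by rw [H.half_add, add_zero]) u z

theorem isClosed_freeSet : IsClosed (freeSet φ h) := by
  have : freeSet φ h = ⋂ u, (Set.Iic (φ u - h u) ∪ Set.Ici (φ u + h u)) := by
    ext θ; simp [freeSet]
  rw [this]
  exact isClosed_iInter fun u => isClosed_Iic.union isClosed_Ici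

theorem add_mem (H : ArcSystem n φ h) {θ : ℝ} (hθ : θ ∈ freeSet φ h) (z : ℤ) :
    θ + z * (2 * π) ∈ freeSet φ h := by
  intro u
  have h1 := H.center_add_mul u (-z)
  have h2 := H.half_add_mul u (-z)
  have := hθ (u + -z * n)
  rw [h1, h2] at this
  push_cast at this
  rcases this with h | h
  · left; linarith
  · right; linarith

/-- The indices of centers around a given point. -/
theorem exists_sector (H : ArcSystem n φ h) (q : ℝ) : ∃ u, φ u ≤ q ∧ q < φ (u + 1) := by
  have hpi := Real.two_pi_pos
  have hbd : ∃ b, ∀ z, φ z ≤ q → z ≤ b := by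
    obtain ⟨N, hN⟩ := exists_nat_gt ((q - φ 0) / (2 * π))
    refine ⟨N * n, fun z hz => ?_⟩
    by_contra hlt
    push Not at hlt
    have := H.center_add_mul 0 N
    have h2 := H.mono hlt.le
    rw [zero_add] at this
    rw [div_lt_iff₀ hpi] at hN
    push_cast at *
    linarith
  have hex : ∃ z, φ z ≤ q := by
    obtain ⟨N, hN⟩ := exists_nat_gt ((φ 0 - q) / (2 * π))
    refine ⟨0 + (-N : ℤ) * n, ?_⟩
    rw [H.center_add_mul, ]
    rw [div_lt_iff₀ hpi] at hN
    push_cast; linarith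
  obtain ⟨u, hu, hmax⟩ := Int.exists_greatest_of_bdd hbd hex
  refine ⟨u, hu, ?_⟩
  by_contra hc
  push Not at hc
  have := hmax _ hc
  omega

/-- Used to replace an arbitrary index by the copy of the same arc within one prescribed turn, which
reduces statements about infinitely many arcs to `n` of them. -/
theorem exists_mul_mem_Ioc (H : ArcSystem n φ h) (w u : ℤ) :
    ∃ z : ℤ, u - n < w + z * n ∧ w + z * n ≤ u := by
  have hn : (0:ℤ) < n := by exact_mod_cast H.pos
  refine ⟨(u - w) / n, ?_, ?_⟩
  · have := Int.emod_lt_of_pos (u - w) hn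
    have h2 := Int.emod_add_mul_ediv (u - w) n
    nlinarith
  · have := Int.emod_nonneg (u - w) hn.ne'
    have h2 := Int.emod_add_mul_ediv (u - w) n
    nlinarith

/-- The last end of an arc with center at most `φ u`. -/
def lastEnd (φ h : ℤ → ℝ) (u : ℤ) : ℝ := sSup ((fun v => φ v + h v) '' Set.Iic u)

/-- The first start of an arc with center after `φ u`. -/
def firstStart (φ h : ℤ → ℝ) (u : ℤ) : ℝ := sInf ((fun v => φ v - h v) '' Set.Ioi u)

/-- The supremum is attained: an arc with index at most `u` has a copy with index in `(u - n, u]`,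
reached by `z ≥ 0` forward turns, and that copy ends no earlier. So the maximum over one turn is the
maximum over all. -/
theorem isGreatest_lastEnd (H : ArcSystem n φ h) (u : ℤ) :
    IsGreatest ((fun v => φ v + h v) '' Set.Iic u) (lastEnd φ h u) := by
  have hn : (0:ℤ) < n := by exact_mod_cast H.pos
  obtain ⟨v, hv, hmax⟩ := Finset.exists_max_image (Finset.Ioc (u - n) u) (fun v => φ v + h v)
    ⟨u, by simp [H.pos]⟩
  rw [Finset.mem_Ioc] at hv
  have key : IsGreatest ((fun v => φ v + h v) '' Set.Iic u) (φ v + h v) := by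
    refine ⟨⟨v, hv.2, rfl⟩, ?_⟩
    rintro _ ⟨w, hw, rfl⟩
    obtain ⟨z, h1, h2⟩ := H.exists_mul_mem_Ioc w u
    have h3 := hmax (w + z * n) (Finset.mem_Ioc.2 ⟨h1, h2⟩)
    simp only [H.center_add_mul, H.half_add_mul] at h3
    have hz : 0 ≤ z := by
      simp only [Set.mem_Iic] at hw
      by_contra hz
      push Not at hz
      nlinarith
    have : (0:ℝ) ≤ z := by exact_mod_cast hz
    have := Real.two_pi_pos
    simp only
    nlinarith
  unfold lastEnd
  rw [key.csSup_eq]; exact key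

theorem isLeast_firstStart (H : ArcSystem n φ h) (u : ℤ) :
    IsLeast ((fun v => φ v - h v) '' Set.Ioi u) (firstStart φ h u) := by
  have hn : (0:ℤ) < n := by exact_mod_cast H.pos
  obtain ⟨v, hv, hmin⟩ := Finset.exists_min_image (Finset.Ioc u (u + n)) (fun v => φ v - h v)
    ⟨u + n, by simp [H.pos]⟩
  rw [Finset.mem_Ioc] at hv
  have key : IsLeast ((fun v => φ v - h v) '' Set.Ioi u) (φ v - h v) := by
    refine ⟨⟨v, hv.1, rfl⟩, ?_⟩
    rintro _ ⟨w, hw, rfl⟩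
    obtain ⟨z, h1, h2⟩ := H.exists_mul_mem_Ioc w (u + n)
    have h3 := hmin (w + z * n) (Finset.mem_Ioc.2 ⟨by omega, h2⟩)
    simp only [H.center_add_mul, H.half_add_mul] at h3
    have hz : z ≤ 0 := by
      simp only [Set.mem_Ioi] at hw
      by_contra hz
      push Not at hz
      nlinarith
    have : (z:ℝ) ≤ 0 := by exact_mod_cast hz
    have := Real.two_pi_pos
    simp only
    nlinarith
  unfold firstStart
  rw [key.csInf_eq]; exact key

/-- A program scans indices from 0, not from `-∞`. By `n - 1 ≤ u` the scan has covered a whole turn,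
and the arcs before it are earlier copies of those seen. -/
theorem lastEnd_eq (H : ArcSystem n φ h) {u : ℤ} {m : ℝ} (hu : n - 1 ≤ u)
    (h1 : ∀ v, 0 ≤ v → v ≤ u → φ v + h v ≤ m) (h2 : ∃ v, v ≤ u ∧ m = φ v + h v) :
    lastEnd φ h u = m := by
  have hn : (0:ℤ) < n := by exact_mod_cast H.pos
  obtain ⟨v, hv, rfl⟩ := h2
  refine le_antisymm ?_ ((H.isGreatest_lastEnd u).2 ⟨v, hv, rfl⟩)
  obtain ⟨w, hw, h3⟩ := (H.isGreatest_lastEnd u).1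
  rw [← h3]
  obtain ⟨z, h4, h5⟩ := H.exists_mul_mem_Ioc w u
  have h6 := h1 (w + z * n) (by omega) h5
  rw [H.center_add_mul, H.half_add_mul] at h6
  have hz : 0 ≤ z := by
    simp only [Set.mem_Iic] at hw
    by_contra hz
    push Not at hz
    nlinarith
  have : (0:ℝ) ≤ z := by exact_mod_cast hz
  have := Real.two_pi_pos
  simp only
  nlinarith

/-- Counterpart of `lastEnd_eq` for a scan that comes down from `b`: the indices in `(u, b)` contain
a whole turn, and later copies start later. -/
theorem firstStart_eq (H : ArcSystem n φ h) {u b : ℤ} {m : ℝ} (hu : u + n < b)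
    (h1 : ∀ v, u < v → v < b → m ≤ φ v - h v) (h2 : ∃ v, u < v ∧ m = φ v - h v) :
    firstStart φ h u = m := by
  have hn : (0:ℤ) < n := by exact_mod_cast H.pos
  obtain ⟨v, hv, rfl⟩ := h2
  refine le_antisymm ((H.isLeast_firstStart u).2 ⟨v, hv, rfl⟩) ?_
  obtain ⟨w, hw, h3⟩ := (H.isLeast_firstStart u).1
  rw [← h3]
  obtain ⟨z, h4, h5⟩ := H.exists_mul_mem_Ioc w (u + n)
  have h6 := h1 (w + z * n) (by omega) (by omega)
  rw [H.center_add_mul, H.half_add_mul] at h6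
  have hz : z ≤ 0 := by
    simp only [Set.mem_Ioi] at hw
    by_contra hz
    push Not at hz
    nlinarith
  have : (z:ℝ) ≤ 0 := by exact_mod_cast hz
  have := Real.two_pi_pos
  simp only
  nlinarith

theorem lastEnd_mono (H : ArcSystem n φ h) : Monotone (lastEnd φ h) := by
  intro u v huv
  obtain ⟨w, hw, h2⟩ := (H.isGreatest_lastEnd u).1
  exact (H.isGreatest_lastEnd v).2 ⟨w, le_trans hw huv, h2⟩

theorem firstStart_mono (H : ArcSystem n φ h) : Monotone (firstStart φ h) := by
  intro u v huv
  obtain ⟨w, hw, h2⟩ := (H.isLeast_firstStart v).1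
  exact (H.isLeast_firstStart u).2 ⟨w, lt_of_le_of_lt huv hw, h2⟩

theorem lastEnd_add (H : ArcSystem n φ h) (u : ℤ) :
    lastEnd φ h (u + n) = lastEnd φ h u + 2 * π := by
  apply (H.isGreatest_lastEnd (u + n)).unique
  obtain ⟨⟨v, hv, hv'⟩, hmax⟩ := H.isGreatest_lastEnd u
  refine ⟨⟨v + n, by simpa using hv, by simp only [H.center_add, H.half_add, ← hv']; ring⟩, ?_⟩
  rintro _ ⟨w, hw, rfl⟩
  have := hmax ⟨w - n, by simp only [Set.mem_Iic] at *; omega, rfl⟩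
  have h1 := H.center_add (w - n)
  have h2 := H.half_add (w - n)
  rw [sub_add_cancel] at h1 h2
  simp only [h1, h2] at *; linarith

theorem firstStart_add (H : ArcSystem n φ h) (u : ℤ) :
    firstStart φ h (u + n) = firstStart φ h u + 2 * π := by
  apply (H.isLeast_firstStart (u + n)).unique
  obtain ⟨⟨v, hv, hv'⟩, hmax⟩ := H.isLeast_firstStart u
  refine ⟨⟨v + n, by simpa using hv, by simp only [H.center_add, H.half_add, ← hv']; ring⟩, ?_⟩
  rintro _ ⟨w, hw, rfl⟩
  have := hmax ⟨w - n, by simp only [Set.mem_Ioi] at *; omega, rfl⟩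
  have h1 := H.center_add (w - n)
  have h2 := H.half_add (w - n)
  rw [sub_add_cancel] at h1 h2
  simp only [h1, h2] at *; linarith

theorem lastEnd_add_mul (H : ArcSystem n φ h) (u z : ℤ) :
    lastEnd φ h (u + z * n) = lastEnd φ h u + z * (2 * π) :=
  apply_add_mul H.lastEnd_add u z

theorem firstStart_add_mul (H : ArcSystem n φ h) (u z : ℤ) :
    firstStart φ h (u + z * n) = firstStart φ h u + z * (2 * π) :=
  apply_add_mul H.firstStart_add u z

theorem mem_freeSet_of_le_of_le (H : ArcSystem n φ h) {u : ℤ} {p : ℝ} (h1 : lastEnd φ h u ≤ p)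
    (h2 : p ≤ firstStart φ h u) : p ∈ freeSet φ h := by
  intro v
  rcases le_or_gt v u with hv | hv
  · right; exact ((H.isGreatest_lastEnd u).2 ⟨v, hv, rfl⟩).trans h1
  · left; exact h2.trans ((H.isLeast_firstStart u).2 ⟨v, hv, rfl⟩)

/-- Gaps are indexed by the last center `φ u ≤ p`. As half-lengths are nonnegative, a free point
must be beyond the end of every arc centered at or before it and before the start of every arc
centered after it. -/
theorem exists_gap (H : ArcSystem n φ h) {p : ℝ} (hp : p ∈ freeSet φ h) :
    ∃ u, lastEnd φ h u ≤ p ∧ p ≤ firstStart φ h u := by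
  obtain ⟨u, h1, h2⟩ := H.exists_sector p
  refine ⟨u, ?_, ?_⟩
  · obtain ⟨v, hv, h3⟩ := (H.isGreatest_lastEnd u).1
    rw [← h3]
    have h4 := H.mono hv
    have := H.half_nonneg v
    rcases hp v with h | h <;> simp only at * <;> linarith
  · obtain ⟨v, hv, h3⟩ := (H.isLeast_firstStart u).1
    rw [← h3]
    have h4 := H.mono (show u + 1 ≤ v by simpa using hv)
    have := H.half_nonneg v
    rcases hp v with h | h <;> simp only at * <;> linarith

/-- Every free point can be moved back to the end of an arc. -/
theorem exists_end (H : ArcSystem n φ h) {p : ℝ} (hp : p ∈ freeSet φ h) :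
    ∃ v, φ v + h v ≤ p ∧ Set.Icc (φ v + h v) p ⊆ freeSet φ h := by
  obtain ⟨u, h1, h2⟩ := H.exists_gap hp
  obtain ⟨v, hv, h3⟩ := (H.isGreatest_lastEnd u).1
  simp only at h3
  exact ⟨v, h3 ▸ h1, fun q hq => H.mem_freeSet_of_le_of_le (h3 ▸ hq.1) (hq.2.trans h2)⟩

theorem exists_ge (H : ArcSystem n φ h) (hne : (freeSet φ h).Nonempty) (p : ℝ) :
    (freeSet φ h ∩ Set.Ici p).Nonempty := by
  obtain ⟨q, hq⟩ := hne
  obtain ⟨N, hN⟩ := exists_nat_gt ((p - q) / (2 * π))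
  rw [div_lt_iff₀ Real.two_pi_pos] at hN
  refine ⟨_, H.add_mem hq N, ?_⟩
  simp only [Set.mem_Ici]; push_cast; linarith

theorem isLeast_nextPoint (H : ArcSystem n φ h) (hne : (freeSet φ h).Nonempty) (p : ℝ) :
    IsLeast (freeSet φ h ∩ Set.Ici p) (nextPoint (freeSet φ h) p) :=
  ⟨(isClosed_freeSet.inter isClosed_Ici).csInf_mem (H.exists_ge hne p) ⟨p, fun _ hx => hx.2⟩,
    fun _ hx => csInf_le ⟨p, fun _ hx => hx.2⟩ hx⟩

/-- The point found can be moved back within `freeSet` to the end of an arc. If that end is at most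
`p`, then `p` itself is free; otherwise minimality places the point at that end. -/
theorem nextPoint_eq_or (H : ArcSystem n φ h) (hne : (freeSet φ h).Nonempty) (p : ℝ) :
    nextPoint (freeSet φ h) p = p ∨ ∃ v, nextPoint (freeSet φ h) p = φ v + h v := by
  obtain ⟨⟨h1, h2⟩, h3⟩ := H.isLeast_nextPoint hne p
  obtain ⟨v, hv, hI⟩ := H.exists_end h1
  simp only [Set.mem_Ici] at h2
  rcases le_total (φ v + h v) p with h4 | h4
  · left
    exact le_antisymm (h3 ⟨hI ⟨h4, h2⟩, Set.mem_Ici.2 le_rfl⟩) h2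
  · right
    exact ⟨v, le_antisymm (h3 ⟨hI ⟨le_rfl, hv⟩, h4⟩) hv⟩

/-- The form in which the decision procedure evaluates `nextPoint`: once the first nonempty gap
reaching `p` is known, one comparison suffices. A free point before that maximum would lie in an
earlier gap, and those end before `p`. -/
theorem nextPoint_eq_max (H : ArcSystem n φ h) {p : ℝ} {c : ℤ}
    (hlt : ∀ u < c, lastEnd φ h u ≤ firstStart φ h u → firstStart φ h u < p)
    (hc : lastEnd φ h c ≤ firstStart φ h c) (hp : p ≤ firstStart φ h c) :
    nextPoint (freeSet φ h) p = max p (lastEnd φ h c) := by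
  have hm : max p (lastEnd φ h c) ∈ freeSet φ h :=
    H.mem_freeSet_of_le_of_le (le_max_right _ _) (max_le hp hc)
  apply (H.isLeast_nextPoint ⟨_, hm⟩ p).unique
  refine ⟨⟨hm, Set.mem_Ici.2 (le_max_left _ _)⟩, ?_⟩
  rintro q ⟨hq, hpq⟩
  obtain ⟨u, h1, h2⟩ := H.exists_gap hq
  refine max_le hpq ?_
  by_contra hcon
  push Not at hcon
  have huc : u < c := by
    by_contra hh
    push Not at hh
    have := H.lastEnd_mono hh
    linarith
  have := hlt u huc (h1.trans h2)
  simp only [Set.mem_Ici] at hpq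
  linarith

theorem nextPoint_self (H : ArcSystem n φ h) {p : ℝ} (hp : p ∈ freeSet φ h) :
    nextPoint (freeSet φ h) p = p :=
  (H.isLeast_nextPoint ⟨_, hp⟩ p).unique ⟨⟨hp, Set.mem_Ici.2 le_rfl⟩, fun _ hq => hq.2⟩

theorem greedy_mem (H : ArcSystem n φ h) {a : ℝ} (ha : a ∈ freeSet φ h) (s : ℝ) (m : ℕ) :
    greedy (freeSet φ h) s a m ∈ freeSet φ h := by
  cases m with
  | zero => exact ha
  | succ m => exact (H.isLeast_nextPoint ⟨_, ha⟩ _).1.1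

theorem greedy_step (H : ArcSystem n φ h) {a : ℝ} (ha : a ∈ freeSet φ h) (s : ℝ) (m : ℕ) :
    greedy (freeSet φ h) s a m + s ≤ greedy (freeSet φ h) s a (m + 1) :=
  (H.isLeast_nextPoint ⟨_, ha⟩ _).1.2

theorem greedy_mono (H : ArcSystem n φ h) {a : ℝ} (ha : a ∈ freeSet φ h) {s : ℝ} (hs : 0 ≤ s) :
    Monotone (greedy (freeSet φ h) s a) :=
  monotone_nat_of_le_succ fun m => by have := H.greedy_step ha s m; linarith

/-- By induction, the next chain point is free and at least one step after the greedy point, so it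
competes in the minimum that defines `nextPoint`. -/
theorem greedy_le (H : ArcSystem n φ h) {θ : ℕ → ℝ} {s : ℝ}
    (hmem : ∀ j, θ j ∈ freeSet φ h) (hstep : ∀ j, θ j + s ≤ θ (j + 1)) (m : ℕ) :
    greedy (freeSet φ h) s (θ 0) m ≤ θ m := by
  induction m with
  | zero => exact le_rfl
  | succ m ih =>
    refine (H.isLeast_nextPoint ⟨_, hmem 0⟩ _).2 ⟨hmem _, ?_⟩
    have := hstep m
    simp only [Set.mem_Ici]; linarith

/-- Every point of a greedy sequence is reached by steps from the end of an arc. -/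
theorem greedy_eq (H : ArcSystem n φ h) {v : ℤ} (hv : φ v + h v ∈ freeSet φ h) (s : ℝ) (m : ℕ) :
    ∃ w : ℤ, ∃ t : ℕ, t ≤ m ∧ greedy (freeSet φ h) s (φ v + h v) m = φ w + h w + t * s := by
  induction m with
  | zero => exact ⟨v, 0, le_rfl, by simp [greedy]⟩
  | succ m ih =>
    rcases H.nextPoint_eq_or ⟨_, hv⟩ (greedy (freeSet φ h) s (φ v + h v) m + s) with h1 | ⟨w, h1⟩
    · obtain ⟨w, t, ht, h2⟩ := ih
      refine ⟨w, t + 1, by omega, ?_⟩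
      simp only [greedy, h1]; rw [h2]; push_cast; ring
    · exact ⟨w, 0, by omega, by simp only [greedy, h1]; simp⟩

end ArcSystem

/-! ### Closing sequences up around the circle -/

/-- The `ℤ`-indexed sequence that repeats `y 0, …, y (k-1)` turn by turn. -/
def unroll (k : ℕ) (y : ℕ → ℝ) (j : ℤ) : ℝ := y (j % k).toNat + (j / k : ℤ) * (2 * π)

theorem unroll_add {k : ℕ} (hk : 0 < k) (y : ℕ → ℝ) (j : ℤ) :
    unroll k y (j + k) = unroll k y j + 2 * π := by
  have : (k:ℤ) ≠ 0 := by omega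
  simp only [unroll, Int.add_emod_right]
  rw [Int.add_ediv_of_dvd_right (dvd_refl _), Int.ediv_self this]
  push_cast; ring

theorem unroll_step {k : ℕ} (hk : 0 < k) {y : ℕ → ℝ} {s : ℝ}
    (hy : ∀ m, m + 1 < k → y m + s ≤ y (m + 1)) (hlast : y (k - 1) + s ≤ y 0 + 2 * π) (j : ℤ) :
    unroll k y j + s ≤ unroll k y (j + 1) := by
  have hk' : (0:ℤ) < k := by omega
  have h1 := Int.emod_nonneg j hk'.ne'
  have h2 := Int.emod_lt_of_pos j hk'
  have h3 := Int.emod_add_mul_ediv j k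
  obtain ⟨m, hm⟩ := Int.eq_ofNat_of_zero_le h1
  simp only [unroll]
  rcases (show m + 1 < k ∨ m = k - 1 by omega) with h | h
  · have e1 : (j + 1) / (k:ℤ) = j / k := by
      rw [Int.ediv_eq_iff_of_pos hk']; constructor <;> nlinarith
    have e2 : (j + 1) % (k:ℤ) = m + 1 := by
      have := Int.emod_add_mul_ediv (j + 1) k; rw [e1] at this; omega
    rw [e1, e2, hm]
    have := hy m h
    simp only [Int.toNat_natCast]
    rw [show ((m:ℤ) + 1).toNat = m + 1 by omega]
    linarith
  · have hmk : (m:ℤ) = k - 1 := by omega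
    rw [hm, hmk] at h3
    have e1 : (j + 1) / (k:ℤ) = j / k + 1 := by
      rw [Int.ediv_eq_iff_of_pos hk']; constructor <;> nlinarith
    have e2 : (j + 1) % (k:ℤ) = 0 := by
      have := Int.emod_add_mul_ediv (j + 1) k; rw [e1] at this; linarith [mul_add (k:ℤ) (j / k) 1]
    rw [e1, e2, hm, h]
    simp only [Int.toNat_natCast, Int.toNat_zero]
    push_cast; linarith

namespace ArcSystem

variable {n : ℕ} {φ h : ℤ → ℝ}

theorem hasChain_of_greedy (H : ArcSystem n φ h) {a s : ℝ} {k : ℕ} (hk : 0 < k)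
    (ha : a ∈ freeSet φ h) (hlast : greedy (freeSet φ h) s a (k - 1) + s ≤ a + 2 * π) :
    HasChain (freeSet φ h) s k :=
  ⟨unroll k (greedy (freeSet φ h) s a), unroll_add hk _,
    unroll_step hk (fun m _ => H.greedy_step ha s m) hlast,
    fun _ => H.add_mem (H.greedy_mem ha s _) _⟩

/-- A chain can be rotated back until it contains the start of a gap. -/
theorem exists_greedy_of_hasChain (H : ArcSystem n φ h) {s : ℝ} {k : ℕ} (hk : 0 < k)
    (hc : HasChain (freeSet φ h) s k) : ∃ u : ℤ, n ≤ u ∧ u < 2 * n ∧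
      lastEnd φ h u ≤ firstStart φ h u ∧
      greedy (freeSet φ h) s (lastEnd φ h u) (k - 1) + s ≤ lastEnd φ h u + 2 * π := by
  obtain ⟨θ, hper, hstep, hmem⟩ := hc
  choose w hw hw' using fun j => H.exists_gap (hmem j)
  -- `δ` is the least distance of a chain point from the start of its gap. Rotating the whole chain
  -- back by `δ` leaves every point in its gap and brings point `j` to the start of its gap.
  obtain ⟨j, -, hmin⟩ := Finset.exists_min_image (Finset.Ico (0:ℤ) k)
    (fun j => θ j - lastEnd φ h (w j)) ⟨0, by simp [hk]⟩
  set δ := θ j - lastEnd φ h (w j) with hδ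
  have hδ0 : 0 ≤ δ := by have := hw j; linarith
  have hperm : ∀ i z : ℤ, θ (i + z * k) = θ i + z * (2 * π) := apply_add_mul hper
  have hfree : ∀ i, θ i - δ ∈ freeSet φ h := by
    intro i
    have hk' : (0:ℤ) < k := by omega
    have h1 := Int.emod_nonneg i hk'.ne'
    have h2 := Int.emod_lt_of_pos i hk'
    have h3 := Int.emod_add_mul_ediv i k
    have h4 := hmin (i % k) (Finset.mem_Ico.2 ⟨h1, h2⟩)
    have h5 := H.add_mem (H.mem_freeSet_of_le_of_le (u := w (i % k)) (p := θ (i % k) - δ)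
      (by linarith) (by linarith [hw' (i % k)])) (i / k)
    have h6 := hperm (i % k) (i / k)
    rw [show i % k + i / k * k = i by linarith [mul_comm (k:ℤ) (i / k)]] at h6
    rw [h6]
    convert h5 using 1; ring
  -- Full turns bring the index of the gap into `[n, 2n)`, the range that the program scans.
  obtain ⟨z, hz1, hz2⟩ := H.exists_mul_mem_Ioc (w j) (2 * n - 1)
  have e1 : lastEnd φ h (w j + z * n) = θ j - δ + z * (2 * π) := by
    rw [H.lastEnd_add_mul, hδ]; ring
  refine ⟨w j + z * n, by omega, by omega, ?_, ?_⟩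
  · rw [H.lastEnd_add_mul, H.firstStart_add_mul]; linarith [hw j, hw' j]
  · rw [e1]
    have := H.greedy_le (θ := fun m : ℕ => θ (j + m) - δ + z * (2 * π)) (s := s)
      (fun m => H.add_mem (hfree _) z)
      (fun m => by have := hstep (j + m); push_cast; rw [← add_assoc]; linarith) (k - 1)
    simp only [Nat.cast_zero, add_zero] at this
    have h7 := hstep (j + (k - 1 : ℕ))
    rw [show j + ((k - 1 : ℕ):ℤ) + 1 = j + k by omega, hper] at h7
    linarith

end ArcSystem

end

noncomputable section

/-! ## Half-arcs, steps and candidate radii as functions of the radius -/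

namespace RealRAM

theorem halfArc_nonneg (d r x : ℝ) : 0 ≤ halfArc d r x := arccos_nonneg _

theorem halfArc_le_pi (d r x : ℝ) : halfArc d r x ≤ π := arccos_le_pi _

theorem continuous_halfArc (d r : ℝ) : Continuous (halfArc d r) :=
  continuous_arccos.comp (by fun_prop)

theorem halfArc_mono {d r : ℝ} (hd : 0 < d) (hr : 0 < r) {x y : ℝ} (hx : 0 ≤ x) (hxy : x ≤ y) :
    halfArc d r x ≤ halfArc d r y := by
  apply antitone_arccos
  gcongr

theorem halfArc_zero {d r : ℝ} (hd : 0 < d) (hr : 0 < r) : halfArc d r 0 = 0 := by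
  apply arccos_of_one_le
  rw [le_div_iff₀ (by positivity)]
  nlinarith [sq_nonneg (d - r)]

/-- `arccos` is strictly decreasing where its argument is not clamped: `hpos` keeps the argument at
`x` below 1 and `hlt` keeps it above -1. If the argument at `y` has dropped below -1, the value
there is `π`, still larger. -/
theorem halfArc_strict {d r : ℝ} (hd : 0 < d) (hr : 0 < r) {x y : ℝ} (hx : 0 ≤ x) (hxy : x < y)
    (hpos : 0 < halfArc d r x) (hlt : x < d + r) : halfArc d r x < halfArc d r y := by
  have h2 : 0 < 2 * d * r := by positivity
  have h1 : (d ^ 2 + r ^ 2 - y ^ 2) / (2 * d * r) < (d ^ 2 + r ^ 2 - x ^ 2) / (2 * d * r) := by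
    gcongr
  have h3 : -1 < (d ^ 2 + r ^ 2 - x ^ 2) / (2 * d * r) := by
    rw [lt_div_iff₀ h2]; nlinarith
  have h4 : (d ^ 2 + r ^ 2 - x ^ 2) / (2 * d * r) < 1 := arccos_pos.1 hpos
  unfold halfArc
  rcases le_total (-1) ((d ^ 2 + r ^ 2 - y ^ 2) / (2 * d * r)) with h5 | h5
  · exact strictAntiOn_arccos ⟨h5, by linarith⟩ ⟨h3.le, h4.le⟩ h1
  · rw [arccos_of_le_neg_one h5]
    rcases (arccos_le_pi ((d ^ 2 + r ^ 2 - x ^ 2) / (2 * d * r))).lt_or_eq with h | h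
    · exact h
    · exact absurd (arccos_eq_pi.1 h) (by linarith)

theorem continuous_stepAngle (r α : ℝ) : Continuous (stepAngle r α) :=
  continuous_const.mul (continuous_arcsin.comp (by fun_prop))

theorem stepAngle_zero (r α : ℝ) : stepAngle r α 0 = 0 := by simp [stepAngle]

theorem stepAngle_mono {r α : ℝ} (hr : 0 < r) (hα : 0 < α) {x y : ℝ} (hxy : x ≤ y) :
    stepAngle r α x ≤ stepAngle r α y := by
  unfold stepAngle
  have : x / (2 * α * r) ≤ y / (2 * α * r) := by gcongr
  have := monotone_arcsin this
  linarith

theorem stepAngle_nonneg {r α : ℝ} (hr : 0 < r) (hα : 0 < α) {x : ℝ} (hx : 0 ≤ x) :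
    0 ≤ stepAngle r α x := by
  rw [← stepAngle_zero r α]; exact stepAngle_mono hr hα hx

theorem stepAngle_pos {r α : ℝ} (hr : 0 < r) (hα : 0 < α) {x : ℝ} (hx : 0 < x) :
    0 < stepAngle r α x := by
  have : 0 < x / (2 * α * r) := by positivity
  have := arcsin_pos.2 this
  unfold stepAngle; linarith

/-- The left-hand side of the equation that defines candidate radii. -/
def rootFn (d₁ d₂ r α : ℝ) (t : ℤ) (x : ℝ) : ℝ :=
  halfArc d₁ r x + halfArc d₂ r x + t * stepAngle r α x

section root
variable {ω d₁ d₂ r α : ℝ} {t : ℤ}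

theorem continuous_rootFn : Continuous (rootFn d₁ d₂ r α t) :=
  ((continuous_halfArc _ _).add (continuous_halfArc _ _)).add
    (continuous_const.mul (continuous_stepAngle _ _))

theorem rootFn_mono (h₁ : 0 < d₁) (h₂ : 0 < d₂) (hr : 0 < r) (hα : 0 < α) (ht : 0 ≤ t) {x y : ℝ}
    (hx : 0 ≤ x) (hxy : x ≤ y) : rootFn d₁ d₂ r α t x ≤ rootFn d₁ d₂ r α t y := by
  have h3 := halfArc_mono h₁ hr hx hxy
  have h4 := halfArc_mono h₂ hr hx hxy
  have h5 := stepAngle_mono hr hα hxy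
  have : (0:ℝ) ≤ t := by exact_mod_cast ht
  have := mul_le_mul_of_nonneg_left h5 this
  unfold rootFn; linarith

theorem rootFn_zero (h₁ : 0 < d₁) (h₂ : 0 < d₂) (hr : 0 < r) : rootFn d₁ d₂ r α t 0 = 0 := by
  simp [rootFn, halfArc_zero h₁ hr, halfArc_zero h₂ hr, stepAngle_zero]

theorem rootFn_mono_t (hr : 0 < r) (hα : 0 < α) {t t' : ℤ} (htt : t ≤ t') {x : ℝ} (hx : 0 ≤ x) :
    rootFn d₁ d₂ r α t x ≤ rootFn d₁ d₂ r α t' x := by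
  have : (t:ℝ) ≤ t' := by exact_mod_cast htt
  have := mul_le_mul_of_nonneg_right this (stepAngle_nonneg hr hα hx)
  unfold rootFn; linarith

theorem candidateRoot_bddAbove : BddAbove {x | 0 ≤ x ∧ x ≤ 2 * α * r ∧
    halfArc d₁ r x + halfArc d₂ r x + t * stepAngle r α x = ω} :=
  ⟨2 * α * r, fun _ h => h.2.1⟩

theorem le_candidateRoot {x : ℝ} (hx : 0 ≤ x) (hx' : x ≤ 2 * α * r)
    (h : rootFn d₁ d₂ r α t x = ω) : x ≤ candidateRoot ω d₁ d₂ r α t :=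
  le_csSup candidateRoot_bddAbove ⟨hx, hx', h⟩

theorem candidateRoot_spec {x : ℝ} (hx : 0 ≤ x) (hx' : x ≤ 2 * α * r)
    (h : rootFn d₁ d₂ r α t x = ω) : candidateRoot ω d₁ d₂ r α t ≤ 2 * α * r ∧
      rootFn d₁ d₂ r α t (candidateRoot ω d₁ d₂ r α t) = ω := by
  have hc : IsClosed {x | 0 ≤ x ∧ x ≤ 2 * α * r ∧
      halfArc d₁ r x + halfArc d₂ r x + t * stepAngle r α x = ω} :=
    (isClosed_le continuous_const continuous_id).inter
      ((isClosed_le continuous_id continuous_const).inter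
        (isClosed_eq continuous_rootFn continuous_const))
  have := hc.csSup_mem ⟨x, hx, hx', h⟩ candidateRoot_bddAbove
  exact ⟨this.2.1, this.2.2⟩

theorem candidateRoot_nonneg : 0 ≤ candidateRoot ω d₁ d₂ r α t :=
  Real.sSup_nonneg fun _ h => h.1

theorem candidateRoot_eq {x : ℝ} (hx : 0 ≤ x) (hx' : x ≤ 2 * α * r)
    (h : rootFn d₁ d₂ r α t x = ω)
    (hstrict : ∀ y, x < y → rootFn d₁ d₂ r α t x < rootFn d₁ d₂ r α t y) :
    candidateRoot ω d₁ d₂ r α t = x := by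
  refine le_antisymm ?_ (le_candidateRoot hx hx' h)
  by_contra hc
  push Not at hc
  have := hstrict _ hc
  rw [(candidateRoot_spec hx hx' h).2, h] at this
  exact lt_irrefl _ this

/-- Without a sign change below `b` there is no candidate radius in `(0, b)`. -/
theorem candidateRoot_not_mem (h₁ : 0 < d₁) (h₂ : 0 < d₂) (hr : 0 < r) (hα : 0 < α) (ht : 0 ≤ t)
    {b : ℝ} (hb : 0 ≤ b) (hb' : b ≤ 2 * α * r) (h : rootFn d₁ d₂ r α t b ≤ ω) :
    candidateRoot ω d₁ d₂ r α t = 0 ∨ b ≤ candidateRoot ω d₁ d₂ r α t := by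
  by_cases hne : ∃ x, 0 ≤ x ∧ x ≤ 2 * α * r ∧ rootFn d₁ d₂ r α t x = ω
  · right
    obtain ⟨x, h3, h4, h5⟩ := hne
    rcases le_total b x with hbx | hbx
    · exact hbx.trans (le_candidateRoot h3 h4 h5)
    · have := rootFn_mono h₁ h₂ hr hα ht h3 hbx
      exact le_candidateRoot hb hb' (by linarith)
  · left
    have : {x | 0 ≤ x ∧ x ≤ 2 * α * r ∧
        halfArc d₁ r x + halfArc d₂ r x + t * stepAngle r α x = ω} = ∅ := by
      ext x; simp only [Set.mem_ofPred_eq, Set.mem_empty_iff_false, iff_false]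
      exact fun h => hne ⟨x, h⟩
    rw [candidateRoot, this, Real.sSup_empty]

theorem candidateRoot_of_neg (h₁ : 0 < d₁) (h₂ : 0 < d₂) (hr : 0 < r) (hα : 0 < α) (ht : 0 ≤ t)
    (h : ω < 0) : candidateRoot ω d₁ d₂ r α t = 0 := by
  have : {x | 0 ≤ x ∧ x ≤ 2 * α * r ∧
      halfArc d₁ r x + halfArc d₂ r x + t * stepAngle r α x = ω} = ∅ := by
    ext x; simp only [Set.mem_ofPred_eq, Set.mem_empty_iff_false, iff_false]
    rintro ⟨h3, -, h4⟩
    have := rootFn_mono h₁ h₂ hr hα ht le_rfl h3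
    rw [rootFn_zero h₁ h₂ hr] at this
    unfold rootFn at this
    linarith
  rw [candidateRoot, this, Real.sSup_empty]

theorem candidateRoot_root (h₁ : 0 < d₁) (h₂ : 0 < d₂) (hr : 0 < r)
    {b : ℝ} (hb : 0 ≤ b) (hb' : b ≤ 2 * α * r) (hω : 0 ≤ ω) (h : ω < rootFn d₁ d₂ r α t b) :
    candidateRoot ω d₁ d₂ r α t ≤ 2 * α * r ∧
      rootFn d₁ d₂ r α t (candidateRoot ω d₁ d₂ r α t) = ω := by
  obtain ⟨x, ⟨h3, h4⟩, h5⟩ := intermediate_value_Icc hb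
    (continuous_rootFn (d₁ := d₁) (d₂ := d₂) (r := r) (α := α) (t := t)).continuousOn
    (show ω ∈ Set.Icc _ _ from ⟨by rw [rootFn_zero h₁ h₂ hr]; exact hω, h.le⟩)
  exact candidateRoot_spec h3 (h4.trans hb') h5

theorem candidateRoot_lt (h₁ : 0 < d₁) (h₂ : 0 < d₂) (hr : 0 < r) (hα : 0 < α) (ht : 0 ≤ t)
    {b : ℝ} (hb : 0 < b) (hb' : b ≤ 2 * α * r) (h : ω < rootFn d₁ d₂ r α t b) :
    candidateRoot ω d₁ d₂ r α t < b := by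
  rcases lt_or_ge ω 0 with hω | hω
  · rw [candidateRoot_of_neg h₁ h₂ hr hα ht hω]; exact hb
  obtain ⟨-, h4⟩ := candidateRoot_root h₁ h₂ hr hb.le hb' hω h
  by_contra hc
  push Not at hc
  have := rootFn_mono h₁ h₂ hr hα ht hb.le hc
  linarith

/-- More steps enlarge the left-hand side, so at the root `y` for `t'` the function for `t` is at
most `ω`. If `y` exceeded the root for `t`, monotonicity would force equality there, and `y` would
be a larger root for `t`. -/
theorem candidateRoot_anti (h₁ : 0 < d₁) (h₂ : 0 < d₂) (hr : 0 < r) (hα : 0 < α) (ht : 0 ≤ t)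
    {t' : ℤ} (htt : t ≤ t') {b : ℝ} (hb : 0 < b) (hb' : b ≤ 2 * α * r)
    (h : ω < rootFn d₁ d₂ r α t b) :
    candidateRoot ω d₁ d₂ r α t' ≤ candidateRoot ω d₁ d₂ r α t := by
  rcases lt_or_ge ω 0 with hω | hω
  · rw [candidateRoot_of_neg h₁ h₂ hr hα ht hω,
      candidateRoot_of_neg h₁ h₂ hr hα (ht.trans htt) hω]
  obtain ⟨h3, h4⟩ := candidateRoot_root h₁ h₂ hr hb.le hb' hω h
  obtain ⟨h5, h6⟩ := candidateRoot_root h₁ h₂ hr hb.le hb' hω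
    (h.trans_le (rootFn_mono_t hr hα htt hb.le))
  set x := candidateRoot ω d₁ d₂ r α t
  set y := candidateRoot ω d₁ d₂ r α t'
  have hy0 : 0 ≤ y := candidateRoot_nonneg
  by_contra hc
  push Not at hc
  have h7 : rootFn d₁ d₂ r α t y ≤ ω := by rw [← h6]; exact rootFn_mono_t hr hα htt hy0
  have h8 := rootFn_mono h₁ h₂ hr hα ht candidateRoot_nonneg hc.le
  rw [h4] at h8
  exact absurd (le_candidateRoot hy0 h5 (le_antisymm h7 h8)) (not_le.2 hc)

end root

end RealRAM

/-! ### Arcs that grow with the radius -/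

open RealRAM

/-- Arcs with centers `φ u` that depend on the radius, as the forbidden arcs of demand points at
the distances `D u`. -/
structure Demands (n : ℕ) (φ D : ℤ → ℝ) : Prop where
  pos : 0 < n
  mono : Monotone φ
  center_add : ∀ u, φ (u + n) = φ u + 2 * π
  dist_add : ∀ u, D (u + n) = D u
  dist_pos : ∀ u, 0 < D u
  first_nonneg : 0 ≤ φ 0
  last_lt : φ (n - 1) < 2 * π

namespace Demands

variable {n : ℕ} {φ D : ℤ → ℝ}

theorem arcSystem (H : Demands n φ D) (r x : ℝ) :
    ArcSystem n φ (fun u => halfArc (D u) r x) :=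
  ⟨H.pos, H.mono, H.center_add, fun u => by rw [H.dist_add], fun _ => halfArc_nonneg _ _ _⟩

/-- The points of the circle at distance at least `x` from all demand points. -/
abbrev free (φ D : ℤ → ℝ) (r x : ℝ) : Set ℝ := freeSet φ (fun u => halfArc (D u) r x)

/-- Finitely many pairs suffice. Shift by full turns so that `0 ≤ i < n`. The angle `φ j - φ i` is
positive because the second half-arc is, and below `4π`: two half-arcs of at most `π` each and steps
of total less than `2π`. This gives `0 ≤ j < 3n`. Beyond `x` the second half-arc grows strictly at
`x`, so `x` is the largest root, as `candidateRoot` requires. -/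
theorem exists_candidate_of_eq (H : Demands n φ D) {r α x : ℝ} (hr : 0 < r) (hα : 0 < α)
    (hx : 0 < x) (hx' : x ≤ 2 * α * r) (hD : ∀ u, x < D u + r) {k : ℕ}
    (hk : k * stepAngle r α x < 2 * π) {v w : ℤ} {t : ℕ} (ht : t < k)
    (hw : 0 < halfArc (D w) r x)
    (heq : φ v + halfArc (D v) r x + t * stepAngle r α x = φ w - halfArc (D w) r x) :
    ∃ i j : ℤ, 0 ≤ i ∧ i < n ∧ 0 ≤ j ∧ j < 3 * n ∧
      x = candidateRoot (φ j - φ i) (D i) (D j) r α t := by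
  have A := H.arcSystem r x
  have hs := stepAngle_pos hr hα hx
  obtain ⟨z, hz1, hz2⟩ := A.exists_mul_mem_Ioc v (n - 1)
  have e1 := A.center_add_mul v z
  have e2 := A.center_add_mul w z
  have e3 := A.half_add_mul v z
  have e4 := A.half_add_mul w z
  have hD' : ∀ u, D (u + z * n) = D u := fun u => (⟨H.pos, H.mono, H.center_add, H.dist_add,
    fun u => (H.dist_pos u).le⟩ : ArcSystem n φ D).half_add_mul u z
  set i := v + z * n with hi
  set j := w + z * n with hj
  have hroot : rootFn (D i) (D j) r α (t : ℤ) x = φ j - φ i := by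
    simp only [rootFn]; rw [e3, e4, e1, e2]; push_cast; linarith
  have hts : (t:ℝ) * stepAngle r α x < 2 * π := by
    refine lt_trans ?_ hk
    gcongr
  have hpos : 0 < φ j - φ i := by
    rw [← hroot]
    simp only [rootFn]
    rw [e4]
    have h1 := halfArc_nonneg (D i) r x
    have : 0 ≤ ((t:ℤ):ℝ) * stepAngle r α x := by positivity
    linarith
  have hlt : φ j - φ i < 4 * π := by
    rw [← hroot]
    simp only [rootFn]
    have h1 := halfArc_le_pi (D i) r x
    have h2 := halfArc_le_pi (D j) r x
    push_cast; linarith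
  refine ⟨i, j, by omega, by omega, ?_, ?_, ?_⟩
  · by_contra hc
    push Not at hc
    have h1 := H.mono (show j ≤ -1 by omega)
    have h2 := H.mono (show 0 ≤ i by omega)
    have h3 := H.center_add (-1)
    rw [show (-1 : ℤ) + n = n - 1 by ring] at h3
    have := H.last_lt
    have := H.first_nonneg
    linarith
  · by_contra hc
    push Not at hc
    have h1 := H.mono hc
    have h2 := H.mono (show i ≤ n - 1 by omega)
    have h3 := A.center_add_mul 0 3
    rw [zero_add] at h3
    have := H.last_lt
    have := H.first_nonneg
    push_cast at h3
    linarith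
  · refine (candidateRoot_eq hx.le hx' hroot fun y hy => ?_).symm
    have h1 := halfArc_mono (H.dist_pos i) hr hx.le hy.le
    have h2 := halfArc_strict (H.dist_pos j) hr hx.le hy (by rw [e4]; exact hw) (hD j)
    have h3 := stepAngle_mono hr hα hy.le
    have : ((t:ℤ):ℝ) * stepAngle r α x ≤ ((t:ℤ):ℝ) * stepAngle r α y := by gcongr
    simp only [rootFn]; linarith

/-- One turn of indices is enough for all radii at once, so this is a finite maximum of continuous
functions of the radius. -/
theorem continuous_lastEnd (H : Demands n φ D) (r : ℝ) (u : ℤ) :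
    Continuous fun x => ArcSystem.lastEnd φ (fun u => halfArc (D u) r x) u := by
  have hne : (Finset.Ioc (u - n) u).Nonempty := ⟨u, by simp [H.pos]⟩
  have : (fun x => ArcSystem.lastEnd φ (fun u => halfArc (D u) r x) u) =
      fun x => (Finset.Ioc (u - n) u).sup' hne (fun v => φ v + halfArc (D v) r x) := by
    funext x
    have A := H.arcSystem r x
    apply (A.isGreatest_lastEnd u).unique
    constructor
    · obtain ⟨v, hv, h2⟩ := Finset.exists_mem_eq_sup' hne (fun v => φ v + halfArc (D v) r x)
      exact ⟨v, (Finset.mem_Ioc.1 hv).2, h2.symm⟩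
    · rintro _ ⟨w, hw, rfl⟩
      obtain ⟨z, h1, h2⟩ := A.exists_mul_mem_Ioc w u
      refine le_trans ?_ (Finset.le_sup' (fun v => φ v + halfArc (D v) r x)
        (Finset.mem_Ioc.2 ⟨h1, h2⟩))
      have h3 := A.half_add_mul w z
      simp only at h3 ⊢
      rw [h3, A.center_add_mul]
      have hn : (0:ℤ) < n := by exact_mod_cast H.pos
      have hz : 0 ≤ z := by
        simp only [Set.mem_Iic] at hw
        by_contra hz
        push Not at hz
        nlinarith
      have : (0:ℝ) ≤ z := by exact_mod_cast hz
      have := Real.two_pi_pos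
      nlinarith
  rw [this]
  exact Continuous.finset_sup'_apply hne fun v _ => continuous_const.add (continuous_halfArc _ _)

end Demands

end

/-! ### Persistence of chains away from candidate radii -/

noncomputable section
open RealRAM

namespace Demands

variable {n : ℕ} {φ D : ℤ → ℝ}

/-- The combinatorial core: a chain for the radius `x` can be kept for a slightly larger radius,
unless `x` is a candidate radius. -/
theorem eventually_hasChain (H : Demands n φ D) {r α x : ℝ} (hr : 0 < r) (hα : 0 < α)
    (hx : 0 < x) (hx' : x ≤ 2 * α * r) (hD : ∀ u, x < D u + r) {k : ℕ} (hk0 : 0 < k)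
    (hk : k * stepAngle r α x < 2 * π) (hc : HasChain (free φ D r x) (stepAngle r α x) k)
    (hno : ∀ i j : ℤ, ∀ t : ℕ, 0 ≤ i → i < n → 0 ≤ j → j < 3 * n → t < k →
      x ≠ candidateRoot (φ j - φ i) (D i) (D j) r α t) :
    ∀ᶠ y in nhds x, HasChain (free φ D r y) (stepAngle r α y) k := by
  have S := H.arcSystem r x
  set h := fun u => halfArc (D u) r x with hh
  set s := stepAngle r α x with hs
  -- Replace the given chain by a greedy one from the start of a gap: each of its points is either
  -- one step after its predecessor or at the end of an arc.
  obtain ⟨u₀, -, -, hu₀, hlast⟩ := S.exists_greedy_of_hasChain hk0 hc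
  obtain ⟨v, -, hv⟩ := (S.isGreatest_lastEnd u₀).1
  replace hv : ArcSystem.lastEnd φ h u₀ = φ v + h v := hv.symm
  rw [hv] at hu₀ hlast
  replace hv := S.mem_freeSet_of_le_of_le hv.le hu₀
  set g := greedy (freeSet φ h) s (φ v + h v) with hg
  set θ := unroll k g with hθ
  have hkz : (0:ℤ) < k := by omega
  have hper : ∀ j, θ (j + k) = θ j + 2 * π := unroll_add hk0 g
  have hstep : ∀ j, θ j + s ≤ θ (j + 1) := unroll_step hk0 (fun m _ => S.greedy_step hv s m) hlast
  have hmem : ∀ j, θ j ∈ freeSet φ h := fun j => S.add_mem (S.greedy_mem hv s _) _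
  -- every point is some steps after the end of an arc
  have hlabel : ∀ j, ∃ w : ℤ, ∃ t : ℕ, t < k ∧ θ j = φ w + h w + t * s := by
    intro j
    obtain ⟨w, t, ht, h1⟩ := S.greedy_eq hv s (j % k).toNat
    have h2 := Int.emod_lt_of_pos j hkz
    refine ⟨w + (j / k) * n, t, by omega, ?_⟩
    rw [hθ, unroll, hg, h1, S.center_add_mul, S.half_add_mul]; ring
  have htight : ∀ j, θ (j + 1) = θ j + s ∨ ∃ w, θ (j + 1) = φ w + h w := by
    intro j
    have h1 := Int.emod_nonneg j hkz.ne'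
    have h2 := Int.emod_lt_of_pos j hkz
    have h3 := Int.emod_add_mul_ediv j k
    have h1' := Int.emod_nonneg (j + 1) hkz.ne'
    have h3' := Int.emod_add_mul_ediv (j + 1) k
    rcases (show j % k + 1 < k ∨ j % k + 1 = k by omega) with h4 | h4
    · have e1 : (j + 1) / (k:ℤ) = j / k := by
        rw [Int.ediv_eq_iff_of_pos hkz]; constructor <;> nlinarith
      have e2 : ((j + 1) % (k:ℤ)).toNat = (j % k).toNat + 1 := by rw [e1] at h3'; omega
      rcases S.nextPoint_eq_or ⟨_, hv⟩ (g (j % k).toNat + s) with h5 | ⟨w, h5⟩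
      · left
        simp only [hθ, unroll, e1, e2]
        rw [show g ((j % k).toNat + 1) = g (j % k).toNat + s from h5]; ring
      · right
        refine ⟨w + (j / k) * n, ?_⟩
        simp only [hθ, unroll, e1, e2]
        rw [S.center_add_mul, S.half_add_mul,
          show g ((j % k).toNat + 1) = φ w + h w from h5]; ring
    · right
      have e1 : (j + 1) / (k:ℤ) = j / k + 1 := by
        rw [Int.ediv_eq_iff_of_pos hkz]; constructor <;> nlinarith
      have e2 : ((j + 1) % (k:ℤ)).toNat = 0 := by
        rw [e1] at h3'
        have : (j + 1) % (k:ℤ) = 0 := by linarith [mul_add (k:ℤ) (j / k) 1]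
        omega
      refine ⟨v + (j / k + 1) * n, ?_⟩
      simp only [hθ, unroll, e1, e2]
      rw [S.center_add_mul, S.half_add_mul]
      simp only [hg, greedy]; ring
  choose u hu1 hu2 using fun j => S.exists_sector (θ j)
  have hA : ∀ j, ArcSystem.lastEnd φ h (u j) ≤ θ j := by
    intro j
    obtain ⟨w, hw, h3⟩ := (S.isGreatest_lastEnd (u j)).1
    rw [← h3]
    have h4 := S.mono hw
    have := S.half_nonneg w
    rcases hmem j w with h | h <;> simp only at * <;> linarith [hu1 j]
  -- This recursion involves only quantities that depend continuously on the radius once the gap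
  -- indices `u` are frozen; the chains for nearby radii are defined by it.
  have hmax : ∀ j, θ (j + 1) = max (θ j + s) (ArcSystem.lastEnd φ h (u (j + 1))) := by
    intro j
    refine le_antisymm ?_ (max_le (hstep j) (hA _))
    rcases htight j with h1 | ⟨w, h1⟩
    · exact le_max_of_le_left h1.le
    · apply le_max_of_le_right
      rw [h1]
      refine (S.isGreatest_lastEnd _).2 ⟨w, ?_, rfl⟩
      by_contra hcon
      simp only [Set.mem_Iic, not_le] at hcon
      have h2 := S.mono (show u (j + 1) + 1 ≤ w by omega)
      have := hu2 (j + 1)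
      have := S.half_nonneg w
      linarith
  -- The only use of `hno`. Equality would mean that some steps lead from the end of an arc exactly
  -- to the start of another, so that `x` would be a candidate. The other arc has positive length
  -- since its center lies strictly ahead.
  have hB : ∀ j w, u j < w → θ j < φ w - h w := by
    intro j w hw
    have h2 := S.mono (show u j + 1 ≤ w by omega)
    have h3 := hu2 j
    have h4 : θ j ≤ φ w - h w := by
      rcases hmem j w with h | h
      · exact h
      · have := S.half_nonneg w; linarith
    refine lt_of_le_of_ne h4 fun heq => ?_
    obtain ⟨w', t, ht, h5⟩ := hlabel j
    obtain ⟨i, l, hi, hi', hl, hl', h6⟩ := H.exists_candidate_of_eq hr hα hx hx' hD hk ht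
      (v := w') (w := w) (show 0 < h w by linarith) (show φ w' + h w' + t * s = φ w - h w by linarith)
    exact hno i l t hi hi' hl hl' ht h6
  -- somewhere there is slack
  obtain ⟨b, hb⟩ : ∃ b, θ b + s < θ (b + 1) := by
    by_contra hcon
    push Not at hcon
    -- With no slack anywhere a full turn would measure at most `k * s < 2π`.
    have : ∀ m : ℕ, θ m ≤ θ 0 + m * s := by
      intro m
      induction m with
      | zero => simp
      | succ m ih => have := hcon m; push_cast; linarith
    have h1 := this k
    have h2 := hper 0
    rw [zero_add] at h2
    linarith
  -- After the slack the maximum is attained by the end of an arc, so the perturbed chain can be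
  -- started afresh at that end without reference to the point before it.
  have hbA : θ (b + 1) = ArcSystem.lastEnd φ h (u (b + 1)) := by
    have := hmax b
    rcases max_choice (θ b + s) (ArcSystem.lastEnd φ h (u (b + 1))) with h1 | h1
    · rw [h1] at this; linarith
    · rw [h1] at this; exact this
  -- the perturbed chain
  let L : ℕ → ℝ → ℝ := fun m y => ArcSystem.lastEnd φ (fun u => halfArc (D u) r y) (u (b + 1 + m))
  let ψ : ℕ → ℝ → ℝ := fun m => Nat.rec (L 0) (fun m f y => max (f y + stepAngle r α y) (L (m + 1) y)) m
  have hψs : ∀ m y, ψ (m + 1) y = max (ψ m y + stepAngle r α y) (L (m + 1) y) := fun _ _ => rfl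
  have hLc : ∀ m, Continuous (L m) := fun m => H.continuous_lastEnd r _
  have hψc : ∀ m, Continuous (ψ m) := by
    intro m
    induction m with
    | zero => exact hLc 0
    | succ m ih => exact (ih.add (continuous_stepAngle r α)).max (hLc _)
  have hψx : ∀ m : ℕ, ψ m x = θ (b + 1 + m) := by
    intro m
    induction m with
    | zero => simp only [Nat.cast_zero, add_zero]; rw [hbA]; simp [ψ, L, hh]
    | succ m ih =>
      rw [hψs, ih]
      have := hmax (b + 1 + m)
      rw [show b + 1 + ((m + 1 : ℕ):ℤ) = b + 1 + m + 1 by push_cast; ring, this]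
      simp only [L]
      rw [show b + 1 + ((m + 1 : ℕ):ℤ) = b + 1 + m + 1 by push_cast; ring]
  have hLψ : ∀ m y, L m y ≤ ψ m y := by
    intro m y
    cases m with
    | zero => exact le_rfl
    | succ m => exact le_max_right _ _
  -- The chain closes up with strict inequality because the slack sits at the closing step.
  have ev1 : ∀ᶠ y in nhds x, ψ (k - 1) y + stepAngle r α y < ψ 0 y + 2 * π := by
    refine ContinuousAt.eventually_lt ((hψc _).add (continuous_stepAngle r α)).continuousAt
      ((hψc 0).add continuous_const).continuousAt ?_
    rw [hψx, hψx]
    have h1 := hper b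
    have h2 := hper (b + 1)
    rw [show b + 1 + ((k - 1 : ℕ):ℤ) = b + k by omega]
    simp only [Nat.cast_zero, add_zero]
    linarith
  -- Only one turn of arcs ahead is considered, to have finitely many strict inequalities;
  -- periodicity yields the others.
  have ev2 : ∀ᶠ y in nhds x, ∀ m ∈ Finset.range k, ∀ w ∈ Finset.Ioc (u (b + 1 + m)) (u (b + 1 + m) + n),
      ψ m y < φ w - halfArc (D w) r y := by
    rw [Filter.eventually_all_finset]
    intro m _
    rw [Filter.eventually_all_finset]
    intro w hw
    refine ContinuousAt.eventually_lt (hψc _).continuousAt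
      (continuous_const.sub (continuous_halfArc _ _)).continuousAt ?_
    rw [hψx]
    exact hB _ w (Finset.mem_Ioc.1 hw).1
  filter_upwards [ev1, ev2] with y h1 h2
  have T := H.arcSystem r y
  have hfree : ∀ m, m < k → ψ m y ∈ free φ D r y := by
    intro m hm
    refine T.mem_freeSet_of_le_of_le (u := u (b + 1 + m)) (hLψ m y) ?_
    obtain ⟨w, hw, h3⟩ := (T.isLeast_firstStart (u (b + 1 + m))).1
    obtain ⟨z, hz1, hz2⟩ := T.exists_mul_mem_Ioc w (u (b + 1 + m) + n)
    have h4 := h2 m (Finset.mem_range.2 hm) (w + z * n) (Finset.mem_Ioc.2 ⟨by omega, hz2⟩)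
    have h5 := T.half_add_mul w z
    rw [h5, T.center_add_mul] at h4
    rw [← h3]
    have hz : z ≤ 0 := by
      have hn : (0:ℤ) < n := by exact_mod_cast H.pos
      simp only [Set.mem_Ioi] at hw
      by_contra hz
      push Not at hz
      nlinarith
    have : (z:ℝ) ≤ 0 := by exact_mod_cast hz
    have := Real.two_pi_pos
    simp only
    nlinarith
  refine ⟨unroll k (fun m => ψ m y), unroll_add hk0 _,
    unroll_step hk0 (fun m _ => le_max_left _ _) h1.le, fun j => T.add_mem (hfree _ ?_) _⟩
  have h3 := Int.emod_lt_of_pos j hkz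
  have h4 := Int.emod_nonneg j hkz.ne'
  omega

end Demands

end

noncomputable section
open RealRAM

/-! ## Distances to points of a circle -/

/-- The law of cosines. -/
theorem dist_circlePoint_sq (o q : Plane) (r θ d φ : ℝ) (h0 : q 0 - o 0 = d * cos φ)
    (h1 : q 1 - o 1 = d * sin φ) :
    dist q (circlePoint o r θ) ^ 2 = d ^ 2 + r ^ 2 - 2 * d * r * cos (θ - φ) := by
  rw [EuclideanSpace.dist_eq, Real.sq_sqrt (Finset.sum_nonneg fun _ _ => sq_nonneg _)]
  simp only [Fin.sum_univ_two, circlePoint, PiLp.add_apply, Real.dist_eq, sq_abs, cos_sub]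
  simp only [Matrix.cons_val_zero, Matrix.cons_val_one]
  rw [show q 0 - (o 0 + r * cos θ) = d * cos φ - r * cos θ by rw [← h0]; ring,
    show q 1 - (o 1 + r * sin θ) = d * sin φ - r * sin θ by rw [← h1]; ring]
  linear_combination d ^ 2 * cos_sq_add_sin_sq φ + r ^ 2 * cos_sq_add_sin_sq θ

theorem dist_center_circlePoint (o : Plane) {r : ℝ} (hr : 0 ≤ r) (θ : ℝ) :
    dist o (circlePoint o r θ) = r := by
  have := dist_circlePoint_sq o o r θ 0 0 (by simp) (by simp)
  rw [← Real.sqrt_sq dist_nonneg, this, show (0:ℝ) ^ 2 + r ^ 2 - 2 * 0 * r * cos (θ - 0) = r ^ 2 by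
    ring, Real.sqrt_sq hr]

theorem dist_circlePoint_circlePoint (o : Plane) {r : ℝ} (hr : 0 ≤ r) (θ η : ℝ) :
    dist (circlePoint o r θ) (circlePoint o r η) = 2 * r * |sin ((η - θ) / 2)| := by
  have := dist_circlePoint_sq o (circlePoint o r θ) r η r θ (by simp [circlePoint])
    (by simp [circlePoint])
  rw [← Real.sqrt_sq dist_nonneg, this, 
    ← Real.sqrt_sq (show 0 ≤ 2 * r * |sin ((η - θ) / 2)| by positivity)]
  congr 1
  rw [mul_pow, sq_abs, sin_sq_eq_half_sub, show 2 * ((η - θ) / 2) = η - θ by ring]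
  ring

/-- A demand point `q`, as seen from the circle, is in direction `φ` at distance `D` from the
center. -/
structure IsPolar (o : Plane) (r : ℝ) (q : Plane) (φ D : ℝ) : Prop where
  pos : 0 < D
  le : dist q o ≤ D
  far : ∀ x, 0 ≤ x → x ≤ dist q o + r → ∀ θ, x ≤ dist q (circlePoint o r θ) ↔
    ∀ z : ℤ, θ + z * (2 * π) ≤ φ - halfArc D r x ∨ φ + halfArc D r x ≤ θ + z * (2 * π)

/-- By the law of cosines, distance at least `x` means `cos (θ - φ) ≤ c` with `halfArc = arccos c`.
The bound `x ≤ dist q o + r` gives `-1 ≤ c`, so clamping can occur only for `c > 1`, where the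
forbidden arc is empty. -/
theorem isPolar_of_pos {o q : Plane} {r φ : ℝ} (hr : 0 < r) (hd : 0 < dist q o)
    (h0 : q 0 - o 0 = dist q o * cos φ) (h1 : q 1 - o 1 = dist q o * sin φ) :
    IsPolar o r q φ (dist q o) := by
  refine ⟨hd, le_rfl, fun x hx hx' θ => ?_⟩
  have hsq := dist_circlePoint_sq o q r θ _ φ h0 h1
  set d := dist q o with hdd
  have h2 : 0 < 2 * d * r := by positivity
  set c := (d ^ 2 + r ^ 2 - x ^ 2) / (2 * d * r) with hc
  have hc1 : -1 ≤ c := by rw [hc, le_div_iff₀ h2]; nlinarith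
  have key : x ≤ dist q (circlePoint o r θ) ↔ cos (θ - φ) ≤ c := by
    rw [← abs_of_nonneg hx, ← abs_of_nonneg (dist_nonneg (x := q)), ← sq_le_sq, hsq, hc,
      le_div_iff₀ h2]
    constructor <;> intro <;> nlinarith
  rw [key]
  have hH : halfArc d r x = arccos c := rfl
  rw [hH]
  have hcos : ∀ z : ℤ, cos (θ - φ) = cos |θ + z * (2 * π) - φ| := by
    intro z
    rw [cos_abs, show θ + z * (2 * π) - φ = θ - φ + z * (2 * π) by ring, cos_add_int_mul_two_pi]
  constructor
  · intro hle z
    by_contra hcon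
    push Not at hcon
    have h3 : |θ + z * (2 * π) - φ| < arccos c := by
      rw [abs_lt]; constructor <;> linarith
    have h4 := strictAntiOn_cos ⟨abs_nonneg _, h3.le.trans (arccos_le_pi c)⟩
      ⟨arccos_nonneg c, arccos_le_pi c⟩ h3
    rw [← hcos z] at h4
    rcases le_total c 1 with h5 | h5
    · rw [cos_arccos hc1 h5] at h4; linarith
    · rw [arccos_of_one_le h5] at h3
      exact absurd h3 (not_lt.2 (abs_nonneg _))
  · intro hz
    -- Choose the representative of the angle within `π` of `φ`, where `cos` is monotone in the
    -- absolute difference.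
    obtain ⟨z, hz1, hz2⟩ : ∃ z : ℤ, -π < θ + z * (2 * π) - φ ∧ θ + z * (2 * π) - φ ≤ π := by
      obtain ⟨z, hz, -⟩ := existsUnique_add_zsmul_mem_Ioc Real.two_pi_pos (θ - φ) (-π)
      rw [zsmul_eq_mul, Set.mem_Ioc] at hz
      exact ⟨z, by linarith [hz.1], by linarith [hz.2]⟩
    rcases le_total 1 c with h5 | h5
    · exact (cos_le_one _).trans h5
    rw [hcos z, ← cos_arccos hc1 h5]
    apply cos_le_cos_of_nonneg_of_le_pi (arccos_nonneg c) (abs_le.2 ⟨hz1.le, hz2⟩)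
    rcases hz z with h6 | h6
    · rw [abs_of_nonpos (by linarith [arccos_nonneg c])]; linarith
    · rw [abs_of_nonneg (by linarith [arccos_nonneg c])]; linarith

/-- A demand point at the center has no direction, and all points of the circle are at distance `r`
from it. The fictitious distance `2r` makes the half-arc vanish for every `x ≤ r`, because the
argument of `arccos` is then at least 1; the direction is arbitrary. -/
theorem isPolar_center (o : Plane) {r : ℝ} (hr : 0 < r) (φ : ℝ) : IsPolar o r o φ (2 * r) := by
  refine ⟨by positivity, by rw [dist_self]; positivity, fun x hx hx' θ => ?_⟩
  rw [dist_self, zero_add] at hx'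
  rw [dist_center_circlePoint o hr.le]
  have : halfArc (2 * r) r x = 0 := by
    apply arccos_of_one_le
    rw [le_div_iff₀ (by positivity)]
    nlinarith
  rw [this]
  simp only [hx', true_iff, sub_zero, add_zero]
  exact fun z => le_total _ _

/-- Chords of length at least `x / α` in terms of angles. -/
theorem le_chord_iff {r α x Δ : ℝ} (hr : 0 < r) (hα : 0 < α) (hx : 0 ≤ x) (hx' : x ≤ 2 * α * r)
    (h0 : 0 ≤ Δ) (h1 : Δ ≤ 2 * π) :
    x ≤ α * (2 * r * |sin (Δ / 2)|) ↔ stepAngle r α x ≤ Δ ∧ Δ ≤ 2 * π - stepAngle r α x := by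
  have h2 : 0 < 2 * α * r := by positivity
  have hs : 0 ≤ sin (Δ / 2) := sin_nonneg_of_nonneg_of_le_pi (by linarith) (by linarith)
  rw [abs_of_nonneg hs]
  have h3 : x ≤ α * (2 * r * sin (Δ / 2)) ↔ x / (2 * α * r) ≤ sin (Δ / 2) := by
    rw [div_le_iff₀ h2]; constructor <;> intro <;> linarith
  rw [h3]
  have h4 : 0 ≤ x / (2 * α * r) := by positivity
  have h5 : x / (2 * α * r) ≤ 1 := by rw [div_le_one h2]; exact hx'
  have hm : x / (2 * α * r) ∈ Set.Icc (-1:ℝ) 1 := ⟨by linarith, h5⟩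
  unfold stepAngle
  rcases le_total (Δ / 2) (π / 2) with h6 | h6
  · rw [← arcsin_le_iff_le_sin hm ⟨by linarith, h6⟩]
    have := arcsin_le_pi_div_two (x / (2 * α * r))
    constructor
    · intro h; constructor <;> linarith
    · intro h; linarith [h.1]
  · rw [← sin_pi_sub, ← arcsin_le_iff_le_sin hm ⟨by linarith, by linarith⟩]
    have := arcsin_le_pi_div_two (x / (2 * α * r))
    constructor
    · intro h; constructor <;> linarith
    · intro h; linarith [h.2]

/-! ## The objective -/

section objective
variable {α : ℝ} {n k : ℕ} {p : Fin n → Plane} {c : Fin k → Plane}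

theorem le_circObjective_iff (hn : 0 < n) (hk : 0 < k) (hα : 0 < α) {x : ℝ} :
    x ≤ circObjective α p c ↔
      (∀ i j, x ≤ dist (p i) (c j)) ∧ ∀ i, x ≤ α * dist (c i) (c (finRotate k i)) := by
  have : Nonempty (Fin n) := ⟨⟨0, hn⟩⟩
  have : Nonempty (Fin k) := ⟨⟨0, hk⟩⟩
  rw [circObjective, le_min_iff]
  apply and_congr
  · rw [le_ciInf_iff (Set.finite_range _).bddBelow]
    exact forall_congr' fun i => le_ciInf_iff (Set.finite_range _).bddBelow
  · rw [Real.mul_iInf_of_nonneg hα.le, le_ciInf_iff (Set.finite_range _).bddBelow]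

theorem circObjective_nonneg (hα : 0 ≤ α) : 0 ≤ circObjective α p c :=
  le_min (Real.iInf_nonneg fun _ => Real.iInf_nonneg fun _ => dist_nonneg)
    (mul_nonneg hα (Real.iInf_nonneg fun _ => dist_nonneg))

/-- A single facility is its own cyclic neighbor, so the second term of the objective is zero. -/
theorem isCircOptimum_one (hn : 0 < n) (hα : 0 < α) (o : Plane) (r : ℝ) :
    IsCircOptimum α o r p 1 0 := by
  have key : ∀ c : Fin 1 → Plane, circObjective α p c = 0 := by
    intro c
    refine le_antisymm ?_ (circObjective_nonneg hα.le)
    have := ((le_circObjective_iff (p := p) (c := c) hn one_pos hα).1 le_rfl).2 0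
    rwa [Subsingleton.elim (finRotate 1 0) 0, dist_self, mul_zero] at this
  refine ⟨⟨fun _ => circlePoint o r 0, ⟨fun _ => 0, monotone_const, fun _ _ => ?_, fun _ => rfl⟩,
    (key _).symm⟩, ?_⟩
  · have := Real.two_pi_pos; linarith
  · rintro _ ⟨c, -, rfl⟩; exact (key c).le

theorem continuous_circObjective (hn : 0 < n) (hk : 0 < k) (o : Plane) (r : ℝ) :
    Continuous fun θ : Fin k → ℝ => circObjective α p fun j => circlePoint o r (θ j) := by
  have : Nonempty (Fin n) := ⟨⟨0, hn⟩⟩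
  have : Nonempty (Fin k) := ⟨⟨0, hk⟩⟩
  have hc : Continuous (circlePoint o r) := by
    unfold circlePoint
    refine continuous_const.add ?_
    refine (PiLp.continuous_toLp 2 _).comp ?_
    refine continuous_pi fun i => ?_
    fin_cases i <;> simp <;> fun_prop
  unfold circObjective
  simp only [← Finset.inf'_univ_eq_ciInf]
  refine Continuous.min ?_ (continuous_const.mul ?_)
  · refine Continuous.finset_inf'_apply _ fun i _ => Continuous.finset_inf'_apply _ fun j _ => ?_
    exact continuous_const.dist (hc.comp (continuous_apply j))
  · refine Continuous.finset_inf'_apply _ fun i _ => ?_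
    exact (hc.comp (continuous_apply _)).dist (hc.comp (continuous_apply _))

theorem circlePoint_add (o : Plane) (r θ : ℝ) (z : ℤ) :
    circlePoint o r (θ + z * (2 * π)) = circlePoint o r θ := by
  simp [circlePoint, cos_add_int_mul_two_pi, sin_add_int_mul_two_pi]

/-- Compactness: subtracting full turns puts the first angle into `[0, 2π)` and hence all of them
into `[0, 4π]`, so the continuous objective is maximized over a compact set of angle vectors. -/
theorem exists_isCircOptimum (hn : 0 < n) (hk : 0 < k) (α : ℝ) (o : Plane) (r : ℝ)
    (p : Fin n → Plane) : ∃ v, IsCircOptimum α o r p k v := by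
  have hpi := Real.two_pi_pos
  let K : Set (Fin k → ℝ) := {θ | (∀ i, θ i ∈ Set.Icc 0 (4 * π)) ∧ Monotone θ ∧
    ∀ i j, θ j ≤ θ i + 2 * π}
  have hK : IsCompact K := by
    refine IsCompact.of_isClosed_subset (isCompact_univ_pi fun _ => isCompact_Icc
      (a := (0:ℝ)) (b := 4 * π)) ?_ (fun θ hθ i _ => hθ.1 i)
    have e : K = (⋂ i, {θ : Fin k → ℝ | 0 ≤ θ i ∧ θ i ≤ 4 * π}) ∩
        ((⋂ i, ⋂ j, ⋂ _ : i ≤ j, {θ : Fin k → ℝ | θ i ≤ θ j}) ∩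
          ⋂ i, ⋂ j, {θ : Fin k → ℝ | θ j ≤ θ i + 2 * π}) := by
      ext θ
      simp only [K, Set.mem_inter_iff, Set.mem_iInter, Set.mem_ofPred_eq, Set.mem_Icc]
      rfl
    rw [e]
    refine (isClosed_iInter fun i => ?_).inter ((isClosed_iInter fun i => isClosed_iInter fun j =>
      isClosed_iInter fun _ => ?_).inter (isClosed_iInter fun i => isClosed_iInter fun j => ?_))
    · exact (isClosed_le continuous_const (continuous_apply i)).inter
        (isClosed_le (continuous_apply i) continuous_const)
    · exact isClosed_le (continuous_apply i) (continuous_apply j)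
    · exact isClosed_le (continuous_apply j) ((continuous_apply i).add continuous_const)
  have hne : K.Nonempty := ⟨fun _ => 0, fun _ => ⟨le_rfl, by linarith⟩, monotone_const,
    fun _ _ => by linarith⟩
  obtain ⟨θ, hθ, hmax⟩ := hK.exists_isMaxOn hne
    (continuous_circObjective (α := α) (p := p) hn hk o r).continuousOn
  refine ⟨_, ⟨_, ⟨θ, hθ.2.1, hθ.2.2, fun _ => rfl⟩, rfl⟩, ?_⟩
  rintro _ ⟨c, ⟨η, hη1, hη2, hη3⟩, rfl⟩
  obtain ⟨z, hz, -⟩ := existsUnique_add_zsmul_mem_Ico Real.two_pi_pos (η ⟨0, hk⟩) 0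
  rw [zsmul_eq_mul, Set.mem_Ico, zero_add] at hz
  have hm : (fun j => η j + z * (2 * π)) ∈ K := by
    refine ⟨fun i => ?_, fun i j hij => by simpa using hη1 hij, fun i j => by linarith [hη2 i j]⟩
    have h1 : η ⟨0, hk⟩ ≤ η i := hη1 (Fin.mk_le_of_le_val (Nat.zero_le _))
    have h2 := hη2 ⟨0, hk⟩ i
    constructor <;> linarith
  have := hmax hm
  simp only [Set.mem_ofPred_eq, circlePoint_add] at this
  rw [show c = fun j => circlePoint o r (η j) from funext hη3]
  exact this

end objective

end

/-! ### From placements to chains, and the optimum as a candidate radius -/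

noncomputable section
open RealRAM

/-- The data computed from an instance: the demand points in polar form, sorted by direction, and
an upper bound `X` for the optimum. -/
structure IsReduction (α : ℝ) (o : Plane) (r : ℝ) {n : ℕ} (p : Fin n → Plane) (k : ℕ)
    (φ D : ℤ → ℝ) (X : ℝ) : Prop where
  demands : Demands n φ D
  exists_index : ∀ i, ∃ u : ℤ, IsPolar o r (p i) (φ u) (D u)
  exists_point : ∀ u : ℤ, 0 ≤ u → u < n → ∃ i, IsPolar o r (p i) (φ u) (D u)
  cap_le : X ≤ 2 * α * r * sin (π / k)
  cap_le_dist : ∀ i, X ≤ dist (p i) o + r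
  cap_eq : X = 2 * α * r * sin (π / k) ∨ ∃ i, X = dist (p i) o + r

namespace IsReduction

variable {α r : ℝ} {o : Plane} {n k : ℕ} {p : Fin n → Plane} {φ D : ℤ → ℝ} {X : ℝ}

theorem exists_point_add (H : IsReduction α o r p k φ D X) (u : ℤ) :
    ∃ i, ∃ z : ℤ, IsPolar o r (p i) (φ u + z * (2 * π)) (D u) := by
  have A : ArcSystem n φ D := ⟨H.demands.pos, H.demands.mono, H.demands.center_add,
    H.demands.dist_add, fun u => (H.demands.dist_pos u).le⟩
  obtain ⟨z, h1, h2⟩ := A.exists_mul_mem_Ioc u (n - 1)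
  obtain ⟨i, hi⟩ := H.exists_point (u + z * n) (by omega) (by omega)
  rw [A.center_add_mul, A.half_add_mul] at hi
  exact ⟨i, z, hi⟩

theorem pos (H : IsReduction α o r p k φ D X) (hk : 2 ≤ k) (hα : 0 < α) (hr : 0 < r) : 0 < X := by
  rcases H.cap_eq with h | ⟨i, h⟩
  · rw [h]
    have hk' : (2:ℝ) ≤ k := by exact_mod_cast hk
    have : 0 < sin (π / k) := by
      apply sin_pos_of_pos_of_lt_pi (by positivity)
      exact div_lt_self Real.pi_pos (by linarith)
    positivity
  · rw [h]; positivity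

theorem cap_le' (H : IsReduction α o r p k φ D X) (hα : 0 < α) (hr : 0 < r) : X ≤ 2 * α * r := by
  refine H.cap_le.trans (mul_le_of_le_one_right (by positivity) (sin_le_one _))

/-- Strictly below the cap the `k` steps do not fill the turn. This is the slack on which
`Demands.eventually_hasChain` relies. -/
theorem mul_stepAngle_le (H : IsReduction α o r p k φ D X) (hk : 2 ≤ k) (hα : 0 < α) (hr : 0 < r)
    {x : ℝ} (hx : x < X) : k * stepAngle r α x < 2 * π := by
  have hk' : (2:ℝ) ≤ k := by exact_mod_cast hk
  have h2 : 0 < 2 * α * r := by positivity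
  have h1 : x / (2 * α * r) < sin (π / k) := by
    rw [div_lt_iff₀ h2]; linarith [H.cap_le]
  have h3 : π / k ≤ π / 2 := by gcongr
  have h4 : 0 < π / k := by positivity
  have h5 : arcsin (x / (2 * α * r)) < π / k :=
    (arcsin_lt_iff_lt_sin' ⟨by linarith, h3⟩).2 h1
  unfold stepAngle
  have : (k:ℝ) * (2 * arcsin (x / (2 * α * r))) < k * (2 * (π / k)) := by gcongr
  rwa [show (k:ℝ) * (2 * (π / k)) = 2 * π by field_simp] at this

/-- Placements of value at least `x` correspond to chains. -/
theorem hasChain_iff (H : IsReduction α o r p k φ D X) (hk : 2 ≤ k) (hα : 0 < α) (hr : 0 < r)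
    {x : ℝ} (hx : 0 < x) (hxX : x ≤ X) :
    HasChain (Demands.free φ D r x) (stepAngle r α x) k ↔
      ∃ c : Fin k → Plane, IsCircPlacement o r c ∧ x ≤ circObjective α p c := by
  have hpi := Real.two_pi_pos
  have hx2 := hxX.trans (H.cap_le' hα hr)
  have hn := H.demands.pos
  have hs := stepAngle_nonneg hr hα hx.le
  have hfree : ∀ θ, θ ∈ Demands.free φ D r x ↔ ∀ i, x ≤ dist (p i) (circlePoint o r θ) := by
    intro θ
    have A := H.demands.arcSystem r x
    constructor
    · intro h i
      obtain ⟨u, hu⟩ := H.exists_index i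
      rw [hu.far x hx.le (hxX.trans (H.cap_le_dist i))]
      exact fun z => A.add_mem h z u
    · intro h u
      obtain ⟨i, z, hu⟩ := H.exists_point_add u
      have := (hu.far x hx.le (hxX.trans (H.cap_le_dist i)) θ).1 (h i) z
      rcases this with h | h
      · left; linarith
      · right; linarith
  obtain ⟨l, rfl⟩ : ∃ l, k = l + 1 := ⟨k - 1, by omega⟩
  -- A chord bounds the angle on both sides: it is at least one step and at most a full turn minus
  -- one step. The last pair wraps around and is treated separately.
  have hobj : ∀ θ : Fin (l + 1) → ℝ, (∀ i j, θ j ≤ θ i + 2 * π) → Monotone θ →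
      (x ≤ circObjective α p (fun j => circlePoint o r (θ j)) ↔
        (∀ j, θ j ∈ Demands.free φ D r x) ∧
        (∀ j : Fin l, θ j.castSucc + stepAngle r α x ≤ θ j.succ ∧
          θ j.succ ≤ θ j.castSucc + 2 * π - stepAngle r α x) ∧
        (θ (Fin.last l) + stepAngle r α x ≤ θ 0 + 2 * π ∧
          θ 0 + stepAngle r α x ≤ θ (Fin.last l))) := by
    intro θ h1 h2
    rw [le_circObjective_iff hn (by omega) hα]
    apply and_congr
    · simp only [hfree]; exact ⟨fun h j i => h i j, fun h i j => h j i⟩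
    rw [Fin.forall_fin_succ', finRotate_last]
    apply and_congr
    · refine forall_congr' fun j => ?_
      rw [finRotate_apply, Fin.coeSucc_eq_succ, dist_circlePoint_circlePoint o hr.le, le_chord_iff hr hα hx.le hx2]
      · constructor <;> rintro ⟨h3, h4⟩ <;> constructor <;> linarith
      · linarith [h2 (Fin.castSucc_le_succ j)]
      · linarith [h1 j.castSucc j.succ]
    · rw [dist_comm, dist_circlePoint_circlePoint o hr.le, le_chord_iff hr hα hx.le hx2]
      · constructor <;> rintro ⟨h3, h4⟩ <;> constructor <;> linarith
      · linarith [h2 (Fin.zero_le (Fin.last l))]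
      · linarith [h1 0 (Fin.last l)]
  constructor
  · rintro ⟨θ, hper, hstep, hmem⟩
    have hmono : Monotone θ := monotone_int_of_le_succ fun j => by linarith [hstep j]
    have hm : Monotone (fun j : Fin (l + 1) => θ (j : ℕ)) := fun i j hij =>
      hmono (by exact_mod_cast hij)
    have hb : ∀ i j : Fin (l + 1), θ (j : ℕ) ≤ θ (i : ℕ) + 2 * π := fun i j => by
      rw [← hper]; apply hmono; push_cast; omega
    refine ⟨fun j => circlePoint o r (θ (j : ℕ)), ⟨_, hm, hb, fun _ => rfl⟩, ?_⟩
    rw [hobj _ hb hm]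
    refine ⟨fun j => hmem _, fun j => ⟨?_, ?_⟩, ?_, ?_⟩
    · have := hstep j; simpa using this
    -- The complementary arc contains at least one further step of the chain, because `k ≥ 2`.
    · have h1 := hper j
      have h2 := hstep (j + 1)
      have h3 := hmono (show (j:ℤ) + 1 + 1 ≤ j + (l + 1 : ℕ) by push_cast; omega)
      simp only [Fin.val_succ, Fin.val_castSucc]; push_cast at *; linarith
    · have h1 := hstep l
      have h2 := hper 0
      rw [zero_add] at h2
      simp only [Fin.val_last, Fin.val_zero]; push_cast at *; linarith
    · have h1 := hstep 0
      have h3 := hmono (show (0:ℤ) + 1 ≤ l by omega)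
      simp only [Fin.val_last, Fin.val_zero]; push_cast at *; linarith
  · rintro ⟨c, ⟨θ, hm, hb, hc⟩, hobj'⟩
    rw [show c = fun j => circlePoint o r (θ j) from funext hc, hobj θ hb hm] at hobj'
    obtain ⟨h1, h2, h3, h4⟩ := hobj'
    have A := H.demands.arcSystem r x
    -- The value 0 is never used: `unroll` reads only the indices below `l + 1`.
    let y : ℕ → ℝ := fun m => if h : m < l + 1 then θ ⟨m, h⟩ else 0
    refine ⟨unroll (l + 1) y, unroll_add (by omega) y, unroll_step (by omega) ?_ ?_, fun j => ?_⟩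
    · intro m hm'
      have := (h2 ⟨m, by omega⟩).1
      simp only [y, dif_pos hm', dif_pos (show m < l + 1 by omega)]
      exact this
    · simp only [y, add_tsub_cancel_right, dif_pos (show l < l + 1 by omega),
        dif_pos (show 0 < l + 1 by omega)]
      exact h3
    · refine A.add_mem ?_ _
      have h5 := Int.emod_lt_of_pos j (show (0:ℤ) < (l + 1 : ℕ) by positivity)
      have h6 := Int.emod_nonneg j (show ((l + 1 : ℕ):ℤ) ≠ 0 by positivity)
      have h7 : (j % (l + 1 : ℕ)).toNat < l + 1 := by omega
      simp only [y, dif_pos h7]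
      exact h1 _

/-- If all scaled chords exceeded `2αr sin(π/k)`, every angular step would exceed `2π/k` and
together they would exceed a full turn. The other bound is the triangle inequality through the
center. -/
theorem circObjective_le (H : IsReduction α o r p k φ D X) (hk : 2 ≤ k) (hα : 0 < α) (hr : 0 < r)
    {c : Fin k → Plane} (hc : IsCircPlacement o r c) : circObjective α p c ≤ X := by
  have hpi := Real.pi_pos
  have hn := H.demands.pos
  obtain ⟨θ, hm, hb, hc⟩ := hc
  obtain ⟨h1, h2⟩ := (le_circObjective_iff (p := p) (c := c) hn (by omega) hα).1 le_rfl
  rcases H.cap_eq with h | ⟨i, h⟩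
  · by_contra hcon
    push Not at hcon
    rw [h] at hcon
    obtain ⟨l, rfl⟩ : ∃ l, k = l + 1 := ⟨k - 1, by omega⟩
    set k' : ℝ := ((l + 1 : ℕ) : ℝ) with hk'
    have hk2 : (2:ℝ) ≤ k' := by rw [hk']; exact_mod_cast hk
    have key : ∀ Δ, 0 ≤ Δ → 2 * α * r * sin (π / k') < α * (2 * r * |sin (Δ / 2)|) →
        2 * (π / k') < Δ := by
      intro Δ h0 h3
      by_contra h4
      push Not at h4
      have h5 : π / k' ≤ π / 2 := by gcongr
      have h6 : sin (Δ / 2) ≤ sin (π / k') :=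
        sin_le_sin_of_le_of_le_pi_div_two (by linarith) h5 (by linarith)
      rw [abs_of_nonneg (sin_nonneg_of_nonneg_of_le_pi (by linarith) (by linarith))] at h3
      have : 2 * α * r * sin (Δ / 2) ≤ 2 * α * r * sin (π / k') := by gcongr
      linarith
    have hstep : ∀ j : Fin l, θ j.castSucc + 2 * (π / k') < θ j.succ := by
      intro j
      have h3 := h2 j.castSucc
      rw [finRotate_apply, Fin.coeSucc_eq_succ, hc, hc, dist_circlePoint_circlePoint o hr.le] at h3
      have := key (θ j.succ - θ j.castSucc) (by linarith [hm (Fin.castSucc_le_succ j)])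
        (hcon.trans_le h3)
      linarith
    have hlast : θ (Fin.last l) + 2 * (π / k') < θ 0 + 2 * π := by
      have h3 := h2 (Fin.last l)
      rw [finRotate_last, hc, hc, dist_circlePoint_circlePoint o hr.le] at h3
      have h4 : sin ((θ 0 - θ (Fin.last l)) / 2) =
          sin ((θ 0 + 2 * π - θ (Fin.last l)) / 2 - π) := by congr 1; ring
      rw [h4, sin_sub_pi, abs_neg] at h3
      have := key (θ 0 + 2 * π - θ (Fin.last l)) (by linarith [hb 0 (Fin.last l)])
        (hcon.trans_le h3)
      linarith
    have hind : ∀ m (hm : m < l + 1), θ 0 + m * (2 * (π / k')) ≤ θ ⟨m, hm⟩ := by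
      intro m
      induction m with
      | zero => intro _; simp
      | succ m ih =>
        intro hm
        have h3 := ih (by omega)
        have h4 := hstep ⟨m, by omega⟩
        simp only [Fin.castSucc_mk, Fin.succ_mk] at h4
        push_cast
        linarith
    have h3 := hind l (by omega)
    have h4 : (θ (Fin.last l)) = θ ⟨l, by omega⟩ := rfl
    have h5 : (l:ℝ) = k' - 1 := by rw [hk']; push_cast; ring
    have h6 : k' * (2 * (π / k')) = 2 * π := by field_simp
    rw [h5] at h3
    linarith
  · rw [h]
    refine (h1 i ⟨0, by omega⟩).trans ((dist_triangle _ o _).trans ?_)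
    rw [hc, dist_center_circlePoint o hr.le]

theorem isCircOptimum_of_hasChain (H : IsReduction α o r p k φ D X) (hk : 2 ≤ k) (hα : 0 < α)
    (hr : 0 < r) (hc : HasChain (Demands.free φ D r X) (stepAngle r α X) k) :
    IsCircOptimum α o r p k X := by
  obtain ⟨c, h1, h2⟩ := (H.hasChain_iff hk hα hr (H.pos hk hα hr) le_rfl).1 hc
  refine ⟨⟨c, h1, le_antisymm h2 (H.circObjective_le hk hα hr h1)⟩, ?_⟩
  rintro _ ⟨c, hc, rfl⟩
  exact H.circObjective_le hk hα hr hc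

/-- The optimum is the largest candidate radius that admits a chain. -/
theorem isCircOptimum_of_no_candidate (H : IsReduction α o r p k φ D X) (hk : 2 ≤ k) (hα : 0 < α)
    (hr : 0 < r) {lo hi : ℝ} (h0 : 0 ≤ lo) (hhi : hi ≤ X) (hlh : lo < hi)
    (hlo : lo = 0 ∨ HasChain (Demands.free φ D r lo) (stepAngle r α lo) k)
    (hnot : ¬ HasChain (Demands.free φ D r hi) (stepAngle r α hi) k)
    (hno : ∀ i j : ℤ, ∀ t : ℕ, 0 ≤ i → i < n → 0 ≤ j → j < 3 * n → t < k →
      ¬ (lo < candidateRoot (φ j - φ i) (D i) (D j) r α t ∧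
        candidateRoot (φ j - φ i) (D i) (D j) r α t < hi)) :
    IsCircOptimum α o r p k lo := by
  obtain ⟨v, hv⟩ := exists_isCircOptimum H.demands.pos (show 0 < k by omega) α o r p
  suffices v = lo by rwa [← this]
  have hle : lo ≤ v := by
    rcases hlo with h | h
    · rw [h]
      obtain ⟨c, hc, h1⟩ := hv.1
      rw [h1]; exact circObjective_nonneg hα.le
    · rcases h0.eq_or_lt with h2 | h2
      · rw [← h2]
        obtain ⟨c, hc, h1⟩ := hv.1
        rw [h1]; exact circObjective_nonneg hα.le
      · obtain ⟨c, hc, h1⟩ := (H.hasChain_iff hk hα hr h2 (by linarith)).1 h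
        exact h1.trans (hv.2 ⟨c, hc, rfl⟩)
  by_contra hne
  have hlt : lo < v := lt_of_le_of_ne hle (Ne.symm hne)
  obtain ⟨⟨c, hc, h1⟩, hmax⟩ := hv
  have hvhi : v < hi := by
    by_contra hcon
    push Not at hcon
    exact hnot ((H.hasChain_iff hk hα hr (by linarith) hhi).2 ⟨c, hc, h1 ▸ hcon⟩)
  have hv0 : 0 < v := by linarith
  have hchain := (H.hasChain_iff hk hα hr hv0 (by linarith)).2 ⟨c, hc, h1.le⟩
  -- An optimum `v` strictly inside the bracket is not a candidate, so its chain persists for some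
  -- larger radius below `hi`, against maximality.
  have hev := H.demands.eventually_hasChain hr hα hv0
    (by linarith [H.cap_le' hα hr]) (fun u => by
      obtain ⟨i, z, hi⟩ := H.exists_point_add u
      have := H.cap_le_dist i
      have := hi.le
      linarith) (show 0 < k by omega) (H.mul_stepAngle_le hk hα hr (by linarith)) hchain
    (fun i j t h1 h2 h3 h4 h5 heq => hno i j t h1 h2 h3 h4 h5 (by rw [← heq]; exact ⟨hlt, hvhi⟩))
  obtain ⟨y, hy1, hy2, hy3⟩ := ((hev.filter_mono nhdsWithin_le_nhds).and
    (Ioo_mem_nhdsGT hvhi)).exists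
  obtain ⟨c', hc', h2⟩ := (H.hasChain_iff hk hα hr (by linarith) (by linarith)).1 hy1
  have := hmax ⟨c', hc', rfl⟩
  linarith

end IsReduction

end

namespace RealRAM

noncomputable section

/-! ## Reasoning about programs -/

/-- Contents of an integer register. -/
def Store.I (σ : Store) (x : ℕ) : ℤ := σ.var .int x
/-- Contents of a real register. -/
def Store.R (σ : Store) (x : ℕ) : ℝ := σ.var .real x
/-- Contents of a real array. -/
def Store.A (σ : Store) (a : ℕ) (i : ℤ) : ℝ := σ.arr .real a i

def Store.setI (σ : Store) (x : ℕ) (v : ℤ) : Store := σ.setVar .int x v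
def Store.setR (σ : Store) (x : ℕ) (v : ℝ) : Store := σ.setVar .real x v
def Store.setA (σ : Store) (a : ℕ) (i : ℤ) (v : ℝ) : Store := σ.setArr .real a i v

theorem Store.I_setI (σ : Store) (x y : ℕ) (v : ℤ) :
    (σ.setI x v).I y = if y = x then v else σ.I y := by
  by_cases h : y = x
  · subst h; simp [Store.I, Store.setI, Store.setVar]
  · simp [Store.I, Store.setI, Store.setVar, h]

theorem Store.R_setI (σ : Store) (x y : ℕ) (v : ℤ) : (σ.setI x v).R y = σ.R y := by
  simp [Store.R, Store.setI, Store.setVar]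

theorem Store.A_setI (σ : Store) (x a : ℕ) (v : ℤ) : (σ.setI x v).A a = σ.A a := rfl

theorem Store.R_setR (σ : Store) (x y : ℕ) (v : ℝ) :
    (σ.setR x v).R y = if y = x then v else σ.R y := by
  by_cases h : y = x
  · subst h; simp [Store.R, Store.setR, Store.setVar]
  · simp [Store.R, Store.setR, Store.setVar, h]

theorem Store.I_setR (σ : Store) (x y : ℕ) (v : ℝ) : (σ.setR x v).I y = σ.I y := by
  simp [Store.I, Store.setR, Store.setVar]

theorem Store.A_setR (σ : Store) (x a : ℕ) (v : ℝ) : (σ.setR x v).A a = σ.A a := rfl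

theorem Store.I_setA (σ : Store) (x a : ℕ) (i : ℤ) (v : ℝ) : (σ.setA a i v).I x = σ.I x := rfl

theorem Store.R_setA (σ : Store) (x a : ℕ) (i : ℤ) (v : ℝ) : (σ.setA a i v).R x = σ.R x := rfl

theorem Store.A_setA (σ : Store) (a b : ℕ) (i : ℤ) (v : ℝ) :
    (σ.setA a i v).A b = if b = a then Function.update (σ.A a) i v else σ.A b := by
  by_cases h : b = a
  · subst h; funext j; by_cases hj : j = i
    · subst hj; simp [Store.A, Store.setA, Store.setArr]
    · simp [Store.A, Store.setA, Store.setArr, hj]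
  · funext j; simp [Store.A, Store.setA, Store.setArr, h]

/-- Restricted to one kind, the value has type `ℤ` or `ℝ` on its face, so that rewriting meets
ordinary ring operations. -/
def Expr.ival (σ : Store) (e : Expr .int) : ℤ := e.val σ
def Expr.rval (σ : Store) (e : Expr .real) : ℝ := e.val σ

/-! ### Concrete syntax -/

namespace Syn

instance : Add (Expr .int) := ⟨.iop .add⟩
instance : Sub (Expr .int) := ⟨.iop .sub⟩
instance : Mul (Expr .int) := ⟨.iop .mul⟩
instance : Div (Expr .int) := ⟨.iop .div⟩
instance : Add (Expr .real) := ⟨.rop .add⟩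
instance : Sub (Expr .real) := ⟨.rop .sub⟩
instance : Mul (Expr .real) := ⟨.rop .mul⟩
instance : Div (Expr .real) := ⟨.rop .div⟩

/-- Integer register. -/
abbrev iv (x : ℕ) : Expr .int := .var x
/-- Real register. -/
abbrev rv (x : ℕ) : Expr .real := .var x
/-- Integer constant. -/
abbrev ic (m : ℤ) : Expr .int := .intConst m
/-- Rational constant. -/
abbrev rc (q : ℚ) : Expr .real := .ratConst q
/-- Entry of a real array. -/
abbrev ra (a : ℕ) (i : Expr .int) : Expr .real := .get a i

/-- `e < f` -/
abbrev ltI (e f : Expr .int) : Test := .not (.intLe f e)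
/-- `e < f` -/
abbrev ltR (e f : Expr .real) : Test := .not (.realLe f e)

notation:60 "I[" x "]" " ≔ " e:61 => Program.assign Ty.int x e
notation:60 "R[" x "]" " ≔ " e:61 => Program.assign Ty.real x e
notation:60 "A[" a "," i "]" " ≔ " e:61 => Program.store Ty.real a i e
infixr:50 " ;; " => Program.seq

end Syn

open Syn

/-- Together with `costs`, `reads` and `wps`, these definitional rules let `simp only` execute
loop-free code symbolically. -/
theorem evals :
    (∀ (σ : Store) (m : ℤ), (Expr.intConst m).ival σ = m) ∧
    (∀ (σ : Store) (x : ℕ), (Expr.var x).ival σ = σ.I x) ∧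
    (∀ (σ : Store) (e f : Expr .int), (e + f).ival σ = e.ival σ + f.ival σ) ∧
    (∀ (σ : Store) (e f : Expr .int), (e - f).ival σ = e.ival σ - f.ival σ) ∧
    (∀ (σ : Store) (e f : Expr .int), (e * f).ival σ = e.ival σ * f.ival σ) ∧
    (∀ (σ : Store) (e f : Expr .int), (e / f).ival σ = Int.fdiv (e.ival σ) (f.ival σ)) ∧
    (∀ (σ : Store) (e : Expr .real), (Expr.floor e).ival σ = ⌊e.rval σ⌋) ∧
    (∀ (σ : Store) (q : ℚ), (Expr.ratConst q).rval σ = (q : ℝ)) ∧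
    (∀ (σ : Store) (x : ℕ), (Expr.var x).rval σ = σ.R x) ∧
    (∀ (σ : Store) (a : ℕ) (i : Expr .int), (Expr.get a i).rval σ = σ.A a (i.ival σ)) ∧
    (∀ (σ : Store) (e f : Expr .real), (e + f).rval σ = e.rval σ + f.rval σ) ∧
    (∀ (σ : Store) (e f : Expr .real), (e - f).rval σ = e.rval σ - f.rval σ) ∧
    (∀ (σ : Store) (e f : Expr .real), (e * f).rval σ = e.rval σ * f.rval σ) ∧
    (∀ (σ : Store) (e f : Expr .real), (e / f).rval σ = e.rval σ / f.rval σ) ∧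
    (∀ (σ : Store) (e : Expr .real), (Expr.fn .sqrt e).rval σ = √(e.rval σ)) ∧
    (∀ (σ : Store) (e : Expr .real), (Expr.fn .sin e).rval σ = sin (e.rval σ)) ∧
    (∀ (σ : Store) (e : Expr .real), (Expr.fn .arcsin e).rval σ = arcsin (e.rval σ)) ∧
    (∀ (σ : Store) (e : Expr .real), (Expr.fn .arccos e).rval σ = arccos (e.rval σ)) ∧
    (∀ (σ : Store) (e : Expr .int), (Expr.toReal e).rval σ = ((e.ival σ : ℤ) : ℝ)) ∧
    (∀ (σ : Store) (ω d₁ d₂ r α : Expr .real) (t : Expr .int),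
      (Expr.root ω d₁ d₂ r α t).rval σ = candidateRoot (ω.rval σ) (d₁.rval σ) (d₂.rval σ)
        (r.rval σ) (α.rval σ) (t.ival σ)) ∧
    (∀ (σ : Store) (e f : Expr .int), (Test.intLe e f).Holds σ ↔ e.ival σ ≤ f.ival σ) ∧
    (∀ (σ : Store) (e f : Expr .real), (Test.realLe e f).Holds σ ↔ e.rval σ ≤ f.rval σ) ∧
    (∀ (σ : Store) (b : Test), b.not.Holds σ ↔ ¬ b.Holds σ) ∧
    (∀ (σ : Store) (b c : Test), (b.and c).Holds σ ↔ b.Holds σ ∧ c.Holds σ) := by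
  refine ⟨?_, ?_, ?_, ?_, ?_, ?_, ?_, ?_, ?_, ?_, ?_, ?_, ?_, ?_, ?_, ?_, ?_, ?_, ?_, ?_, ?_, ?_,
    ?_, ?_⟩ <;> intros <;> rfl

theorem costs :
    (∀ m, (Expr.intConst m).cost = 1) ∧ (∀ q, (Expr.ratConst q).cost = 1) ∧
    (∀ x, (Expr.var x : Expr .int).cost = 1) ∧ (∀ x, (Expr.var x : Expr .real).cost = 1) ∧
    (∀ a i, (Expr.get a i : Expr .real).cost = i.cost + 1) ∧
    (∀ e f : Expr .int, (e + f).cost = e.cost + f.cost + 1) ∧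
    (∀ e f : Expr .int, (e - f).cost = e.cost + f.cost + 1) ∧
    (∀ e f : Expr .int, (e * f).cost = e.cost + f.cost + 1) ∧
    (∀ e f : Expr .int, (e / f).cost = e.cost + f.cost + 1) ∧
    (∀ e f : Expr .real, (e + f).cost = e.cost + f.cost + 1) ∧
    (∀ e f : Expr .real, (e - f).cost = e.cost + f.cost + 1) ∧
    (∀ e f : Expr .real, (e * f).cost = e.cost + f.cost + 1) ∧
    (∀ e f : Expr .real, (e / f).cost = e.cost + f.cost + 1) ∧
    (∀ g e, (Expr.fn g e).cost = e.cost + 1) ∧ (∀ e, (Expr.toReal e).cost = e.cost + 1) ∧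
    (∀ e, (Expr.floor e).cost = e.cost + 1) ∧
    (∀ ω d₁ d₂ r α t, (Expr.root ω d₁ d₂ r α t).cost =
      ω.cost + d₁.cost + d₂.cost + r.cost + α.cost + t.cost + 1) ∧
    (∀ e f, (Test.intLe e f).cost = e.cost + f.cost + 1) ∧
    (∀ e f, (Test.realLe e f).cost = e.cost + f.cost + 1) ∧
    (∀ b, (Test.not b).cost = b.cost + 1) ∧
    (∀ b c, (Test.and b c).cost = b.cost + c.cost + 1) := by
  refine ⟨?_, ?_, ?_, ?_, ?_, ?_, ?_, ?_, ?_, ?_, ?_, ?_, ?_, ?_, ?_, ?_, ?_, ?_, ?_, ?_, ?_⟩ <;>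
    intros <;> rfl

theorem reads :
    (∀ (σ : Store) x y v, (σ.setI x v).I y = if y = x then v else σ.I y) ∧
    (∀ (σ : Store) x y v, (σ.setI x v).R y = σ.R y) ∧
    (∀ (σ : Store) x a v, (σ.setI x v).A a = σ.A a) ∧
    (∀ (σ : Store) x y v, (σ.setR x v).R y = if y = x then v else σ.R y) ∧
    (∀ (σ : Store) x y v, (σ.setR x v).I y = σ.I y) ∧
    (∀ (σ : Store) x a v, (σ.setR x v).A a = σ.A a) ∧
    (∀ (σ : Store) x a i v, (σ.setA a i v).I x = σ.I x) ∧
    (∀ (σ : Store) x a i v, (σ.setA a i v).R x = σ.R x) ∧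
    (∀ (σ : Store) a b i v, (σ.setA a i v).A b =
      if b = a then Function.update (σ.A a) i v else σ.A b) :=
  ⟨Store.I_setI, Store.R_setI, Store.A_setI, Store.R_setR, Store.I_setR, Store.A_setR,
    Store.I_setA, Store.R_setA, Store.A_setA⟩

/-! ### Weakest preconditions -/

/-- `P`, started in `σ`, halts in a store `τ` after `m` units of time such that `Q τ m`. -/
def WP (P : Program) (Q : Store → ℕ → Prop) (σ : Store) : Prop := ∃ τ m, Runs P σ τ m ∧ Q τ m

theorem WP_skip {Q : Store → ℕ → Prop} {σ : Store} : WP .skip Q σ ↔ Q σ 1 := by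
  constructor
  · rintro ⟨τ, m, h, h'⟩; cases h; exact h'
  · intro h; exact ⟨_, _, .skip _, h⟩

theorem WP_assignI {x : ℕ} {e : Expr .int} {Q : Store → ℕ → Prop} {σ : Store} :
    WP (.assign .int x e) Q σ ↔ Q (σ.setI x (e.ival σ)) (e.cost + 1) := by
  constructor
  · rintro ⟨τ, m, h, h'⟩; cases h; exact h'
  · intro h; exact ⟨_, _, .assign _ _ _ _, h⟩

theorem WP_assignR {x : ℕ} {e : Expr .real} {Q : Store → ℕ → Prop} {σ : Store} :
    WP (.assign .real x e) Q σ ↔ Q (σ.setR x (e.rval σ)) (e.cost + 1) := by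
  constructor
  · rintro ⟨τ, m, h, h'⟩; cases h; exact h'
  · intro h; exact ⟨_, _, .assign _ _ _ _, h⟩

theorem WP_store {a : ℕ} {i : Expr .int} {e : Expr .real} {Q : Store → ℕ → Prop} {σ : Store} :
    WP (.store .real a i e) Q σ ↔ Q (σ.setA a (i.ival σ) (e.rval σ)) (i.cost + e.cost + 1) := by
  constructor
  · rintro ⟨τ, m, h, h'⟩; cases h; exact h'
  · intro h; exact ⟨_, _, .store _ _ _ _ _, h⟩

theorem WP_seq {P P' : Program} {Q : Store → ℕ → Prop} {σ : Store} :
    WP (.seq P P') Q σ ↔ WP P (fun τ m => WP P' (fun υ m' => Q υ (m + m')) τ) σ := by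
  constructor
  · rintro ⟨τ, m, h, h'⟩; cases h with
    | seq h1 h2 => exact ⟨_, _, h1, _, _, h2, h'⟩
  · rintro ⟨τ, m, h, υ, m', h2, h3⟩; exact ⟨_, _, .seq h h2, h3⟩

theorem WP_ite {b : Test} {P P' : Program} {Q : Store → ℕ → Prop} {σ : Store} :
    WP (.ite b P P') Q σ ↔ (b.Holds σ → WP P (fun τ m => Q τ (b.cost + 1 + m)) σ) ∧
      (¬ b.Holds σ → WP P' (fun τ m => Q τ (b.cost + 1 + m)) σ) := by
  constructor
  · rintro ⟨τ, m, h, h'⟩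
    cases h with
    | iteTrue hb h => exact ⟨fun _ => ⟨_, _, h, h'⟩, fun hn => absurd hb hn⟩
    | iteFalse hb h => exact ⟨fun hn => absurd hn hb, fun _ => ⟨_, _, h, h'⟩⟩
  · rintro ⟨h1, h2⟩
    by_cases hb : b.Holds σ
    · obtain ⟨τ, m, h, h'⟩ := h1 hb; exact ⟨_, _, .iteTrue hb h, h'⟩
    · obtain ⟨τ, m, h, h'⟩ := h2 hb; exact ⟨_, _, .iteFalse hb h, h'⟩

theorem wps :
    (∀ Q σ, WP .skip Q σ ↔ Q σ 1) ∧
    (∀ x (e : Expr .int) Q σ,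
      WP (.assign .int x e) Q σ ↔ Q (σ.setI x (e.ival σ)) (e.cost + 1)) ∧
    (∀ x (e : Expr .real) Q σ,
      WP (.assign .real x e) Q σ ↔ Q (σ.setR x (e.rval σ)) (e.cost + 1)) ∧
    (∀ a i (e : Expr .real) Q σ, WP (.store .real a i e) Q σ ↔
      Q (σ.setA a (i.ival σ) (e.rval σ)) (i.cost + e.cost + 1)) ∧
    (∀ P P' Q σ, WP (.seq P P') Q σ ↔ WP P (fun τ m => WP P' (fun υ m' => Q υ (m + m')) τ) σ) ∧
    (∀ b P P' Q σ, WP (.ite b P P') Q σ ↔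
      (b.Holds σ → WP P (fun τ m => Q τ (b.cost + 1 + m)) σ) ∧
      (¬ b.Holds σ → WP P' (fun τ m => Q τ (b.cost + 1 + m)) σ)) :=
  ⟨fun _ _ => WP_skip, fun _ _ _ _ => WP_assignI, fun _ _ _ _ => WP_assignR,
    fun _ _ _ _ _ => WP_store, fun _ _ _ _ => WP_seq, fun _ _ _ _ _ => WP_ite⟩

/-! ### Frames -/

def Ty.eqb : Ty → Ty → Bool
  | .int, .int => true
  | .real, .real => true
  | _, _ => false

theorem Ty.eqb_iff {s t : Ty} : s.eqb t = true ↔ s = t := by cases s <;> cases t <;> simp [Ty.eqb]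

/-- Does the program write into register `x` of kind `s`? -/
def Program.modVar (s : Ty) (x : ℕ) : Program → Bool
  | .skip => false
  | .assign t y _ => t.eqb s && (y == x)
  | .store _ _ _ _ => false
  | .seq P Q => P.modVar s x || Q.modVar s x
  | .ite _ P Q => P.modVar s x || Q.modVar s x
  | .loop _ P => P.modVar s x

/-- Does the program write into array `a` of kind `s`? -/
def Program.modArr (s : Ty) (a : ℕ) : Program → Bool
  | .skip => false
  | .assign _ _ _ => false
  | .store t b _ _ => t.eqb s && (b == a)
  | .seq P Q => P.modArr s a || Q.modArr s a
  | .ite _ P Q => P.modArr s a || Q.modArr s a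
  | .loop _ P => P.modArr s a

/-- `τ` agrees with `σ` on everything that `P` does not write. -/
structure Frame (P : Program) (σ τ : Store) : Prop where
  I : ∀ x, P.modVar .int x = false → τ.I x = σ.I x
  R : ∀ x, P.modVar .real x = false → τ.R x = σ.R x
  A : ∀ a, P.modArr .real a = false → τ.A a = σ.A a

theorem Runs.frame_var {P : Program} {σ τ : Store} {m : ℕ} (h : Runs P σ τ m) (s : Ty) (x : ℕ)
    (hx : P.modVar s x = false) : τ.var s x = σ.var s x := by
  induction h with
  | skip => rfl
  | assign σ t y e =>
    simp only [Program.modVar, Bool.and_eq_false_iff, beq_eq_false_iff_ne] at hx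
    by_cases hs : s = t
    · subst hs
      have : y ≠ x := by
        rcases hx with hx | hx
        · have := Ty.eqb_iff.2 (rfl : s = s); simp [this] at hx
        · exact hx
      simp [Store.setVar, Function.update_of_ne this.symm]
    · classical simp only [Store.setVar]; rw [Function.update_of_ne hs]
  | store => rfl
  | seq _ _ ih1 ih2 =>
    simp only [Program.modVar, Bool.or_eq_false_iff] at hx
    rw [ih2 hx.2, ih1 hx.1]
  | iteTrue _ _ ih => simp only [Program.modVar, Bool.or_eq_false_iff] at hx; exact ih hx.1
  | iteFalse _ _ ih => simp only [Program.modVar, Bool.or_eq_false_iff] at hx; exact ih hx.2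
  | loopStop => rfl
  | loopStep _ _ _ ih1 ih2 => rw [ih2 hx, ih1 hx]

theorem Runs.frame_arr {P : Program} {σ τ : Store} {m : ℕ} (h : Runs P σ τ m) (s : Ty) (a : ℕ)
    (hx : P.modArr s a = false) : τ.arr s a = σ.arr s a := by
  induction h with
  | skip => rfl
  | assign => rfl
  | store σ t b i e =>
    simp only [Program.modArr, Bool.and_eq_false_iff, beq_eq_false_iff_ne] at hx
    by_cases hs : s = t
    · subst hs
      have : b ≠ a := by
        rcases hx with hx | hx
        · have := Ty.eqb_iff.2 (rfl : s = s); simp [this] at hx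
        · exact hx
      simp [Store.setArr, Function.update_of_ne this.symm]
    · classical simp only [Store.setArr]; rw [Function.update_of_ne hs]
  | seq _ _ ih1 ih2 =>
    simp only [Program.modArr, Bool.or_eq_false_iff] at hx
    rw [ih2 hx.2, ih1 hx.1]
  | iteTrue _ _ ih => simp only [Program.modArr, Bool.or_eq_false_iff] at hx; exact ih hx.1
  | iteFalse _ _ ih => simp only [Program.modArr, Bool.or_eq_false_iff] at hx; exact ih hx.2
  | loopStop => rfl
  | loopStep _ _ _ ih1 ih2 => rw [ih2 hx, ih1 hx]

theorem Runs.frame {P : Program} {σ τ : Store} {m : ℕ} (h : Runs P σ τ m) : Frame P σ τ :=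
  ⟨fun x hx => h.frame_var .int x hx, fun x hx => h.frame_var .real x hx,
    fun a ha => h.frame_arr .real a ha⟩

theorem Frame.refl (P : Program) (σ : Store) : Frame P σ σ :=
  ⟨fun _ _ => rfl, fun _ _ => rfl, fun _ _ => rfl⟩

theorem Frame.trans {P : Program} {σ τ υ : Store} (h : Frame P σ τ) (h' : Frame P τ υ) :
    Frame P σ υ :=
  ⟨fun x hx => (h'.I x hx).trans (h.I x hx), fun x hx => (h'.R x hx).trans (h.R x hx),
    fun x hx => (h'.A x hx).trans (h.A x hx)⟩

/-- The frame is preserved for free. -/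
theorem WP.use {P : Program} {Q Q' : Store → ℕ → Prop} {σ : Store} (h : WP P Q σ)
    (hQ : ∀ τ m, Frame P σ τ → Q τ m → Q' τ m) : WP P Q' σ := by
  obtain ⟨τ, m, h, h'⟩ := h
  exact ⟨τ, m, h, hQ _ _ h.frame h'⟩

/-- While-loops: an invariant `I` and a nonnegative potential `Φ` that pays for the time. -/
theorem WP_loop {b : Test} {P : Program} {Q : Store → ℕ → Prop} {σ₀ : Store}
    (I : Store → Prop) (Φ : Store → ℝ) (h0 : I σ₀)
    (nonneg : ∀ σ, Frame P σ₀ σ → I σ → 0 ≤ Φ σ)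
    (step : ∀ σ, Frame P σ₀ σ → I σ → b.Holds σ →
      WP P (fun τ m => I τ ∧ Φ τ + m + (b.cost + 1 : ℕ) ≤ Φ σ) σ)
    (post : ∀ (τ : Store) (m : ℕ), Frame P σ₀ τ → I τ → ¬ b.Holds τ →
      Φ τ + (m : ℝ) ≤ Φ σ₀ + (b.cost + 1 : ℕ) → Q τ m) :
    WP (.loop b P) Q σ₀ := by
  -- Induction on a natural bound for the potential: each pass costs at least one unit, hence lowers
  -- the potential by at least one, and the potential stays nonnegative.
  have key : ∀ N : ℕ, ∀ σ, Frame P σ₀ σ → I σ → Φ σ ≤ N → ∃ τ m, Runs (.loop b P) σ τ m ∧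
      Frame P σ₀ τ ∧ I τ ∧ ¬ b.Holds τ ∧ Φ τ + (m : ℝ) ≤ Φ σ + (b.cost + 1 : ℕ) := by
    intro N
    induction N with
    | zero =>
      intro σ hf hI hΦ
      by_cases hb : b.Holds σ
      · obtain ⟨τ, m, hr, hI', hc⟩ := step σ hf hI hb
        have := nonneg τ (hf.trans hr.frame) hI'
        push_cast at *
        have : (0:ℝ) ≤ m := by positivity
        have : (0:ℝ) ≤ b.cost := by positivity
        linarith
      · exact ⟨σ, _, .loopStop hb, hf, hI, hb, le_rfl⟩
    | succ N ih =>
      intro σ hf hI hΦ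
      by_cases hb : b.Holds σ
      · obtain ⟨τ, m, hr, hI', hc⟩ := step σ hf hI hb
        have h1 : (0:ℝ) ≤ m := by positivity
        have h2 : (0:ℝ) ≤ b.cost := by positivity
        obtain ⟨υ, m', hr', hf', hI'', hb', hc'⟩ := ih τ (hf.trans hr.frame) hI' (by
          push_cast at *; linarith)
        refine ⟨υ, _, .loopStep hb hr hr', hf', hI'', hb', ?_⟩
        push_cast at *; linarith
      · exact ⟨σ, _, .loopStop hb, hf, hI, hb, le_rfl⟩
  obtain ⟨N, hN⟩ := exists_nat_ge (Φ σ₀)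
  obtain ⟨τ, m, hr, hf, hI, hb, hc⟩ := key N σ₀ (.refl _ _) h0 hN
  exact ⟨τ, m, hr, post τ m hf hI hb hc⟩

end

end RealRAM

namespace RealRAM
noncomputable section
open Syn

/-! ## Sorting -/

/-- Swap entries `i` and `j` of array `a`, using the real register 10. -/
def swapP (a : ℕ) (i j : Expr .int) : Program :=
  R[10] ≔ ra a i ;; A[a, i] ≔ ra a j ;; A[a, j] ≔ rv 10

/-- Sort the pairs of entries of the arrays 2 and 3 by the entries of array 2. -/
def sortP : Program :=
  I[2] ≔ ic 0 ;;
  .loop (ltI (iv 2) (iv 0)) (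
    I[3] ≔ iv 2 + ic 1 ;;
    .loop (ltI (iv 3) (iv 0)) (
      .ite (ltR (ra 2 (iv 3)) (ra 2 (iv 2))) (swapP 2 (iv 2) (iv 3) ;; swapP 3 (iv 2) (iv 3)) .skip ;;
      I[3] ≔ iv 3 + ic 1) ;;
    I[2] ≔ iv 2 + ic 1)

theorem update_update_eq_swap {β : Type*} (f : ℤ → β) {i j : ℤ} (h : i ≠ j) :
    Function.update (Function.update f i (f j)) j (f i) = f ∘ Equiv.swap i j := by
  funext z
  by_cases hj : z = j
  · subst hj; simp
  · by_cases hi : z = i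
    · subst hi; simp [hj]
    · simp [hi, hj, Equiv.swap_apply_of_ne_of_ne hi hj]

/-- A quadratic exchange sort is within the budget. The inner loop brings the minimum of the
remaining entries to position `I 2`, so every finished entry is at most all later ones. A
permutation of all of `ℤ` that preserves `[0, n)` records that both arrays are rearranged alike. -/
theorem sortP_spec (σ : Store) (n : ℕ) (hn : σ.I 0 = n) :
    WP sortP (fun τ m =>
      (∃ ρ : Equiv.Perm ℤ, (∀ z, (0 ≤ ρ z ∧ ρ z < n) ↔ (0 ≤ z ∧ z < n)) ∧
        τ.A 2 = σ.A 2 ∘ ρ ∧ τ.A 3 = σ.A 3 ∘ ρ) ∧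
      (∀ i j : ℤ, 0 ≤ i → i ≤ j → j < n → τ.A 2 i ≤ τ.A 2 j) ∧
      (m : ℝ) ≤ 60 * n ^ 2 + 60 * n + 60) σ := by
  let Pm : Store → Prop := fun τ => ∃ ρ : Equiv.Perm ℤ,
    (∀ z, (0 ≤ ρ z ∧ ρ z < n) ↔ (0 ≤ z ∧ z < n)) ∧ τ.A 2 = σ.A 2 ∘ ρ ∧ τ.A 3 = σ.A 3 ∘ ρ
  unfold sortP
  simp only [wps, evals, costs]
  refine WP_loop (fun τ => 0 ≤ τ.I 2 ∧ τ.I 2 ≤ n ∧ Pm τ ∧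
      ∀ u v, 0 ≤ u → u < τ.I 2 → u ≤ v → v < n → τ.A 2 u ≤ τ.A 2 v)
    (fun τ => (n - τ.I 2) * (40 * n + 40)) ?_ ?_ ?_ ?_
  · simp only [reads, reduceIte]
    refine ⟨le_rfl, by positivity, ⟨Equiv.refl _, by simp [reads]⟩, ?_⟩
    intro u v h1 h2; omega
  · rintro τ - ⟨h1, h2, -⟩
    have : (τ.I 2 : ℝ) ≤ n := by exact_mod_cast h2
    have : (0:ℝ) ≤ n := by positivity
    exact mul_nonneg (by linarith) (by linarith)
  · rintro τ fr ⟨h1, h2, hP, hS⟩ hb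
    have h0 : τ.I 0 = n := by rw [fr.I 0 rfl]; simpa [reads] using hn
    simp only [evals, h0, not_le] at hb
    simp only [wps, evals, costs]
    refine WP_loop (fun υ => τ.I 2 < υ.I 3 ∧ υ.I 3 ≤ n ∧ Pm υ ∧
      (∀ u v, 0 ≤ u → u < τ.I 2 → u ≤ v → v < n → υ.A 2 u ≤ υ.A 2 v) ∧
      ∀ v, τ.I 2 ≤ v → v < υ.I 3 → υ.A 2 (τ.I 2) ≤ υ.A 2 v)
      (fun υ => (n - υ.I 3) * 40) ?_ ?_ ?_ ?_
    · simp only [reads, reduceIte, Pm]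
      refine ⟨by omega, by omega, hP, hS, ?_⟩
      intro v h3 h4
      obtain rfl : v = τ.I 2 := by omega
      exact le_rfl
    · rintro υ - ⟨h3, h4, -⟩
      have : (υ.I 3 : ℝ) ≤ n := by exact_mod_cast h4
      linarith
    · rintro υ fr' ⟨h3, h4, ⟨ρ, hρ, e2, e3⟩, hS', hm⟩ hb'
      have e0 : υ.I 0 = n := by rw [fr'.I 0 rfl]; simpa [reads] using h0
      have e1 : υ.I 2 = τ.I 2 := by rw [fr'.I 2 rfl]; simp [reads]
      simp only [evals, e0, not_le] at hb'
      obtain ⟨i, hi⟩ : ∃ i, τ.I 2 = i := ⟨_, rfl⟩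
      obtain ⟨j, hj⟩ : ∃ j, υ.I 3 = j := ⟨_, rfl⟩
      rw [hi] at e1 h1 h2 hS hb h3 hm hS'
      rw [hj] at h3 h4 hm hb'
      have hij : i ≠ j := by omega
      have hij' : j ≠ i := by omega
      simp only [wps, evals, costs, swapP, reads, reduceIte, Nat.reduceEqDiff, e1, hi, hj, not_le, not_lt,
        update_update_eq_swap _ hij, Nat.reduceAdd, Pm]
      refine ⟨fun hlt => ⟨⟨by omega, by omega, ⟨(Equiv.swap i j).trans ρ, ?_, ?_, ?_⟩, ?_, ?_⟩, ?_⟩,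
        fun hle => ⟨⟨by omega, by omega, ⟨ρ, hρ, e2, e3⟩, hS', ?_⟩, ?_⟩⟩
      · intro z
        rw [Equiv.trans_apply, hρ]
        by_cases hz : z = i
        · subst hz; simp; omega
        · by_cases hz' : z = j
          · subst hz'; simp; omega
          · rw [Equiv.swap_apply_of_ne_of_ne hz hz']
      · rw [e2]; rfl
      · rw [e3]; rfl
      · intro u v hu0 hu huv hv
        have hu1 : u ≠ i := by omega
        have hu2 : u ≠ j := by omega
        simp only [Function.comp, Equiv.swap_apply_of_ne_of_ne hu1 hu2]
        by_cases hz : v = i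
        · subst hz; simp; exact hS' u j hu0 hu (by omega) hb'
        · by_cases hz' : v = j
          · subst hz'; simp; exact hS' u i hu0 hu (by omega) (by omega)
          · rw [Equiv.swap_apply_of_ne_of_ne hz hz']; exact hS' u v hu0 hu huv hv
      · intro v hv hv'
        simp only [Function.comp, Equiv.swap_apply_left]
        by_cases hz : v = i
        · subst hz; simp
        · by_cases hz' : v = j
          · subst hz'; simp; exact hlt.le
          · rw [Equiv.swap_apply_of_ne_of_ne hz hz']; exact hlt.le.trans (hm v hv (by omega))
      · push_cast; linarith
      · intro v hv hv'
        by_cases hz : v = j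
        · subst hz; exact hle
        · exact hm v hv (by omega)
      · push_cast; linarith
    · rintro υ m fr' ⟨h3, h4, hP', hS', hm⟩ hb' hc
      have e0 : υ.I 0 = n := by rw [fr'.I 0 rfl]; simpa [reads] using h0
      have e1 : υ.I 2 = τ.I 2 := by rw [fr'.I 2 rfl]; simp [reads]
      simp only [evals, e0, not_le, not_lt] at hb'
      simp only [reads, reduceIte, e1, costs, Pm] at hc ⊢
      refine ⟨⟨by omega, by omega, hP', ?_⟩, ?_⟩
      · intro u v hu0 hu huv hv
        rcases (show u < τ.I 2 ∨ u = τ.I 2 by omega) with h | rfl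
        · exact hS' u v hu0 h huv hv
        · exact hm v huv (by omega)
      · have : (υ.I 3 : ℝ) = n := by exact_mod_cast (le_antisymm h4 hb')
        rw [this] at hc
        have : (0:ℝ) ≤ τ.I 2 := by exact_mod_cast h1
        push_cast at hc ⊢; nlinarith
  · rintro τ m fr ⟨h1, h2, hP, hS⟩ hb hc
    have h0 : τ.I 0 = n := by rw [fr.I 0 rfl]; simpa [reads] using hn
    simp only [evals, h0, not_le, not_lt] at hb
    refine ⟨hP, fun i j hi hij hj => hS i j hi (by omega) hij hj, ?_⟩
    have : (τ.I 2 : ℝ) = n := by exact_mod_cast (le_antisymm h2 hb)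
    simp only [reads, reduceIte, costs, this] at hc ⊢
    push_cast at hc ⊢; nlinarith

end
end RealRAM

noncomputable section

/-! ## Reading the instance -/

/-- Polar coordinates with an angle in `[0, 2π)`. -/
theorem polar_coordinates {a b d : ℝ} (hd : 0 < d) (h : d ^ 2 = a ^ 2 + b ^ 2) :
    (0 ≤ b → 0 ≤ arccos (a / d) ∧ arccos (a / d) < 2 * π ∧ a = d * cos (arccos (a / d)) ∧
      b = d * sin (arccos (a / d))) ∧
    (b < 0 → 0 ≤ 2 * π - arccos (a / d) ∧ 2 * π - arccos (a / d) < 2 * π ∧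
      a = d * cos (2 * π - arccos (a / d)) ∧ b = d * sin (2 * π - arccos (a / d))) := by
  have hpi := Real.pi_pos
  have h1 : -1 ≤ a / d := by rw [le_div_iff₀ hd]; nlinarith [sq_nonneg b]
  have h2 : a / d ≤ 1 := by rw [div_le_one hd]; nlinarith [sq_nonneg b]
  have h3 := arccos_le_pi (a / d)
  have h4 := arccos_nonneg (a / d)
  have hs : 1 - (a / d) ^ 2 = (b / d) ^ 2 := by field_simp; linarith
  refine ⟨fun hb => ⟨h4, by linarith, ?_, ?_⟩, fun hb => ⟨by linarith, ?_, ?_, ?_⟩⟩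
  · rw [cos_arccos h1 h2]; field_simp
  · rw [sin_arccos, hs, Real.sqrt_sq (by positivity)]; field_simp
  -- Since `b < 0`, the quotient is strictly below 1; this keeps the angle strictly below a full
  -- turn.
  · have : 0 < arccos (a / d) := by
      rw [arccos_pos, div_lt_one hd]; nlinarith
    linarith
  · rw [cos_two_pi_sub, cos_arccos h1 h2]; field_simp
  · rw [sin_two_pi_sub, sin_arccos, hs, Real.sqrt_sq_eq_abs,
      abs_of_neg (div_neg_of_neg_of_pos hb hd)]
    field_simp

namespace RealRAM
open Syn

/-- Write the directions and distances of the demand points, as seen from the center, into the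
arrays 2 and 3, `π` into register 4 and an upper bound for the optimum into register 5. -/
def polarP : Program :=
  R[4] ≔ .fn .arccos (rc (-1)) ;;
  R[5] ≔ rc 2 * rv 0 * rv 1 * .fn .sin (rv 4 / .toReal (iv 1)) ;;
  I[2] ≔ ic 0 ;;
  .loop (ltI (iv 2) (iv 0)) (
    R[10] ≔ ra 0 (iv 2) - rv 2 ;;
    R[11] ≔ ra 1 (iv 2) - rv 3 ;;
    R[12] ≔ .fn .sqrt (rv 10 * rv 10 + rv 11 * rv 11) ;;
    .ite (.realLe (rv 12 + rv 1) (rv 5)) (R[5] ≔ rv 12 + rv 1) .skip ;;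
    .ite (.realLe (rv 12) (rc 0)) (A[2, iv 2] ≔ rc 0 ;; A[3, iv 2] ≔ rc 2 * rv 1) (
      A[3, iv 2] ≔ rv 12 ;;
      .ite (.realLe (rc 0) (rv 11)) (A[2, iv 2] ≔ .fn .arccos (rv 10 / rv 12))
        (A[2, iv 2] ≔ rc 2 * rv 4 - .fn .arccos (rv 10 / rv 12))) ;;
    I[2] ≔ iv 2 + ic 1)

theorem polarP_spec {n k : ℕ} {α r : ℝ} (hr : 0 < r) (o : Plane) (p : Fin n → Plane) (σ : Store)
    (hn : σ.I 0 = n) (hk : σ.I 1 = k) (hα : σ.R 0 = α) (hr' : σ.R 1 = r) (h2 : σ.R 2 = o 0)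
    (h3 : σ.R 3 = o 1) (hA0 : ∀ i : Fin n, σ.A 0 i = p i 0) (hA1 : ∀ i : Fin n, σ.A 1 i = p i 1) :
    WP polarP (fun τ m => τ.R 4 = π ∧
      (∀ i : Fin n, IsPolar o r (p i) (τ.A 2 i) (τ.A 3 i) ∧ 0 ≤ τ.A 2 i ∧ τ.A 2 i < 2 * π ∧
        τ.R 5 ≤ dist (p i) o + r) ∧
      τ.R 5 ≤ 2 * α * r * sin (π / k) ∧
      (τ.R 5 = 2 * α * r * sin (π / k) ∨ ∃ i, τ.R 5 = dist (p i) o + r) ∧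
      (m : ℝ) ≤ 80 * n + 40) σ := by
  have hpi := Real.pi_pos
  unfold polarP
  simp only [wps, evals, costs, reads, reduceIte, Nat.reduceEqDiff]
  refine WP_loop (fun τ => 0 ≤ τ.I 2 ∧ τ.I 2 ≤ n ∧
      (∀ i : Fin n, (i : ℤ) < τ.I 2 → IsPolar o r (p i) (τ.A 2 i) (τ.A 3 i) ∧ 0 ≤ τ.A 2 i ∧
        τ.A 2 i < 2 * π ∧ τ.R 5 ≤ dist (p i) o + r) ∧
      τ.R 5 ≤ 2 * α * r * sin (π / k) ∧
      (τ.R 5 = 2 * α * r * sin (π / k) ∨ ∃ i, τ.R 5 = dist (p i) o + r))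
    (fun τ => (n - τ.I 2) * 80) ?_ ?_ ?_ ?_
  · have hpi' : arccos ((-1 : ℚ) : ℝ) = π := by push_cast; exact arccos_neg_one
    simp only [reads, reduceIte, Nat.reduceEqDiff, hpi', hα, hr', hk]
    push_cast
    refine ⟨trivial, by positivity, fun i hi => by omega, le_rfl, Or.inl rfl⟩
  · rintro τ - ⟨-, h, -⟩
    have : (τ.I 2 : ℝ) ≤ n := by exact_mod_cast h
    linarith
  · rintro τ fr ⟨i1, i2, i3, i4, i5⟩ hb
    have e0 : τ.I 0 = n := by rw [fr.I 0 rfl]; simpa [reads] using hn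
    have e1 : τ.R 1 = r := by rw [fr.R 1 rfl]; simpa [reads] using hr'
    have e2 : τ.R 2 = o 0 := by rw [fr.R 2 rfl]; simpa [reads] using h2
    have e3 : τ.R 3 = o 1 := by rw [fr.R 3 rfl]; simpa [reads] using h3
    have e4 : τ.R 4 = π := by rw [fr.R 4 rfl]; simp [reads, arccos_neg_one]
    simp only [evals, e0, not_le] at hb
    obtain ⟨i, hi⟩ : ∃ i : Fin n, τ.I 2 = i := ⟨⟨(τ.I 2).toNat, by omega⟩, by simp; omega⟩
    have e5 : τ.A 0 i = p i 0 := by rw [fr.A 0 rfl]; simpa [reads] using hA0 i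
    have e6 : τ.A 1 i = p i 1 := by rw [fr.A 1 rfl]; simpa [reads] using hA1 i
    have hd : √((p i 0 - o 0) * (p i 0 - o 0) + (p i 1 - o 1) * (p i 1 - o 1)) = dist (p i) o := by
      rw [EuclideanSpace.dist_eq]
      simp only [Fin.sum_univ_two, Real.dist_eq, sq_abs]
      congr 1; ring
    have hd2 : dist (p i) o ^ 2 = (p i 0 - o 0) ^ 2 + (p i 1 - o 1) ^ 2 := by
      rw [← hd, Real.sq_sqrt (add_nonneg (mul_self_nonneg _) (mul_self_nonneg _))]; ring
    rw [hi] at i3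
    have hnew : ∀ (A2 A3 : ℤ → ℝ) (X a b : ℝ), A2 = Function.update (τ.A 2) i a →
        A3 = Function.update (τ.A 3) i b → X ≤ τ.R 5 → X ≤ dist (p i) o + r →
        IsPolar o r (p i) a b → 0 ≤ a → a < 2 * π → ∀ j : Fin n, (j : ℤ) < i + 1 →
          IsPolar o r (p j) (A2 j) (A3 j) ∧ 0 ≤ A2 j ∧ A2 j < 2 * π ∧ X ≤ dist (p j) o + r := by
      rintro _ _ X a b rfl rfl hX hX' hP ha hb j hj
      by_cases hji : j = i
      · subst hji; simp only [Function.update_self]; exact ⟨hP, ha, hb, hX'⟩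
      · have hji' : (j : ℤ) ≠ i := fun h => hji (Fin.ext (by exact_mod_cast h))
        rw [Function.update_of_ne hji', Function.update_of_ne hji']
        obtain ⟨q1, q2, q3, q4⟩ := i3 j (by omega)
        exact ⟨q1, q2, q3, hX.trans q4⟩
    have hcases : ∀ (A2 A3 : ℤ → ℝ) (X a b : ℝ), A2 = Function.update (τ.A 2) i a →
        A3 = Function.update (τ.A 3) i b → (X = τ.R 5 ∨ X = dist (p i) o + r) → X ≤ τ.R 5 →
        X ≤ dist (p i) o + r →
        IsPolar o r (p i) a b → 0 ≤ a → a < 2 * π → 0 ≤ (i:ℤ) + 1 ∧ (i:ℤ) + 1 ≤ n ∧ (∀ j : Fin n, (j : ℤ) < i + 1 →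
          IsPolar o r (p j) (A2 j) (A3 j) ∧ 0 ≤ A2 j ∧ A2 j < 2 * π ∧ X ≤ dist (p j) o + r) ∧
          X ≤ 2 * α * r * sin (π / k) ∧
          (X = 2 * α * r * sin (π / k) ∨ ∃ i, X = dist (p i) o + r) := by
      rintro A2 A3 X a b hA2 hA3 hX hX1 hX2 hP ha hb
      refine ⟨by omega, by omega, hnew A2 A3 X a b hA2 hA3 hX1 hX2 hP ha hb, hX1.trans i4, ?_⟩
      rcases hX with rfl | h
      · exact i5
      · exact Or.inr ⟨i, h⟩
    have hpos : ∀ a, ¬ dist (p i) o ≤ 0 → p i 0 - o 0 = dist (p i) o * cos a →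
        p i 1 - o 1 = dist (p i) o * sin a → IsPolar o r (p i) a (dist (p i) o) :=
      fun a ha => isPolar_of_pos hr (not_le.1 ha)
    have hcen : dist (p i) o ≤ 0 → IsPolar o r (p i) 0 (2 * r) := by
      intro h
      rw [dist_le_zero.1 h]; exact isPolar_center o hr 0
    simp only [wps, evals, costs, reads, reduceIte, Nat.reduceEqDiff, Nat.reduceAdd, hi, e1, e2, e3,
      e4, e5, e6, hd, Rat.cast_ofNat, Rat.cast_zero]
    have hc : ∀ c : ℕ, c ≤ 80 → ((n:ℝ) - ((i + 1 : ℤ) : ℝ)) * 80 + (c : ℝ) ≤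
        (n - ((i : ℤ) : ℝ)) * 80 := by
      intro c hc
      have : (c:ℝ) ≤ 80 := by exact_mod_cast hc
      push_cast; linarith
    have pc := fun hd => @polar_coordinates (p i 0 - o 0) (p i 1 - o 1) (dist (p i) o) hd hd2
    refine ⟨fun hX => ⟨fun h0 => ?_, fun h0 => ⟨fun hb' => ?_, fun hb' => ?_⟩⟩,
      fun hX => ⟨fun h0 => ?_, fun h0 => ⟨fun hb' => ?_, fun hb' => ?_⟩⟩⟩
    · exact ⟨hcases _ _ _ _ _ rfl rfl (Or.inr rfl) hX le_rfl (hcen h0) le_rfl (by linarith),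
        by rw [add_assoc, ← Nat.cast_add]; exact hc _ (by norm_num)⟩
    · obtain ⟨q1, q2, q3, q4⟩ := (pc (not_le.1 h0)).1 hb'
      exact ⟨hcases _ _ _ _ _ rfl rfl (Or.inr rfl) hX le_rfl (hpos _ h0 q3 q4) q1 q2,
        by rw [add_assoc, ← Nat.cast_add]; exact hc _ (by norm_num)⟩
    · obtain ⟨q1, q2, q3, q4⟩ := (pc (not_le.1 h0)).2 (not_le.1 hb')
      exact ⟨hcases _ _ _ _ _ rfl rfl (Or.inr rfl) hX le_rfl (hpos _ h0 q3 q4) q1 q2,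
        by rw [add_assoc, ← Nat.cast_add]; exact hc _ (by norm_num)⟩
    · exact ⟨hcases _ _ _ _ _ rfl rfl (Or.inl rfl) le_rfl (not_le.1 hX).le (hcen h0) le_rfl (by linarith),
        by rw [add_assoc, ← Nat.cast_add]; exact hc _ (by norm_num)⟩
    · obtain ⟨q1, q2, q3, q4⟩ := (pc (not_le.1 h0)).1 hb'
      exact ⟨hcases _ _ _ _ _ rfl rfl (Or.inl rfl) le_rfl (not_le.1 hX).le (hpos _ h0 q3 q4) q1 q2,
        by rw [add_assoc, ← Nat.cast_add]; exact hc _ (by norm_num)⟩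
    · obtain ⟨q1, q2, q3, q4⟩ := (pc (not_le.1 h0)).2 (not_le.1 hb')
      exact ⟨hcases _ _ _ _ _ rfl rfl (Or.inl rfl) le_rfl (not_le.1 hX).le (hpos _ h0 q3 q4) q1 q2,
        by rw [add_assoc, ← Nat.cast_add]; exact hc _ (by norm_num)⟩
  · rintro τ m fr ⟨i1, i2, i3, i4, i5⟩ hb hc
    have e0 : τ.I 0 = n := by rw [fr.I 0 rfl]; simpa [reads] using hn
    have e4 : τ.R 4 = π := by rw [fr.R 4 rfl]; simp [reads, arccos_neg_one]
    simp only [evals, e0, not_le, not_lt] at hb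
    refine ⟨e4, fun i => i3 i (by omega), i4, i5, ?_⟩
    have : (τ.I 2 : ℝ) = n := by exact_mod_cast (le_antisymm i2 hb)
    simp only [reads, reduceIte, costs, this] at hc ⊢
    push_cast at hc ⊢; linarith

/-- Unroll the `n` directions and distances over four turns. -/
def unrollP : Program :=
  I[2] ≔ iv 0 ;;
  .loop (ltI (iv 2) (ic 4 * iv 0)) (
    A[2, iv 2] ≔ ra 2 (iv 2 - iv 0) + rc 2 * rv 4 ;;
    A[3, iv 2] ≔ ra 3 (iv 2 - iv 0) ;;
    I[2] ≔ iv 2 + ic 1)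

/-- Four turns are what the later scans read: greedy runs start at gaps in `[n, 2n)` and cross at
most one more turn, up to `3n`; the first start after a gap looks one turn further ahead, and the
last end before a gap one turn back. -/
theorem unrollP_spec {n : ℕ} (h0 : 0 < n) (σ : Store) (hn : σ.I 0 = n) (h4 : σ.R 4 = π) :
    WP unrollP (fun τ m => (∀ u : ℤ, 0 ≤ u → u < 4 * n →
      τ.A 2 u = σ.A 2 (u % n) + (u / n : ℤ) * (2 * π) ∧ τ.A 3 u = σ.A 3 (u % n)) ∧
      (m : ℝ) ≤ 90 * n + 40) σ := by
  have hn0 : (0:ℤ) < n := by omega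
  unfold unrollP
  simp only [wps, evals, costs, hn]
  refine WP_loop (fun τ => n ≤ τ.I 2 ∧ τ.I 2 ≤ 4 * n ∧ ∀ u : ℤ, 0 ≤ u → u < τ.I 2 →
      τ.A 2 u = σ.A 2 (u % n) + (u / n : ℤ) * (2 * π) ∧ τ.A 3 u = σ.A 3 (u % n))
    (fun τ => (4 * n - τ.I 2) * 30) ?_ ?_ ?_ ?_
  · simp only [reads, reduceIte]
    refine ⟨le_rfl, by omega, fun u hu hu' => ?_⟩
    rw [Int.emod_eq_of_lt hu hu', Int.ediv_eq_zero_of_lt hu hu']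
    simp
  · rintro τ - ⟨-, h, -⟩
    have : (τ.I 2 : ℝ) ≤ 4 * n := by exact_mod_cast h
    linarith
  · rintro τ fr ⟨i1, i2, i3⟩ hb
    have e0 : τ.I 0 = n := by rw [fr.I 0 rfl]; simpa [reads] using hn
    have e4 : τ.R 4 = π := by rw [fr.R 4 rfl]; simpa [reads] using h4
    obtain ⟨v, hv⟩ : ∃ v, τ.I 2 = v := ⟨_, rfl⟩
    simp only [evals, e0, not_le, hv] at hb
    rw [hv] at i1 i2 i3
    simp only [wps, evals, costs, reads, reduceIte, Nat.reduceEqDiff, Nat.reduceAdd, hv, e0, e4]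
    refine ⟨⟨by omega, by omega, fun u hu hu' => ?_⟩, by push_cast; linarith⟩
    by_cases h : u = v
    · subst h
      simp only [Function.update_self]
      obtain ⟨q1, q2⟩ := i3 (u - n) (by omega) (by omega)
      rw [q1, q2, Int.sub_emod_right]
      have : (u - n) / (n:ℤ) = u / n - 1 := by
        rw [Int.sub_ediv_of_dvd _ (dvd_refl _), Int.ediv_self hn0.ne']
      rw [this]
      refine ⟨?_, rfl⟩
      push_cast; ring
    · rw [Function.update_of_ne h, Function.update_of_ne h]
      exact i3 u hu (by omega)
  · rintro τ m fr ⟨i1, i2, i3⟩ hb hc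
    have e0 : τ.I 0 = n := by rw [fr.I 0 rfl]; simpa [reads] using hn
    simp only [evals, e0, not_le, not_lt] at hb
    refine ⟨fun u hu hu' => i3 u hu (by omega), ?_⟩
    have : (τ.I 2 : ℝ) = 4 * n := by exact_mod_cast (le_antisymm i2 hb)
    simp only [reads, reduceIte, costs, this] at hc ⊢
    push_cast at hc ⊢; linarith

/-- Compute the sorted directions and distances and the upper bound for the optimum. -/
def readP : Program := polarP ;; sortP ;; unrollP

theorem readP_spec {n k : ℕ} {α r : ℝ} (h0 : 0 < n) (hr : 0 < r) (o : Plane)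
    (p : Fin n → Plane) (σ : Store)
    (hn : σ.I 0 = n) (hk : σ.I 1 = k) (hα : σ.R 0 = α) (hr' : σ.R 1 = r) (h2 : σ.R 2 = o 0)
    (h3 : σ.R 3 = o 1) (hA0 : ∀ i : Fin n, σ.A 0 i = p i 0) (hA1 : ∀ i : Fin n, σ.A 1 i = p i 1) :
    WP readP (fun τ m => ∃ φ D, IsReduction α o r p k φ D (τ.R 5) ∧
      (∀ u : ℤ, 0 ≤ u → u < 4 * n → τ.A 2 u = φ u ∧ τ.A 3 u = D u) ∧ τ.R 4 = π ∧
      (m : ℝ) ≤ 500 * n ^ 2) σ := by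
  have hpi := Real.two_pi_pos
  have hn0 : (0:ℤ) < n := by omega
  unfold readP
  rw [WP_seq]
  refine (polarP_spec hr o p σ hn hk hα hr' h2 h3 hA0 hA1).use ?_
  rintro τ m fr ⟨hR4, hP, hX1, hX2, hm⟩
  rw [WP_seq]
  have eτ : τ.I 0 = n := by rw [fr.I 0 rfl, hn]
  refine (sortP_spec τ n eτ).use ?_
  rintro τ' m' fr' ⟨⟨ρ, hρ, hA2, hA3⟩, hs, hm'⟩
  have eτ' : τ'.I 0 = n := by rw [fr'.I 0 rfl, eτ]
  have hR4' : τ'.R 4 = π := by rw [fr'.R 4 rfl, hR4]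
  refine (unrollP_spec h0 τ' eτ' hR4').use ?_
  rintro υ m'' fr'' ⟨hu, hm''⟩
  have hR5 : υ.R 5 = τ.R 5 := by rw [fr''.R 5 rfl, fr'.R 5 rfl]
  have hidx : ∀ u : ℤ, 0 ≤ u → u < n → ∃ i : Fin n, ρ u = i := fun u h1 h2 => by
    obtain ⟨h3, h4⟩ := (hρ u).2 ⟨h1, h2⟩
    exact ⟨⟨(ρ u).toNat, by omega⟩, by simp; omega⟩
  have hmod : ∀ u : ℤ, 0 ≤ u % n ∧ u % n < n := fun u =>
    ⟨Int.emod_nonneg _ hn0.ne', Int.emod_lt_of_pos _ hn0⟩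
  have hbase : ∀ u : ℤ, 0 ≤ u → u < n →
      τ'.A 2 (u % n) + (u / n : ℤ) * (2 * π) = τ'.A 2 u ∧ τ'.A 3 (u % n) = τ'.A 3 u := by
    intro u hu hu'
    simp [Int.emod_eq_of_lt hu hu', Int.ediv_eq_zero_of_lt hu hu']
  have hrange : ∀ u : ℤ, 0 ≤ u → u < n → 0 ≤ τ'.A 2 u ∧ τ'.A 2 u < 2 * π := by
    intro u hu hu'
    obtain ⟨i, hi⟩ := hidx u hu hu'
    rw [hA2, Function.comp, hi]
    exact ⟨(hP i).2.1, (hP i).2.2.1⟩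
  -- The bi-infinite sequences repeat the sorted arrays turn by turn. Monotonicity across a turn
  -- holds because the sorted directions lie in `[0, 2π)`.
  refine ⟨fun u : ℤ => τ'.A 2 (u % n) + (u / n : ℤ) * (2 * π), fun u : ℤ => τ'.A 3 (u % n), ?_, hu,
    by rw [fr''.R 4 rfl, hR4'], ?_⟩
  · refine ⟨⟨h0, monotone_int_of_le_succ fun u => ?_, fun u => ?_, fun u => ?_, fun u => ?_, ?_, ?_⟩,
      fun i => ?_, fun u hu hu' => ?_, hR5 ▸ hX1, fun i => hR5 ▸ (hP i).2.2.2, hR5 ▸ hX2⟩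
    · have h3 := Int.emod_add_mul_ediv u n
      have h3' := Int.emod_add_mul_ediv (u + 1) n
      obtain ⟨h1, h2⟩ := hmod u
      rcases (show u % n + 1 < n ∨ u % n + 1 = n by omega) with h4 | h4
      · have e1 : (u + 1) / (n:ℤ) = u / n := by
          rw [Int.ediv_eq_iff_of_pos hn0]; constructor <;> nlinarith
        have e2 : (u + 1) % (n:ℤ) = u % n + 1 := by rw [e1] at h3'; omega
        simp only [e1, e2]
        have := hs (u % n) (u % n + 1) h1 (by omega) h4
        linarith
      · have e1 : (u + 1) / (n:ℤ) = u / n + 1 := by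
          rw [Int.ediv_eq_iff_of_pos hn0]; constructor <;> nlinarith
        have e2 : (u + 1) % (n:ℤ) = 0 := by
          rw [e1] at h3'; linarith [mul_add (n:ℤ) (u / n) 1]
        simp only [e1, e2]
        have := (hrange (u % n) h1 h2).2
        have := (hrange 0 le_rfl hn0).1
        push_cast; linarith
    · simp only [Int.add_emod_right]
      rw [Int.add_ediv_of_dvd_right (dvd_refl _), Int.ediv_self hn0.ne']
      push_cast; ring
    · simp only [Int.add_emod_right]
    · obtain ⟨i, hi⟩ := hidx (u % n) (hmod u).1 (hmod u).2
      simp only [hA3, Function.comp, hi]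
      exact (hP i).1.pos
    · rw [(hbase 0 le_rfl hn0).1]; exact (hrange 0 le_rfl hn0).1
    · rw [(hbase (n - 1) (by omega) (by omega)).1]; exact (hrange _ (by omega) (by omega)).2
    · have h1 := (hρ (ρ.symm i)).1 (by rw [Equiv.apply_symm_apply]; exact ⟨by omega, by omega⟩)
      refine ⟨ρ.symm i, ?_⟩
      rw [(hbase _ h1.1 h1.2).1, (hbase _ h1.1 h1.2).2, hA2, hA3]
      simp only [Function.comp, Equiv.apply_symm_apply]
      exact (hP i).1
    · obtain ⟨i, hi⟩ := hidx u hu hu'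
      refine ⟨i, ?_⟩
      rw [(hbase _ hu hu').1, (hbase _ hu hu').2, hA2, hA3]
      simp only [Function.comp, hi]
      exact (hP i).1
  · have : (1:ℝ) ≤ n := by exact_mod_cast h0
    push_cast; nlinarith

end RealRAM
end

noncomputable section

namespace RealRAM
open Syn ArcSystem

/-! ## The gaps between the forbidden arcs -/

/-- The store holds the sorted demand points. -/
structure Ready (n k w : ℕ) (α r : ℝ) (φ D : ℤ → ℝ) (σ : Store) : Prop where
  hn : σ.I 0 = n
  hk : σ.I 1 = k
  hw : σ.I 4 = w
  hα : σ.R 0 = α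
  hr : σ.R 1 = r
  hpi : σ.R 4 = π
  hφ : ∀ u : ℤ, 0 ≤ u → u < 4 * n → σ.A 2 u = φ u
  hD : ∀ u : ℤ, 0 ≤ u → u < 4 * n → σ.A 3 u = D u

theorem Ready.of_frame {n k w : ℕ} {α r : ℝ} {φ D : ℤ → ℝ} {σ τ : Store} {P : Program}
    (h : Ready n k w α r φ D σ) (fr : Frame P σ τ)
    (hP : (P.modVar .int 0 || P.modVar .int 1 || P.modVar .int 4 || P.modVar .real 0 ||
      P.modVar .real 1 || P.modVar .real 4 || P.modArr .real 2 || P.modArr .real 3) = false) :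
    Ready n k w α r φ D τ := by
  simp only [Bool.or_eq_false_iff] at hP
  obtain ⟨⟨⟨⟨⟨⟨⟨h0, h1⟩, h4⟩, r0⟩, r1⟩, r4⟩, a2⟩, a3⟩ := hP
  exact ⟨by rw [fr.I 0 h0, h.hn], by rw [fr.I 1 h1, h.hk], by rw [fr.I 4 h4, h.hw],
    by rw [fr.R 0 r0, h.hα], by rw [fr.R 1 r1, h.hr], by rw [fr.R 4 r4, h.hpi],
    by rw [fr.A 2 a2]; exact h.hφ, by rw [fr.A 3 a3]; exact h.hD⟩

/-- The half-arc of demand point `u` for the radius in real register `x`. -/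
abbrev halfArcE (u : Expr .int) (x : ℕ) : Expr .real :=
  .fn .arccos ((ra 3 u * ra 3 u + rv 1 * rv 1 - rv x * rv x) / (rc 2 * ra 3 u * rv 1))

/-- The angle of a step for the radius in real register `x`. -/
abbrev stepE (x : ℕ) : Expr .real := rc 2 * .fn .arcsin (rv x / (rc 2 * rv 0 * rv 1))

/-- Last ends of arcs, for the radius in register 8. -/
def lastEndP : Program :=
  R[10] ≔ rc 0 ;; I[2] ≔ ic 0 ;;
  .loop (ltI (iv 2) (ic 4 * iv 0)) (
    A[7, iv 2] ≔ halfArcE (iv 2) 8 ;;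
    .ite (ltR (rv 10) (ra 2 (iv 2) + ra 7 (iv 2))) (R[10] ≔ ra 2 (iv 2) + ra 7 (iv 2)) .skip ;;
    A[4, iv 2] ≔ rv 10 ;;
    I[2] ≔ iv 2 + ic 1)

/-- First starts of arcs. -/
def firstStartP : Program :=
  I[2] ≔ ic 4 * iv 0 - ic 1 ;; R[10] ≔ ra 2 (iv 2) - ra 7 (iv 2) ;; I[2] ≔ iv 2 - ic 1 ;;
  .loop (.intLe (ic 0) (iv 2)) (
    A[5, iv 2] ≔ rv 10 ;;
    .ite (ltR (ra 2 (iv 2) - ra 7 (iv 2)) (rv 10)) (R[10] ≔ ra 2 (iv 2) - ra 7 (iv 2)) .skip ;;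
    I[2] ≔ iv 2 - ic 1)

/-- Ends of the last nonempty gaps. -/
def gapEndP : Program :=
  R[10] ≔ rc 0 ;; I[2] ≔ iv 0 ;;
  .loop (ltI (iv 2) (ic 3 * iv 0)) (
    .ite (.realLe (ra 4 (iv 2)) (ra 5 (iv 2))) (R[10] ≔ ra 5 (iv 2)) .skip ;;
    A[6, iv 2] ≔ rv 10 ;;
    I[2] ≔ iv 2 + ic 1)

def gapsP : Program := R[9] ≔ stepE 8 ;; lastEndP ;; firstStartP ;; gapEndP

section
variable {n k w : ℕ} {α r : ℝ} {φ D : ℤ → ℝ} {σ : Store}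

theorem lastEndP_spec (S : Ready n k w α r φ D σ) (H : Demands n φ D) :
    WP lastEndP (fun τ m =>
      (∀ u : ℤ, 0 ≤ u → u < 4 * n → τ.A 7 u = halfArc (D u) r (σ.R 8)) ∧
      (∀ u : ℤ, n ≤ u → u < 4 * n → τ.A 4 u = lastEnd φ (fun u => halfArc (D u) r (σ.R 8)) u) ∧
      (m : ℝ) ≤ 240 * n + 20) σ := by
  have G := H.arcSystem r (σ.R 8)
  have hn0 := H.pos
  set h := fun u => halfArc (D u) r (σ.R 8) with hh
  -- The running maximum starts with 0 in place of `-∞`. This is harmless: the end of arc 0 is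
  -- nonnegative, so from the first pass on the register holds a true end.
  have hE0 : 0 ≤ φ 0 + h 0 := add_nonneg H.first_nonneg (G.half_nonneg 0)
  unfold lastEndP
  simp only [wps, evals, costs]
  refine WP_loop (fun τ => 0 ≤ τ.I 2 ∧ τ.I 2 ≤ 4 * n ∧
      (∀ u : ℤ, 0 ≤ u → u < τ.I 2 → τ.A 7 u = h u) ∧
      (∀ u : ℤ, n ≤ u → u < τ.I 2 → τ.A 4 u = lastEnd φ h u) ∧
      (∀ u : ℤ, 0 ≤ u → u < τ.I 2 → φ u + h u ≤ τ.R 10) ∧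
      ((0 = τ.I 2 ∧ τ.R 10 = 0) ∨ ∃ u, u < τ.I 2 ∧ τ.R 10 = φ u + h u))
    (fun τ => (4 * n - τ.I 2) * 60) ?_ ?_ ?_ ?_
  · simp only [reads, reduceIte, Rat.cast_zero]
    exact ⟨le_rfl, by positivity, fun u _ _ => by omega, fun u _ _ => by omega,
      fun u _ _ => by omega, by simp⟩
  · rintro τ - ⟨-, h, -⟩
    have : (τ.I 2 : ℝ) ≤ 4 * n := by exact_mod_cast h
    linarith
  · rintro τ fr ⟨i1, i2, i3, i4, i5, i6⟩ hb
    have e0 : τ.I 0 = n := by rw [fr.I 0 rfl]; simpa [reads] using S.hn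
    have e1 : τ.R 1 = r := by rw [fr.R 1 rfl]; simpa [reads] using S.hr
    have e8 : τ.R 8 = σ.R 8 := by rw [fr.R 8 rfl]; simp [reads]
    obtain ⟨v, hv⟩ : ∃ v, τ.I 2 = v := ⟨_, rfl⟩
    simp only [evals, e0, not_le, hv] at hb
    rw [hv] at i1 i2 i3 i4 i5 i6
    have eφ : τ.A 2 v = φ v := by
      rw [fr.A 2 rfl]; simpa [reads] using S.hφ v i1 hb
    have eD : τ.A 3 v = D v := by
      rw [fr.A 3 rfl]; simpa [reads] using S.hD v i1 hb
    have eh : arccos ((D v * D v + r * r - σ.R 8 * σ.R 8) / (2 * D v * r)) = h v := by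
      simp only [hh, halfArc]; congr 2; ring
    simp only [wps, evals, costs, reads, reduceIte, Nat.reduceEqDiff, Nat.reduceAdd, hv, e0, e1, e8,
      eφ, eD, Rat.cast_ofNat, eh, Function.update_self]
    have key : ∀ X : ℝ, τ.R 10 ≤ X → φ v + h v ≤ X → (X = τ.R 10 ∨ X = φ v + h v) →
        ((∀ u : ℤ, n ≤ u → u < v + 1 → Function.update (τ.A 4) v X u = lastEnd φ h u) ∧
        (∀ u : ℤ, 0 ≤ u → u < v + 1 → φ u + h u ≤ X) ∧
        ((0 = v + 1 ∧ X = 0) ∨ ∃ u, u < v + 1 ∧ X = φ u + h u)) := by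
      intro X hX1 hX2 hX3
      have h1 : ∀ u : ℤ, 0 ≤ u → u < v + 1 → φ u + h u ≤ X := by
        intro u hu hu'
        rcases (show u < v ∨ u = v by omega) with h3 | rfl
        · exact (i5 u hu h3).trans hX1
        · exact hX2
      have h2 : ∃ u, u < v + 1 ∧ X = φ u + h u := by
        rcases hX3 with h3 | h3
        · rcases i6 with ⟨h4, h5⟩ | ⟨u, hu, h4⟩
          · rw [← h4] at hX2
            exact ⟨0, by omega, le_antisymm (by rw [h3, h5]; exact hE0) hX2⟩
          · exact ⟨u, by omega, h3.trans h4⟩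
        · exact ⟨v, by omega, h3⟩
      refine ⟨fun u hu hu' => ?_, h1, Or.inr h2⟩
      by_cases huv : u = v
      · subst huv
        rw [Function.update_self]
        obtain ⟨z, hz, hz'⟩ := h2
        exact (G.lastEnd_eq (by omega) (fun z hz hz' => h1 z hz (by omega))
          ⟨z, by omega, hz'⟩).symm
      · rw [Function.update_of_ne huv]; exact i4 u hu (by omega)
    have key7 : ∀ u : ℤ, 0 ≤ u → u < v + 1 → Function.update (τ.A 7) v (h v) u = h u := by
      intro u hu hu'
      by_cases huv : u = v
      · subst huv; rw [Function.update_self]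
      · rw [Function.update_of_ne huv]; exact i3 u hu (by omega)
    refine ⟨fun hX => ⟨⟨by omega, by omega, key7, ?_⟩, by push_cast; linarith⟩,
      fun hX => ⟨⟨by omega, by omega, key7, ?_⟩, by push_cast; linarith⟩⟩
    · exact key _ (not_le.1 hX).le le_rfl (Or.inr rfl)
    · exact key _ le_rfl (not_not.1 hX) (Or.inl rfl)
  · rintro τ m fr ⟨i1, i2, i3, i4, i5, i6⟩ hb hc
    have e0 : τ.I 0 = n := by rw [fr.I 0 rfl]; simpa [reads] using S.hn
    simp only [evals, e0, not_le, not_lt] at hb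
    refine ⟨fun u hu hu' => i3 u hu (by omega), fun u hu hu' => i4 u hu (by omega), ?_⟩
    have : (τ.I 2 : ℝ) = 4 * n := by exact_mod_cast (le_antisymm i2 hb)
    simp only [reads, reduceIte, costs, this] at hc ⊢
    push_cast at hc ⊢; linarith

theorem firstStartP_spec (S : Ready n k w α r φ D σ) {h : ℤ → ℝ}
    (G : ArcSystem n φ h) (h7 : ∀ u : ℤ, 0 ≤ u → u < 4 * n → σ.A 7 u = h u) :
    WP firstStartP (fun τ m =>
      (∀ u : ℤ, 0 ≤ u → u < 3 * n → τ.A 5 u = firstStart φ h u) ∧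
      (m : ℝ) ≤ 240 * n + 40) σ := by
  have hn0 : (1:ℤ) ≤ n := by exact_mod_cast G.pos
  unfold firstStartP
  simp only [wps, evals, costs, reads, reduceIte, Nat.reduceEqDiff, S.hn]
  have hs : ∀ u : ℤ, 0 ≤ u → u < 4 * n → σ.A 2 u - σ.A 7 u = φ u - h u := fun u hu hu' => by
    rw [S.hφ u hu hu', h7 u hu hu']
  refine WP_loop (fun τ => -1 ≤ τ.I 2 ∧ τ.I 2 ≤ 4 * n - 2 ∧
      (∀ u : ℤ, τ.I 2 < u → u < 3 * n → τ.A 5 u = firstStart φ h u) ∧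
      (∀ u : ℤ, τ.I 2 < u → u < 4 * n → τ.R 10 ≤ φ u - h u) ∧
      (∃ u, τ.I 2 < u ∧ τ.R 10 = φ u - h u))
    (fun τ => (1 + τ.I 2) * 60) ?_ ?_ ?_ ?_
  · simp only [reads, reduceIte, Nat.reduceEqDiff]
    rw [hs _ (by omega) (by omega)]
    refine ⟨by omega, by omega, fun u _ _ => by omega, fun u h1 h2 => ?_, ⟨_, by omega, rfl⟩⟩
    obtain rfl : u = 4 * n - 1 := by omega
    exact le_rfl
  · rintro τ - ⟨h, -⟩
    have : (-1 : ℝ) ≤ τ.I 2 := by exact_mod_cast h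
    linarith
  · rintro τ fr ⟨i1, i2, i3, i4, i5⟩ hb
    obtain ⟨v, hv⟩ : ∃ v, τ.I 2 = v := ⟨_, rfl⟩
    simp only [evals, hv] at hb
    rw [hv] at i1 i2 i3 i4 i5
    have eφ : τ.A 2 v - τ.A 7 v = φ v - h v := by
      rw [fr.A 2 rfl, fr.A 7 rfl]; simpa [reads] using hs v hb (by omega)
    simp only [wps, evals, costs, reads, reduceIte, Nat.reduceEqDiff, Nat.reduceAdd, hv,
      Rat.cast_ofNat]
    rw [eφ]
    -- Entry `v` is written before arc `v` enters the minimum, since `firstStart` ranges over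
    -- strictly later centers. For `v < 3n` the indices between `v` and `4n` contain a whole turn.
    have k5 : ∀ u : ℤ, v - 1 < u → u < 3 * n →
        Function.update (τ.A 5) v (τ.R 10) u = firstStart φ h u := by
      intro u hu hu'
      by_cases huv : u = v
      · subst huv
        rw [Function.update_self]
        exact (G.firstStart_eq (b := 4 * n) (by omega) i4 i5).symm
      · rw [Function.update_of_ne huv]; exact i3 u (by omega) hu'
    obtain ⟨z, hz, hz'⟩ := i5
    refine ⟨fun hX => ⟨⟨by omega, by omega, k5, fun u hu hu' => ?_, ⟨v, by omega, rfl⟩⟩,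
      by push_cast; linarith⟩, fun hX => ⟨⟨by omega, by omega, k5, fun u hu hu' => ?_,
      ⟨z, by omega, hz'⟩⟩, by push_cast; linarith⟩⟩
    · rcases (show v < u ∨ u = v by omega) with h3 | rfl
      · exact (not_le.1 hX).le.trans (i4 u h3 hu')
      · exact le_rfl
    · rcases (show v < u ∨ u = v by omega) with h3 | rfl
      · exact i4 u h3 hu'
      · exact not_not.1 hX
  · rintro τ m fr ⟨i1, i2, i3, -, -⟩ hb hc
    simp only [evals, not_le] at hb
    refine ⟨fun u hu hu' => i3 u (by omega) (by omega), ?_⟩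
    have : (-1 : ℝ) ≤ τ.I 2 := by exact_mod_cast i1
    simp only [reads, reduceIte, costs] at hc ⊢
    push_cast at hc ⊢; linarith

/-- The arrays 4, 5 and 6 describe the gaps between the arcs. -/
structure Gaps (n : ℕ) (φ h : ℤ → ℝ) (τ : Store) : Prop where
  lastEnd : ∀ u : ℤ, n ≤ u → u < 3 * n → τ.A 4 u = lastEnd φ h u
  firstStart : ∀ u : ℤ, n ≤ u → u < 3 * n → τ.A 5 u = firstStart φ h u
  le_gapEnd : ∀ u v : ℤ, n ≤ v → v ≤ u → u < 3 * n →
    ArcSystem.lastEnd φ h v ≤ ArcSystem.firstStart φ h v →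
    ArcSystem.firstStart φ h v ≤ τ.A 6 u
  gapEnd_eq : ∀ u : ℤ, n ≤ u → u < 3 * n → τ.A 6 u = 0 ∨ ∃ v : ℤ, n ≤ v ∧ v ≤ u ∧
    ArcSystem.lastEnd φ h v ≤ ArcSystem.firstStart φ h v ∧ τ.A 6 u = ArcSystem.firstStart φ h v

theorem Gaps.congr {h : ℤ → ℝ} {τ : Store} (g : Gaps n φ h σ) (h4 : τ.A 4 = σ.A 4)
    (h5 : τ.A 5 = σ.A 5) (h6 : τ.A 6 = σ.A 6) : Gaps n φ h τ :=
  ⟨h4 ▸ g.1, h5 ▸ g.2, h6 ▸ g.3, h6 ▸ g.4⟩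

/-- Array 6 holds running maxima of the ends of nonempty gaps, so its comparison with a positive `p`
is monotone in the index. This permits searching by strides; the default 0 stands for "no nonempty
gap yet". -/
theorem Gaps.gapEnd_lt {h : ℤ → ℝ} (g : Gaps n φ h σ) {u v : ℤ} {p : ℝ} (hp : 0 < p)
    (hv : n ≤ v) (hvu : v ≤ u) (hu : u < 3 * n) (hup : σ.A 6 u < p) : σ.A 6 v < p := by
  rcases g.gapEnd_eq v hv (by omega) with h1 | ⟨z, hz, hzv, h2, h3⟩
  · rwa [h1]
  · rw [h3]; exact (g.le_gapEnd u z hz (by omega) hu h2).trans_lt hup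

/-- Because `firstStart` is monotone, the latest nonempty gap has the largest end, and overwriting
the register computes the running maximum. -/
theorem gapEndP_spec (S : Ready n k w α r φ D σ) {h : ℤ → ℝ} (hn0 : 0 < n)
    (hm : Monotone (firstStart φ h))
    (h4 : ∀ u : ℤ, n ≤ u → u < 3 * n → σ.A 4 u = lastEnd φ h u)
    (h5 : ∀ u : ℤ, n ≤ u → u < 3 * n → σ.A 5 u = firstStart φ h u) :
    WP gapEndP (fun τ m => Gaps n φ h τ ∧ (m : ℝ) ≤ 80 * n + 20) σ := by
  unfold gapEndP
  simp only [wps, evals, costs, reads, reduceIte, Nat.reduceEqDiff, S.hn]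
  refine WP_loop (fun τ => n ≤ τ.I 2 ∧ τ.I 2 ≤ 3 * n ∧
      (∀ u v : ℤ, n ≤ v → v ≤ u → u < τ.I 2 → lastEnd φ h v ≤ firstStart φ h v →
        firstStart φ h v ≤ τ.A 6 u) ∧
      (∀ u : ℤ, n ≤ u → u < τ.I 2 → τ.A 6 u = 0 ∨ ∃ v : ℤ, n ≤ v ∧ v ≤ u ∧
        lastEnd φ h v ≤ firstStart φ h v ∧ τ.A 6 u = firstStart φ h v) ∧
      (∀ v : ℤ, n ≤ v → v < τ.I 2 → lastEnd φ h v ≤ firstStart φ h v →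
        firstStart φ h v ≤ τ.R 10) ∧
      (τ.R 10 = 0 ∨ ∃ v : ℤ, n ≤ v ∧ v < τ.I 2 ∧
        lastEnd φ h v ≤ firstStart φ h v ∧ τ.R 10 = firstStart φ h v))
    (fun τ => (3 * n - τ.I 2) * 40) ?_ ?_ ?_ ?_
  · simp only [reads, reduceIte, Rat.cast_zero]
    exact ⟨le_rfl, by omega, fun u v _ _ _ => by omega, fun u _ _ => by omega,
      fun u _ _ => by omega, by simp⟩
  · rintro τ - ⟨-, h, -⟩
    have : (τ.I 2 : ℝ) ≤ 3 * n := by exact_mod_cast h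
    linarith
  · rintro τ fr ⟨i1, i2, i3, i4, i5, i6⟩ hb
    have e0 : τ.I 0 = n := by rw [fr.I 0 rfl]; simpa [reads] using S.hn
    obtain ⟨v, hv⟩ : ∃ v, τ.I 2 = v := ⟨_, rfl⟩
    simp only [evals, e0, not_le, hv] at hb
    rw [hv] at i1 i2 i3 i4 i5 i6
    have e4 : τ.A 4 v = lastEnd φ h v := by
      rw [fr.A 4 rfl]; simpa [reads] using h4 v i1 hb
    have e5 : τ.A 5 v = firstStart φ h v := by
      rw [fr.A 5 rfl]; simpa [reads] using h5 v i1 hb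
    simp only [wps, evals, costs, reads, reduceIte, Nat.reduceEqDiff, Nat.reduceAdd, hv, e4, e5]
    have key : ∀ X : ℝ, (∀ u : ℤ, n ≤ u → u < v + 1 → lastEnd φ h u ≤ firstStart φ h u →
        firstStart φ h u ≤ X) → (X = 0 ∨ ∃ u : ℤ, n ≤ u ∧ u < v + 1 ∧
        lastEnd φ h u ≤ firstStart φ h u ∧ X = firstStart φ h u) →
        (∀ u z : ℤ, n ≤ z → z ≤ u → u < v + 1 → lastEnd φ h z ≤ firstStart φ h z →
          firstStart φ h z ≤ Function.update (τ.A 6) v X u) ∧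
        (∀ u : ℤ, n ≤ u → u < v + 1 → Function.update (τ.A 6) v X u = 0 ∨ ∃ z : ℤ, n ≤ z ∧ z ≤ u ∧
          lastEnd φ h z ≤ firstStart φ h z ∧
          Function.update (τ.A 6) v X u = firstStart φ h z) ∧
        (∀ u : ℤ, n ≤ u → u < v + 1 → lastEnd φ h u ≤ firstStart φ h u →
        firstStart φ h u ≤ X) ∧ (X = 0 ∨ ∃ u : ℤ, n ≤ u ∧ u < v + 1 ∧
        lastEnd φ h u ≤ firstStart φ h u ∧ X = firstStart φ h u) := by
      intro X hX1 hX2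
      refine ⟨fun u z hz hzu hu hne => ?_, fun u hu hu' => ?_, hX1, hX2⟩
      · by_cases huv : u = v
        · subst huv; rw [Function.update_self]; exact hX1 z hz (by omega) hne
        · rw [Function.update_of_ne huv]; exact i3 u z hz hzu (by omega) hne
      · by_cases huv : u = v
        · subst huv; rw [Function.update_self]
          rcases hX2 with h1 | ⟨z, z1, z2, z3⟩
          · exact Or.inl h1
          · exact Or.inr ⟨z, z1, by omega, z3⟩
        · rw [Function.update_of_ne huv]; exact i4 u hu (by omega)
    have hor : ∀ u : ℤ, u < v + 1 → u < v ∨ u = v := fun u hu => by omega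
    refine ⟨fun hX => ⟨⟨by omega, by omega, key _ (fun u hu hu' hne => ?_)
        (Or.inr ⟨v, i1, by omega, hX, rfl⟩)⟩, by push_cast; linarith⟩,
      fun hX => ⟨⟨by omega, by omega, key _ (fun u hu hu' hne => ?_) ?_⟩, by push_cast; linarith⟩⟩
    · exact hm (by omega)
    · rcases hor u hu' with h1 | rfl
      · exact i5 u hu h1 hne
      · exact absurd hne hX
    · rcases i6 with h1 | ⟨z, z1, z2, z3⟩
      · exact Or.inl h1
      · exact Or.inr ⟨z, z1, by omega, z3⟩
  · rintro τ m fr ⟨i1, i2, i3, i4, -, -⟩ hb hc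
    have e0 : τ.I 0 = n := by rw [fr.I 0 rfl]; simpa [reads] using S.hn
    simp only [evals, e0, not_le, not_lt] at hb
    have e4 : τ.A 4 = σ.A 4 := by rw [fr.A 4 rfl]; simp [reads]
    have e5 : τ.A 5 = σ.A 5 := by rw [fr.A 5 rfl]; simp [reads]
    refine ⟨⟨e4 ▸ h4, e5 ▸ h5, fun u v h1 h2 h3 => i3 u v h1 h2 (by omega), fun u h1 h2 =>
      i4 u h1 (by omega)⟩, ?_⟩
    have : (τ.I 2 : ℝ) = 3 * n := by exact_mod_cast (le_antisymm i2 hb)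
    simp only [reads, reduceIte, costs, this] at hc ⊢
    push_cast at hc ⊢; linarith

theorem gapsP_spec (S : Ready n k w α r φ D σ) (H : Demands n φ D) :
    WP gapsP (fun τ m => Gaps n φ (fun u => halfArc (D u) r (σ.R 8)) τ ∧
      τ.R 9 = stepAngle r α (σ.R 8) ∧
      (∀ u : ℤ, 0 ≤ u → u < 4 * n → τ.A 7 u = halfArc (D u) r (σ.R 8)) ∧
      (m : ℝ) ≤ 700 * n) σ := by
  have hn0 := H.pos
  have hn1 : (1:ℝ) ≤ n := by exact_mod_cast hn0
  unfold gapsP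
  simp only [wps, evals, costs, Nat.reduceAdd]
  have es : ((2:ℚ):ℝ) * arcsin (σ.R 8 / (((2:ℚ):ℝ) * σ.R 0 * σ.R 1)) = stepAngle r α (σ.R 8) := by
    rw [S.hα, S.hr, stepAngle]; norm_num
  rw [es]
  have S1 : Ready n k w α r φ D (σ.setR 9 (stepAngle r α (σ.R 8))) :=
    ⟨by simp [reads, S.hn], by simp [reads, S.hk], by simp [reads, S.hw], by simp [reads, S.hα], by simp [reads, S.hr], by simp [reads, S.hpi],
      S.hφ, S.hD⟩
  refine (lastEndP_spec S1 H).use ?_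
  simp only [reads, reduceIte, Nat.reduceEqDiff]
  rintro τ m fr ⟨h7, h4, hm⟩
  have S2 := S1.of_frame fr rfl
  refine (firstStartP_spec S2 (H.arcSystem r (σ.R 8)) h7).use ?_
  rintro τ' m' fr' ⟨h5, hm'⟩
  have S3 := S2.of_frame fr' rfl
  refine (gapEndP_spec S3 hn0 (H.arcSystem r (σ.R 8)).firstStart_mono (fun u hu hu' => ?_) (fun u hu hu' => h5 u (by omega) hu')).use ?_
  · rw [fr'.A 4 rfl]; exact h4 u hu (by omega)
  rintro υ m'' fr'' ⟨hg, hm''⟩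
  refine ⟨hg, ?_, ?_, by push_cast; linarith⟩
  · rw [fr''.R 9 rfl, fr'.R 9 rfl, fr.R 9 rfl]; simp [reads]
  · rw [fr''.A 7 rfl, fr'.A 7 rfl]; exact h7

end

end RealRAM
end

noncomputable section

namespace RealRAM
open Syn ArcSystem

/-! ## The decision procedure -/

/-- Advance register 3 to the first gap whose end is at least register 11. -/
def searchP : Program :=
  .loop (.and (ltI (iv 3 + iv 4) (ic 3 * iv 0)) (ltR (ra 6 (iv 3 + iv 4)) (rv 11)))
    (I[3] ≔ iv 3 + iv 4) ;;
  .loop (ltR (ra 6 (iv 3)) (rv 11)) (I[3] ≔ iv 3 + ic 1)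

/-- The greedy sequence from the start of the gap in register 2. -/
def chainP : Program :=
  R[11] ≔ ra 4 (iv 2) ;; R[12] ≔ rv 11 + rc 2 * rv 4 ;; I[3] ≔ iv 2 ;; I[5] ≔ iv 1 ;;
  .loop (.intLe (ic 1) (iv 5)) (
    I[6] ≔ .floor ((ra 5 (iv 3) - rv 11) / rv 9) + ic 1 ;;
    .ite (.intLe (iv 5) (iv 6)) (
      R[11] ≔ rv 11 + .toReal (iv 5) * rv 9 ;; I[5] ≔ ic 0 ;;
      .ite (.realLe (rv 11) (rv 12)) (I[7] ≔ ic 1) .skip) (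
      I[5] ≔ iv 5 - iv 6 ;; R[11] ≔ rv 11 + .toReal (iv 6) * rv 9 ;;
      .ite (.realLe (rv 11) (rv 12)) (
        searchP ;;
        .ite (ltR (rv 11) (ra 4 (iv 3))) (R[11] ≔ ra 4 (iv 3)) .skip)
        (I[5] ≔ ic 0)))

/-- Decide whether register 8 is a feasible radius. -/
def testP : Program :=
  gapsP ;; I[7] ≔ ic 0 ;; I[2] ≔ iv 0 ;;
  .loop (ltI (iv 2) (ic 2 * iv 0)) (
    .ite (.realLe (ra 4 (iv 2)) (ra 5 (iv 2))) chainP .skip ;;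
    I[2] ≔ iv 2 + ic 1)

section
variable {n k w : ℕ} {α r : ℝ} {φ D : ℤ → ℝ} {σ : Store}

/-- Strides of `w` go on while the gap reached still ends before `p`; then at most `w` unit steps
remain. The cost is bounded in two ways: by the distance travelled, which adds up to one turn over a
whole run, and by O(n/w + w) for a single search. -/
theorem searchP_spec {h : ℤ → ℝ} (h0 : σ.I 0 = n) (h4 : σ.I 4 = w) (hw : 1 ≤ w)
    (g : Gaps n φ h σ) {c e : ℤ} {p : ℝ} (hc : σ.I 3 = c) (hp : σ.R 11 = p) (hp0 : 0 < p)
    (hnc : n ≤ c) (hce : c ≤ e) (he : e < 3 * n) (hcp : σ.A 6 c < p) (hpe : p ≤ σ.A 6 e) :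
    WP searchP (fun τ m => c < τ.I 3 ∧ τ.I 3 ≤ e ∧ p ≤ σ.A 6 (τ.I 3) ∧
      (∀ v : ℤ, n ≤ v → v < τ.I 3 → σ.A 6 v < p) ∧ (m : ℝ) ≤ 21 * (τ.I 3 - c) + 40 ∧
      (m : ℝ) ≤ 42 * (n / w) + 10 * w + 40) σ := by
  have hw' : (1:ℝ) ≤ w := by exact_mod_cast hw
  have hlt : ∀ {v z : ℤ}, n ≤ v → z < 3 * n → p ≤ σ.A 6 v → σ.A 6 z < p → z < v := by
    intro v z h1 h2 h3 h4
    by_contra h5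
    exact absurd (g.gapEnd_lt hp0 h1 (not_lt.1 h5) h2 h4) (not_lt.2 h3)
  have hce' : c < e := hlt (by omega) (by omega) hpe hcp
  unfold searchP
  simp only [wps, evals, costs]
  refine WP_loop (fun τ => c ≤ τ.I 3 ∧ τ.I 3 < e ∧ σ.A 6 (τ.I 3) < p)
    (fun τ => (e - τ.I 3) * (21 / w)) ?_ ?_ ?_ ?_
  · rw [hc]; exact ⟨le_rfl, hce', hcp⟩
  · rintro τ - ⟨-, h, -⟩
    have : (τ.I 3 : ℝ) ≤ e := by exact_mod_cast h.le
    exact mul_nonneg (by linarith) (by positivity)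
  · rintro τ fr ⟨i1, i2, i3⟩ hb
    simp only [evals, fr.I 0 rfl, h0, fr.I 4 rfl, h4, fr.A 6 rfl, fr.R 11 rfl, hp, not_le] at hb
    simp only [wps, evals, costs, reads, reduceIte, fr.I 4 rfl, h4]
    refine ⟨⟨by omega, hlt (by omega) (by omega) hpe hb.2, hb.2⟩, ?_⟩
    have : (w:ℝ) * (21 / w) = 21 := by field_simp
    push_cast; linarith
  · rintro τ m fr ⟨i1, i2, i3⟩ hb hcost
    simp only [evals, fr.I 0 rfl, h0, fr.I 4 rfl, h4, fr.A 6 rfl, fr.R 11 rfl, hp, not_le] at hb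
    refine WP_loop (fun υ => τ.I 3 ≤ υ.I 3 ∧ υ.I 3 ≤ e ∧ ∀ v : ℤ, n ≤ v → v < υ.I 3 → σ.A 6 v < p)
      (fun υ => (e - υ.I 3) * 10) ?_ ?_ ?_ ?_
    · exact ⟨le_rfl, i2.le, fun v h1 h2 => g.gapEnd_lt hp0 h1 h2.le (by omega) i3⟩
    · rintro υ - ⟨-, h, -⟩
      have : (υ.I 3 : ℝ) ≤ e := by exact_mod_cast h
      linarith
    · rintro υ fr' ⟨j1, j2, j3⟩ hb'
      simp only [evals, fr'.A 6 rfl, fr.A 6 rfl, fr'.R 11 rfl, fr.R 11 rfl, hp, not_le] at hb'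
      simp only [wps, evals, costs, reads, reduceIte]
      have h1 := hlt (by omega) (by omega) hpe hb'
      refine ⟨⟨by omega, by omega, fun v h2 h3 => ?_⟩, by push_cast; linarith⟩
      rcases (show v < υ.I 3 ∨ v = υ.I 3 by omega) with h4 | rfl
      · exact j3 v h2 h4
      · exact hb'
    · rintro υ m' fr' ⟨j1, j2, j3⟩ hb' hcost'
      simp only [evals, fr'.A 6 rfl, fr.A 6 rfl, fr'.R 11 rfl, fr.R 11 rfl, hp, not_le,
        not_lt] at hb'
      have h1 : τ.I 3 < υ.I 3 := hlt (by omega) (by omega) hb' i3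
      -- Otherwise one more stride would still have stayed in range at a gap ending before `p`, and
      -- the first loop would not have stopped.
      have h2 : υ.I 3 ≤ τ.I 3 + w := by
        by_contra h3
        exact hb ⟨by omega, j3 _ (by omega) (by omega)⟩
      have h2' : (υ.I 3 : ℝ) ≤ τ.I 3 + w := by exact_mod_cast h2
      have i1' : (c : ℝ) ≤ τ.I 3 := by exact_mod_cast i1
      have h3' : (τ.I 3 : ℝ) - c ≤ 2 * n := by
        have : τ.I 3 - c ≤ 2 * n := by omega
        exact_mod_cast this
      have h4' : (τ.I 3 : ℝ) ≤ υ.I 3 := by exact_mod_cast j1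
      simp only [costs, hc] at hcost hcost'
      push_cast at hcost hcost'
      have e1 : (m:ℝ) ≤ (τ.I 3 - c) * (21 / w) + 17 := by linarith
      have e2 : ((τ.I 3 : ℝ) - c) * (21 / w) ≤ (τ.I 3 - c) * 21 :=
        by
        have : (0:ℝ) ≤ τ.I 3 - c := by linarith
        gcongr
        exact div_le_self (by norm_num) hw'
      have e3 : (τ.I 3 - c) * (21 / w) ≤ 2 * n * (21 / w : ℝ) :=
        mul_le_mul_of_nonneg_right h3' (by positivity)
      have e4 : 2 * n * (21 / w : ℝ) = 42 * (n / w) := by ring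
      refine ⟨by omega, j2, hb', j3, ?_, ?_⟩
      · push_cast; linarith
      · push_cast; linarith

/-- Within a gap the greedy sequence advances by the step. -/
theorem _root_.ArcSystem.greedy_gap {h : ℤ → ℝ} (G : ArcSystem n φ h) {s a : ℝ} (hs : 0 ≤ s)
    {c : ℤ} {j : ℕ} (h1 : lastEnd φ h c ≤ greedy (freeSet φ h) s a j) (i : ℕ)
    (hi : greedy (freeSet φ h) s a j + i * s ≤ firstStart φ h c) :
    greedy (freeSet φ h) s a (j + i) = greedy (freeSet φ h) s a j + i * s := by
  induction i with
  | zero => simp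
  | succ i ih =>
    push_cast at hi
    rw [← add_assoc, greedy, ih (by linarith)]
    have h2 : 0 ≤ i * s := by positivity
    rw [G.nextPoint_self (G.mem_freeSet_of_le_of_le (u := c) (by linarith) (by linarith))]
    push_cast; ring

/-- Each pass makes all steps that fit into the current gap by one floor, then one more step, and
then looks for the next gap. It uses up at least one of the remaining points and moves to a strictly
later gap within one turn. Hence the potential is the minimum of (remaining points) × (cost of one
search) and a multiple of the number of gaps left in the turn. -/
theorem chainP_spec {h : ℤ → ℝ} {s : ℝ} (G : ArcSystem n φ h) (hφ0 : 0 ≤ φ 0) (hk : 1 ≤ k)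
    (hw : 1 ≤ w) (S : Ready n k w α r φ D σ) (g : Gaps n φ h σ) (hs : 0 < s) (h9 : σ.R 9 = s)
    {u : ℤ} (hu : σ.I 2 = u) (hun : n ≤ u) (hun' : u < 2 * n)
    (hne : lastEnd φ h u ≤ firstStart φ h u) :
    WP chainP (fun τ m => τ.I 7 = (open Classical in if
        greedy (freeSet φ h) s (lastEnd φ h u) (k - 1) + s ≤ lastEnd φ h u + 2 * π
        then 1 else σ.I 7) ∧
      (m : ℝ) ≤ 50 + min (k * (42 * ((n:ℝ) / w) + 10 * w + 150)) (200 * n + 200)) σ := by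
  classical
  set y := greedy (freeSet φ h) s (lastEnd φ h u) with hy
  set L := lastEnd φ h u + 2 * π with hL
  set v7 := if y (k - 1) + s ≤ L then 1 else σ.I 7 with hv7
  set W : ℝ := 42 * (n / w) + 10 * w + 150 with hW
  have hn0 : (0:ℤ) < n := by exact_mod_cast G.pos
  have hW0 : 0 ≤ W := by positivity
  have hLe : lastEnd φ h (u + n) = L := G.lastEnd_add u
  have hne' : lastEnd φ h (u + n) ≤ firstStart φ h (u + n) := by
    rw [G.lastEnd_add, G.firstStart_add]; linarith
  have hmem : lastEnd φ h u ∈ freeSet φ h := G.mem_freeSet_of_le_of_le le_rfl hne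
  have hend0 : ∀ c : ℤ, 0 ≤ c → 0 ≤ lastEnd φ h c := fun c hc => by
    have h1 := (G.isGreatest_lastEnd c).2 ⟨c, Set.mem_Iic.2 le_rfl, rfl⟩
    have h2 := G.half_nonneg c
    have h3 := G.mono hc
    simp only at h1; linarith
  unfold chainP
  simp only [wps, evals, costs, reads, reduceIte, Nat.reduceEqDiff, hu, S.hk, S.hpi,
    g.lastEnd u hun (by omega), Rat.cast_ofNat, Nat.reduceAdd]
  refine WP_loop (fun τ => (τ.I 5 = 0 ∧ τ.I 7 = v7) ∨
      (1 ≤ τ.I 5 ∧ τ.I 7 = σ.I 7 ∧ u ≤ τ.I 3 ∧ τ.I 3 ≤ u + n ∧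
        lastEnd φ h (τ.I 3) ≤ τ.R 11 ∧ τ.R 11 ≤ firstStart φ h (τ.I 3) ∧
        ∃ j : ℕ, j + τ.I 5 = k ∧ τ.R 11 = y j))
    (fun τ => if τ.I 5 = 0 then 0 else min (τ.I 5 * W) (200 * (u + n - τ.I 3) + 200)) ?_ ?_ ?_ ?_
  · right
    simp only [reads, reduceIte, Nat.reduceEqDiff]
    exact ⟨by omega, trivial, le_rfl, by omega, le_rfl, hne, 0, by simp, rfl⟩
  · rintro τ - (⟨h1, -⟩ | ⟨h1, -, -, h2, -⟩)
    · simp [h1]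
    · rw [if_neg (by omega)]
      have h1' : (1:ℝ) ≤ τ.I 5 := by exact_mod_cast h1
      have h2' : (τ.I 3:ℝ) ≤ u + n := by exact_mod_cast h2
      exact le_min (by positivity) (by linarith)
  · rintro τ fr (⟨h1, -⟩ | ⟨h1, i7, i1, i2, i3, i4, j, hj, hpos⟩) hb
    · simp [evals, h1] at hb
    clear hb
    obtain ⟨c, hc⟩ : ∃ c, τ.I 3 = c := ⟨_, rfl⟩
    obtain ⟨q, hq⟩ : ∃ q : ℕ, ⌊(firstStart φ h c - τ.R 11) / s⌋ = q := by
      refine Int.eq_ofNat_of_zero_le (Int.floor_nonneg.2 (div_nonneg ?_ hs.le))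
      rw [← hc]; linarith
    obtain ⟨m, hm⟩ := Int.eq_ofNat_of_zero_le (show 0 ≤ τ.I 5 by omega)
    rw [hc] at i1 i2 i3 i4
    rw [hpos] at hq i3 i4
    rw [hm] at h1 hj
    have hq1 : y j + q * s ≤ firstStart φ h c := by
      have := Int.floor_le ((firstStart φ h c - y j) / s)
      rw [hq, le_div_iff₀ hs] at this
      push_cast at this; linarith
    have hq2 : firstStart φ h c < y j + (q + 1) * s := by
      have := Int.lt_floor_add_one ((firstStart φ h c - y j) / s)
      rw [hq, div_lt_iff₀ hs] at this
      push_cast at this; linarith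
    have hgap : ∀ i : ℕ, i ≤ q → y (j + i) = y j + i * s := fun i hi =>
      G.greedy_gap hs.le (c := c) i3 i (by
        have : (i:ℝ) ≤ q := by exact_mod_cast hi
        have := mul_le_mul_of_nonneg_right this hs.le
        simp only [← hy]; linarith)
    have e4 : τ.I 4 = w := by rw [fr.I 4 rfl]; simpa [reads] using S.hw
    have e0 : τ.I 0 = n := by rw [fr.I 0 rfl]; simpa [reads] using S.hn
    have e9 : τ.R 9 = s := by rw [fr.R 9 rfl]; simpa [reads] using h9
    have e12 : τ.R 12 = L := by rw [fr.R 12 rfl]; simp [reads, hL]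
    have gτ : Gaps n φ h τ := g.congr (by rw [fr.A 4 rfl]; simp [reads])
      (by rw [fr.A 5 rfl]; simp [reads]) (by rw [fr.A 6 rfl]; simp [reads])
    simp only [wps, evals, costs, reads, reduceIte, Nat.reduceEqDiff, Nat.reduceAdd, hc, hm, e9, e12,
      gτ.firstStart c (by omega) (by omega), hq, hpos, i7]
    have hm0 : ¬ (m : ℤ) = 0 := by omega
    simp only [hm0, if_false]
    have h1' : (1:ℝ) ≤ m := by exact_mod_cast h1
    have i2' : (c:ℝ) ≤ u + n := by exact_mod_cast i2
    have hmin : 150 ≤ min (m * W) (200 * (u + n - c) + 200) := by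
      have : (0:ℝ) ≤ 42 * (n / w) + 10 * w := by positivity
      refine le_min ?_ (by linarith)
      nlinarith
    push_cast
    -- The closing test concerns `y (k - 1) + s`, not the next free point after it: the last of the
    -- `m` steps may end inside an arc.
    have hfin : m ≤ q + 1 → y (k - 1) + s = y j + m * s := by
      intro h
      rw [show k - 1 = j + (m - 1) by omega, hgap _ (by omega), Nat.cast_sub (by omega)]
      push_cast; ring
    refine ⟨fun hmq => ⟨fun hle => ?_, fun hle => ?_⟩, fun hmq => ⟨fun hle => ?_, fun hle => ?_⟩⟩
    · refine ⟨Or.inl ⟨trivial, ?_⟩, by linarith⟩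
      rw [hv7, if_pos (by rw [hfin (by omega)]; exact hle)]
    · refine ⟨Or.inl ⟨trivial, ?_⟩, by linarith⟩
      rw [hv7, if_neg (by rw [hfin (by omega)]; exact hle)]
    · set p := y j + (q + 1) * s with hp
      have hc0 : 0 ≤ y j := (hend0 c (by omega)).trans i3
      have hp0 : 0 < p := by positivity
      have hcp : τ.A 6 c < p := by
        rcases gτ.gapEnd_eq c (by omega) (by omega) with h2 | ⟨v, -, hv, -, h2⟩
        · rw [h2]; exact hp0
        · rw [h2]; exact (G.firstStart_mono hv).trans_lt hq2
      -- The gap one turn after the starting gap is nonempty and starts at `L ≥ p`, so the search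
      -- ends there at the latest.
      have hpe : p ≤ τ.A 6 (u + n) :=
        (hle.trans (hLe ▸ hne')).trans (gτ.le_gapEnd _ _ (by omega) le_rfl (by omega) hne')
      refine (searchP_spec (n := n) (w := w) (φ := φ) (h := h) (c := c) (e := u + n) (p := p)
        (by simpa [reads] using e0) (by simpa [reads] using e4) hw
        (gτ.congr (by simp [reads]) (by simp [reads]) (by simp [reads])) (by simpa [reads] using hc)
        (by simp [reads]) hp0 (by omega) i2 (by omega) (by simpa [reads] using hcp)
        (by simpa [reads] using hpe)).use ?_
      intro υ m' fr' hυ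
      simp only [reads] at hυ
      have f5 : υ.I 5 = m - (q + 1) := by rw [fr'.I 5 rfl]; simp [reads]
      have f7 : υ.I 7 = σ.I 7 := by rw [fr'.I 7 rfl]; simp [reads, i7]
      have f11 : υ.R 11 = p := by rw [fr'.R 11 rfl]; simp [reads]
      have f4 : υ.A 4 = τ.A 4 := by rw [fr'.A 4 rfl]; simp [reads]
      obtain ⟨d, hd⟩ : ∃ d, υ.I 3 = d := ⟨_, rfl⟩
      rw [hd] at hυ
      obtain ⟨s1, s2, s3, s4, s5, s6⟩ := hυ
      have hdgap : lastEnd φ h d ≤ firstStart φ h d ∧ p ≤ firstStart φ h d := by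
        rcases gτ.gapEnd_eq d (by omega) (by omega) with h2 | ⟨v, v1, v2, v3, v4⟩
        · rw [h2] at s3; linarith
        · obtain rfl : v = d := by
            by_contra hvd
            have := s4 v v1 (by omega)
            have := gτ.le_gapEnd v v v1 le_rfl (by omega) v3
            linarith
          exact ⟨v3, v4 ▸ s3⟩
      have hy' : y (j + (q + 1)) = max p (lastEnd φ h d) := by
        rw [← add_assoc, hy, greedy, ← hy, hgap q le_rfl,
          show y j + q * s + s = p by rw [hp]; ring]
        refine G.nextPoint_eq_max (fun v hv hv' => ?_) hdgap.1 hdgap.2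
        rcases le_or_gt v c with h2 | h2
        · exact (G.firstStart_mono h2).trans_lt hq2
        · exact (gτ.le_gapEnd v v (by omega) le_rfl (by omega) hv').trans_lt (s4 v (by omega) hv)
      have e4d : τ.A 4 d = lastEnd φ h d := gτ.lastEnd d (by omega) (by omega)
      have hpot : ∀ x : ℝ, x ≤ 42 → (if (m:ℤ) - (q + 1) = 0 then 0 else
          min (((m:ℝ) - (q + 1)) * W) (200 * (u + n - d) + 200)) + (x + m') + 4 ≤
          min (m * W) (200 * (u + n - c) + 200) := by
        intro x hx
        rw [if_neg (by omega)]
        have hq0 : (0:ℝ) ≤ q := by positivity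
        have : (c:ℝ) + 1 ≤ d := by exact_mod_cast s1
        refine le_min ?_ ?_
        · have := min_le_left (((m:ℝ) - (q + 1)) * W) (200 * (u + n - d) + 200)
          have := mul_nonneg hq0 hW0
          linarith
        · have := min_le_right (((m:ℝ) - (q + 1)) * W) (200 * (u + n - d) + 200)
          linarith
      simp only [f5, f7, f11, f4, hd, e4d]
      refine ⟨fun hX => ⟨Or.inr ⟨by omega, trivial, by omega, by omega, le_rfl, hdgap.1, j + (q + 1),
        by push_cast; omega, ?_⟩, ?_⟩, fun hX => ⟨Or.inr ⟨by omega, trivial, by omega, by omega,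
        not_not.1 hX, hdgap.2, j + (q + 1), by push_cast; omega, ?_⟩, ?_⟩⟩
      · rw [hy', max_eq_right (not_le.1 hX).le]
      · have := hpot 42 le_rfl
        push_cast at this ⊢
        linarith
      · rw [hy', max_eq_left (not_not.1 hX)]
      · have := hpot 40 (by norm_num)
        push_cast at this ⊢
        linarith
    -- The run has passed `L` while points remain to be placed, so closing is impossible.
    · refine ⟨Or.inl ⟨trivial, ?_⟩, by linarith⟩
      have h2 : y (j + (q + 1)) ≤ y (k - 1) := G.greedy_mono hmem hs.le (by omega)
      have h3 : y (j + q) + s ≤ y (j + (q + 1)) := G.greedy_step hmem s (j + q)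
      rw [hgap q le_rfl] at h3
      rw [hv7, if_neg (by linarith)]
  · rintro τ m fr (⟨h1, h7⟩ | ⟨h1, -⟩) hb hc
    · refine ⟨h7, ?_⟩
      simp only [h1, reads, reduceIte, Nat.reduceEqDiff, costs] at hc
      rw [if_neg (by omega)] at hc
      push_cast at hc ⊢
      rw [show (u:ℝ) + n - u = n by ring] at hc
      linarith
    · simp [evals] at hb; omega

/-- By `exists_greedy_of_hasChain` it suffices to try the nonempty gaps in `[n, 2n)`. Register 7 is
set by a successful run and never reset. -/
theorem testP_spec (H : Demands n φ D) (hk : 1 ≤ k) (hw : 1 ≤ w) (S : Ready n k w α r φ D σ)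
    (hs : 0 < stepAngle r α (σ.R 8)) :
    WP testP (fun τ m => τ.I 7 = (open Classical in
        if HasChain (Demands.free φ D r (σ.R 8)) (stepAngle r α (σ.R 8)) k then 1 else 0) ∧
      (m : ℝ) ≤ 900 * n + n * min (k * (42 * ((n:ℝ) / w) + 10 * w + 150)) (200 * n + 200)) σ := by
  classical
  have hn0 := H.pos
  have hn1 : (1:ℝ) ≤ n := by exact_mod_cast hn0
  set h : ℤ → ℝ := fun u => halfArc (D u) r (σ.R 8) with hh
  set s := stepAngle r α (σ.R 8) with hs'
  set Z := min (k * (42 * ((n:ℝ) / w) + 10 * w + 150)) (200 * n + 200) with hZ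
  have hZ0 : 0 ≤ Z := by positivity
  have G : ArcSystem n φ h := H.arcSystem r (σ.R 8)
  let good : ℤ → Prop := fun u => lastEnd φ h u ≤ firstStart φ h u ∧
    greedy (freeSet φ h) s (lastEnd φ h u) (k - 1) + s ≤ lastEnd φ h u + 2 * π
  have hgood : HasChain (freeSet φ h) s k ↔ ∃ u : ℤ, n ≤ u ∧ u < 2 * n ∧ good u :=
    ⟨G.exists_greedy_of_hasChain hk, fun ⟨u, _, _, h1, h2⟩ => G.hasChain_of_greedy hk
      (G.mem_freeSet_of_le_of_le le_rfl h1) h2⟩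
  unfold testP
  rw [WP_seq]
  refine (gapsP_spec S H).use ?_
  rintro τ m fr ⟨g, h9, -, hm⟩
  have S1 := S.of_frame fr rfl
  simp only [wps, evals, costs, reads, reduceIte, Nat.reduceEqDiff, S1.hn]
  refine WP_loop (fun υ => n ≤ υ.I 2 ∧ υ.I 2 ≤ 2 * n ∧
      υ.I 7 = if ∃ u : ℤ, n ≤ u ∧ u < υ.I 2 ∧ good u then 1 else 0)
    (fun υ => (2 * n - υ.I 2) * (Z + 80)) ?_ ?_ ?_ ?_
  · simp only [reads, reduceIte, Nat.reduceEqDiff]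
    refine ⟨le_rfl, by omega, ?_⟩
    rw [if_neg]
    rintro ⟨u, h1, h2, -⟩; omega
  · rintro υ - ⟨-, h, -⟩
    have : (υ.I 2 : ℝ) ≤ 2 * n := by exact_mod_cast h
    exact mul_nonneg (by linarith) (by linarith)
  · rintro υ fr' ⟨i1, i2, i3⟩ hb
    have e0 : υ.I 0 = n := by rw [fr'.I 0 rfl]; simpa [reads] using S1.hn
    obtain ⟨v, hv⟩ : ∃ v, υ.I 2 = v := ⟨_, rfl⟩
    simp only [evals, e0, not_le, hv] at hb
    rw [hv] at i1 i2 i3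
    have g' : Gaps n φ h υ := g.congr (by rw [fr'.A 4 rfl]; simp [reads])
      (by rw [fr'.A 5 rfl]; simp [reads]) (by rw [fr'.A 6 rfl]; simp [reads])
    have S' : Ready n k w α r φ D υ :=
      ⟨e0, by rw [fr'.I 1 rfl]; simpa [reads] using S1.hk,
        by rw [fr'.I 4 rfl]; simpa [reads] using S1.hw,
        by rw [fr'.R 0 rfl]; simpa [reads] using S1.hα,
        by rw [fr'.R 1 rfl]; simpa [reads] using S1.hr,
        by rw [fr'.R 4 rfl]; simpa [reads] using S1.hpi,
        by rw [fr'.A 2 rfl]; simpa [reads] using S1.hφ,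
        by rw [fr'.A 3 rfl]; simpa [reads] using S1.hD⟩
    have e9 : υ.R 9 = s := by rw [fr'.R 9 rfl]; simpa [reads] using h9
    have hsucc : (∃ u : ℤ, n ≤ u ∧ u < v + 1 ∧ good u) ↔ (good v ∨ ∃ u : ℤ, n ≤ u ∧ u < v ∧ good u) := by
      constructor
      · rintro ⟨u, h1, h2, h3⟩
        rcases (show u < v ∨ u = v by omega) with h4 | rfl
        · exact Or.inr ⟨u, h1, h4, h3⟩
        · exact Or.inl h3
      · rintro (h1 | ⟨u, h1, h2, h3⟩)
        · exact ⟨v, i1, by omega, h1⟩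
        · exact ⟨u, h1, by omega, h3⟩
    simp only [wps, evals, costs, hv, g'.lastEnd v i1 (by omega), g'.firstStart v i1 (by omega)]
    refine ⟨fun hne => (chainP_spec G H.first_nonneg hk hw S' g' hs e9 hv i1 hb hne).use ?_,
      fun hne => ?_⟩
    · rintro x mx frx ⟨h7, hmx⟩
      have ex : x.I 2 = v := by rw [frx.I 2 rfl, hv]
      simp only [reads, reduceIte, Nat.reduceEqDiff, ex]
      refine ⟨⟨by omega, by omega, ?_⟩, ?_⟩
      · rw [h7, i3]
        by_cases h1 : good v
        · rw [if_pos h1.2, if_pos (hsucc.2 (Or.inl h1))]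
        · rw [if_neg (fun h2 => h1 ⟨hne, h2⟩)]
          simp only [hsucc, h1, false_or]
      · push_cast; linarith
    · simp only [reads, reduceIte, Nat.reduceEqDiff, hv]
      refine ⟨⟨by omega, by omega, ?_⟩, by push_cast; linarith⟩
      have h1 : ¬ good v := fun h1 => hne h1.1
      simp only [i3, hsucc, h1, false_or]
  · rintro υ m' fr' ⟨i1, i2, i3⟩ hb hc
    have e0 : υ.I 0 = n := by rw [fr'.I 0 rfl]; simpa [reads] using S1.hn
    simp only [evals, e0, not_le, not_lt] at hb
    have e2 : υ.I 2 = 2 * n := le_antisymm i2 hb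
    refine ⟨?_, ?_⟩
    · rw [i3, e2]
      simp only [Demands.free, ← hh, hgood]
    · simp only [reads, reduceIte, costs, e2] at hc ⊢
      push_cast at hc ⊢; linarith

end

end RealRAM
end

noncomputable section

/-! ## Counting array entries -/

open Classical in
/-- The number of indices `i` with `a ≤ i < b` such that `p (f i)`. -/
def cnt (p : ℝ → Prop) (f : ℤ → ℝ) (a b : ℤ) : ℕ := ((Finset.Ico a b).filter fun i => p (f i)).card

section
variable {p q : ℝ → Prop} {f g : ℤ → ℝ} {a b c : ℤ}

@[simp] theorem cnt_self : cnt p f a a = 0 := by simp [cnt]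

theorem cnt_add (hab : a ≤ b) (hbc : b ≤ c) : cnt p f a b + cnt p f b c = cnt p f a c := by
  classical
  unfold cnt
  rw [← Finset.Ico_union_Ico_eq_Ico hab hbc, Finset.filter_union, Finset.card_union_of_disjoint]
  exact Finset.disjoint_filter_filter (Finset.Ico_disjoint_Ico_consecutive a b c)

theorem cnt_succ [Decidable (p (f b))] (hab : a ≤ b) :
    cnt p f a (b + 1) = cnt p f a b + if p (f b) then 1 else 0 := by
  classical
  rw [← cnt_add hab (by omega)]
  congr 1
  have : Finset.Ico b (b + 1) = {b} := by ext; simp; omega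
  rw [cnt, this, Finset.filter_singleton]
  split_ifs <;> simp

theorem cnt_congr (h : ∀ i, a ≤ i → i < b → f i = g i) : cnt p f a b = cnt p g a b := by
  classical
  unfold cnt
  congr 1
  refine Finset.filter_congr fun i hi => ?_
  rw [Finset.mem_Ico] at hi
  rw [h i hi.1 hi.2]

theorem cnt_imp (h : ∀ x, p x → q x) : cnt p f a b ≤ cnt q f a b := by
  classical
  exact Finset.card_le_card (Finset.monotone_filter_right _ fun i _ => h (f i))

theorem cnt_pos {i : ℤ} (hi : a ≤ i) (hi' : i < b) (h : p (f i)) : 1 ≤ cnt p f a b := by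
  classical
  exact Finset.card_pos.2 ⟨i, Finset.mem_filter.2 ⟨Finset.mem_Ico.2 ⟨hi, hi'⟩, h⟩⟩

theorem exists_of_cnt_pos (h : 1 ≤ cnt p f a b) : ∃ i, a ≤ i ∧ i < b ∧ p (f i) := by
  classical
  obtain ⟨i, hi⟩ := Finset.card_pos.1 h
  rw [Finset.mem_filter, Finset.mem_Ico] at hi
  exact ⟨i, hi.1.1, hi.1.2, hi.2⟩

theorem cnt_of_forall (hab : a ≤ b) (h : ∀ i, a ≤ i → i < b → p (f i)) :
    (cnt p f a b : ℤ) = b - a := by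
  classical
  unfold cnt
  rw [Finset.filter_true_of_mem fun i hi => ?_]
  · simp; omega
  · rw [Finset.mem_Ico] at hi; exact h i hi.1 hi.2

theorem cnt_true (hab : a ≤ b) : (cnt (fun _ => True) f a b : ℤ) = b - a :=
  cnt_of_forall hab fun _ _ _ => trivial

theorem cnt_add_cnt_not : cnt p f a b + cnt (fun x => ¬ p x) f a b = cnt (fun _ => True) f a b := by
  classical
  unfold cnt
  rw [Finset.card_filter_add_card_filter_not]
  simp

theorem cnt_le (hab : a ≤ b) : (cnt p f a b : ℤ) ≤ b - a := by
  rw [← cnt_true (f := f) hab]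
  exact_mod_cast cnt_imp fun _ _ => trivial

end

/-! ## Lists with sorted blocks -/

/-- The blocks of length `s` of the first `M` entries are sorted. -/
def SortedBlocks (s M : ℤ) (f : ℤ → ℝ) : Prop :=
  ∀ i j, 0 ≤ i → i ≤ j → j < M → i / s = j / s → f i ≤ f j

/-- Omit every other entry of a list with sorted blocks. -/
theorem SortedBlocks.thin {s M : ℤ} {f : ℤ → ℝ} (h : SortedBlocks (2 * s) M f) :
    SortedBlocks s (M / 2) (fun i => f (2 * i + 1)) := by
  intro i j hi hij hj hd
  have key : ∀ i : ℤ, (2 * i + 1) / (2 * s) = i / s := fun i => by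
    rw [← Int.ediv_ediv_of_nonneg (by norm_num : (0:ℤ) ≤ 2)]
    congr 1; omega
  exact h _ _ (by omega) (by omega) (by omega) (by rw [key, key, hd])

open Classical in
theorem cnt_thin_eq {p : ℝ → Prop} {M : ℤ} {f : ℤ → ℝ} :
    cnt p (fun i => f (2 * i + 1)) 0 (M / 2) =
      ((Finset.Ico 0 M).filter fun i => i % 2 = 1 ∧ p (f i)).card := by
  unfold cnt
  refine Finset.card_bij (fun i _ => 2 * i + 1) ?_ ?_ ?_
  · intro i hi
    simp only [Finset.mem_filter, Finset.mem_Ico] at hi ⊢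
    exact ⟨by omega, by omega, hi.2⟩
  · intro i _ j _ hij; omega
  · intro j hj
    simp only [Finset.mem_filter, Finset.mem_Ico] at hj
    refine ⟨j / 2, ?_, by omega⟩
    simp only [Finset.mem_filter, Finset.mem_Ico]
    rw [show 2 * (j / 2) + 1 = j by omega]
    exact ⟨by omega, hj.2.2⟩

theorem cnt_thin_le {p : ℝ → Prop} {M : ℤ} {f : ℤ → ℝ} :
    cnt p (fun i => f (2 * i + 1)) 0 (M / 2) ≤ cnt p f 0 M := by
  classical
  rw [cnt_thin_eq]
  exact Finset.card_le_card (Finset.monotone_filter_right _ fun i _ h => h.2)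

/-- For a down-closed `p`, the entries satisfying it form an initial segment of each sorted block.
Blocks have even length, so positions `2i` and `2i + 1` share a block: a counted odd position has a
counted even partner, and per block at most one counted even position lacks an odd partner. -/
theorem SortedBlocks.cnt_thin {s M : ℤ} {f : ℤ → ℝ} {p : ℝ → Prop} (hs : 0 < s) (hM : 0 ≤ M)
    (h : SortedBlocks (2 * s) M f) (hp : ∀ x y, x ≤ y → p y → p x) :
    2 * cnt p (fun i => f (2 * i + 1)) 0 (M / 2) ≤ cnt p f 0 M ∧
    (cnt p f 0 M : ℤ) ≤ 2 * cnt p (fun i => f (2 * i + 1)) 0 (M / 2) + M / (2 * s) + 1 := by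
  classical
  set O := (Finset.Ico 0 M).filter fun i => i % 2 = 1 ∧ p (f i) with hO
  set E := (Finset.Ico 0 M).filter fun i => i % 2 = 0 ∧ p (f i) with hE
  have hcard : cnt p f 0 M = E.card + O.card := by
    rw [hE, hO, ← Finset.card_union_of_disjoint]
    · unfold cnt; congr 1; ext i
      simp only [Finset.mem_filter, Finset.mem_Ico, Finset.mem_union]
      have := Int.emod_two_eq_zero_or_one i
      tauto
    · refine Finset.disjoint_filter.2 fun i _ h1 h2 => ?_
      omega
  have hpair : ∀ i : ℤ, i % 2 = 0 → (i + 1) / (2 * s) = i / (2 * s) := fun i hi => by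
    rw [← Int.ediv_ediv_of_nonneg (by norm_num : (0:ℤ) ≤ 2),
      ← Int.ediv_ediv_of_nonneg (by norm_num : (0:ℤ) ≤ 2)]
    congr 1; omega
  rw [cnt_thin_eq, hcard]
  change 2 * O.card ≤ _ ∧ ((E.card + O.card : ℕ) : ℤ) ≤ 2 * (O.card : ℤ) + _ + _
  have hOE : O.card ≤ E.card := by
    refine Finset.card_le_card_of_injOn (fun i => i - 1) ?_ fun i _ j _ hij => by
      simp only at hij; omega
    intro i hi
    simp only [hO, hE, Finset.coe_filter, Finset.mem_Ico, Set.mem_ofPred_eq] at hi ⊢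
    refine ⟨by omega, by omega, hp _ _ (h (i - 1) i (by omega) (by omega) (by omega) ?_) hi.2.2⟩
    rw [← hpair (i - 1) (by omega), sub_add_cancel]
  have hsplit : E.card = (E.filter fun i => i + 1 ∈ O).card + (E.filter fun i => ¬ (i + 1 ∈ O)).card :=
    (Finset.card_filter_add_card_filter_not _).symm
  have h1 : (E.filter fun i => i + 1 ∈ O).card ≤ O.card := by
    refine Finset.card_le_card_of_injOn (fun i => i + 1) ?_ fun i _ j _ hij => by
      simp only at hij; omega
    intro i hi
    simp only [Finset.coe_filter, Set.mem_ofPred_eq] at hi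
    exact hi.2
  -- Two unmatched even positions cannot share a block: the successor of the earlier one lies below
  -- the later one and so satisfies `p`. Hence they inject into the blocks.
  have h2 : (E.filter fun i => ¬ (i + 1 ∈ O)).card ≤ (Finset.Icc 0 (M / (2 * s))).card := by
    refine Finset.card_le_card_of_injOn (fun i => i / (2 * s)) ?_ ?_
    · intro i hi
      simp only [hO, hE, Finset.coe_filter, Finset.mem_filter, Finset.mem_Ico,
        Set.mem_ofPred_eq] at hi
      simp only [Finset.coe_Icc, Set.mem_Icc]
      exact ⟨Int.ediv_nonneg (by omega) (by omega), Int.ediv_le_ediv (by omega) (by omega)⟩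
    · have key : ∀ i j : ℤ, i ∈ E → i + 1 ∉ O → j ∈ E → i / (2 * s) = j / (2 * s) → ¬ i < j := by
        intro i j hi hi' hj hd hij
        simp only [hO, hE, Finset.mem_filter, Finset.mem_Ico] at hi hi' hj
        refine hi' ⟨by omega, by omega, hp _ _ (h (i + 1) j (by omega) (by omega) (by omega) ?_)
          hj.2.2⟩
        rw [hpair i hi.2.1, hd]
      intro i hi j hj hij
      simp only [Finset.coe_filter, Set.mem_ofPred_eq] at hi hj
      exact le_antisymm (not_lt.1 (key j i hj.1 hj.2 hi.1 hij.symm))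
        (not_lt.1 (key i j hi.1 hi.2 hj.1 hij))
  have h3 : ((Finset.Icc 0 (M / (2 * s))).card : ℤ) = M / (2 * s) + 1 := by
    have : 0 ≤ M / (2 * s) := Int.ediv_nonneg hM (by omega)
    simp; omega
  refine ⟨by omega, by push_cast; omega⟩

namespace RealRAM
open Syn

/-! ## Approximate medians -/

/-- Merge the segments from register 14 to 17 and from 17 to 18 of array `s` into array `d`. -/
def mergeP (s d : ℕ) : Program :=
  I[15] ≔ iv 14 ;; I[16] ≔ iv 17 ;; I[19] ≔ iv 14 ;;
  .loop (ltI (iv 19) (iv 18)) (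
    .ite (.and (ltI (iv 16) (iv 18))
        (.not (.and (ltI (iv 15) (iv 17)) (.realLe (ra s (iv 15)) (ra s (iv 16))))))
      (A[d, iv 19] ≔ ra s (iv 16) ;; I[16] ≔ iv 16 + ic 1)
      (A[d, iv 19] ≔ ra s (iv 15) ;; I[15] ≔ iv 15 + ic 1) ;;
    I[19] ≔ iv 19 + ic 1)

/-- Everything written so far is at most everything still unread. Equality of `cnt p` for all `p`
expresses that the multiset is kept, without naming a permutation. -/
theorem mergeP_spec {s d : ℕ} (hsd : s ≠ d) {σ : Store} {b m e : ℤ} (hb : σ.I 14 = b)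
    (hm : σ.I 17 = m) (he : σ.I 18 = e) (hbm : b ≤ m) (hme : m ≤ e)
    (h1 : ∀ i j, b ≤ i → i ≤ j → j < m → σ.A s i ≤ σ.A s j)
    (h2 : ∀ i j, m ≤ i → i ≤ j → j < e → σ.A s i ≤ σ.A s j) :
    WP (mergeP s d) (fun τ c => (∀ i j, b ≤ i → i ≤ j → j < e → τ.A d i ≤ τ.A d j) ∧
      (∀ i, i < b → τ.A d i = σ.A d i) ∧ (∀ p, cnt p (τ.A d) b e = cnt p (σ.A s) b e) ∧
      (c : ℝ) ≤ 40 * (e - b) + 15) σ := by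
  have hds : d ≠ s := hsd.symm
  set f := σ.A s with hf
  unfold mergeP
  simp only [wps, evals, costs]
  refine WP_loop (fun τ => b ≤ τ.I 15 ∧ τ.I 15 ≤ m ∧ m ≤ τ.I 16 ∧ τ.I 16 ≤ e ∧
      τ.I 19 = τ.I 15 + τ.I 16 - m ∧
      (∀ i j, b ≤ i → i ≤ j → j < τ.I 19 → τ.A d i ≤ τ.A d j) ∧
      (∀ i, i < b → τ.A d i = σ.A d i) ∧
      (∀ i j, b ≤ i → i < τ.I 19 → τ.I 15 ≤ j → j < m → τ.A d i ≤ f j) ∧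
      (∀ i j, b ≤ i → i < τ.I 19 → τ.I 16 ≤ j → j < e → τ.A d i ≤ f j) ∧
      (∀ p, cnt p (τ.A d) b (τ.I 19) = cnt p f b (τ.I 15) + cnt p f m (τ.I 16)))
    (fun τ => (e - τ.I 19) * 40) ?_ ?_ ?_ ?_
  · simp only [reads, reduceIte, Nat.reduceEqDiff, hb, hm]
    exact ⟨le_rfl, hbm, le_rfl, hme, by omega, fun i j _ _ _ => by omega, fun i hi => trivial,
      fun i j _ _ => by omega, fun i j _ _ => by omega, by simp⟩
  · rintro τ - ⟨i1, i2, i3, i4, i5, -⟩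
    have : (τ.I 19 : ℝ) ≤ e := by exact_mod_cast (by omega : τ.I 19 ≤ e)
    linarith
  · rintro τ fr ⟨i1, i2, i3, i4, i5, i6, i7, i8, i9, i10⟩ hlt
    have e17 : τ.I 17 = m := by rw [fr.I 17 rfl]; simpa [reads] using hm
    have e18 : τ.I 18 = e := by rw [fr.I 18 rfl]; simpa [reads] using he
    have es : τ.A s = f := by
      rw [fr.A s (by simp [Program.modArr, hds])]; simp [reads, hf]
    obtain ⟨i, hi⟩ : ∃ i, τ.I 15 = i := ⟨_, rfl⟩
    obtain ⟨j, hj⟩ : ∃ j, τ.I 16 = j := ⟨_, rfl⟩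
    obtain ⟨t, ht⟩ : ∃ t, τ.I 19 = t := ⟨_, rfl⟩
    simp only [evals, e18, not_le, ht] at hlt
    rw [hi] at i1 i2 i5 i8 i10
    rw [hj] at i3 i4 i5 i9 i10
    rw [ht] at i5 i6 i8 i9 i10
    simp only [wps, evals, costs, reads, reduceIte, Nat.reduceEqDiff, Nat.reduceAdd, hi, hj, ht, e17,
      e18, es, not_le]
    have hsort : ∀ x, (∀ z, b ≤ z → z < t → τ.A d z ≤ x) → ∀ u v, b ≤ u → u ≤ v → v < t + 1 →
        Function.update (τ.A d) t x u ≤ Function.update (τ.A d) t x v := by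
      intro x hx u v hu huv hv
      rcases (show v < t ∨ v = t by omega) with h3 | rfl
      · rw [Function.update_of_ne (by omega), Function.update_of_ne (by omega)]
        exact i6 u v hu huv h3
      · rw [Function.update_self]
        rcases (show u < v ∨ u = v by omega) with h3 | rfl
        · rw [Function.update_of_ne (by omega)]; exact hx u hu h3
        · rw [Function.update_self]
    have hout : ∀ x, ∀ z, z < b → Function.update (τ.A d) t x z = σ.A d z := by
      intro x z hz
      rw [Function.update_of_ne (by omega)]; exact i7 z hz
    have hle : ∀ (x y : ℝ) (z : ℤ), z < t + 1 → (z < t → τ.A d z ≤ y) → x ≤ y →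
        Function.update (τ.A d) t x z ≤ y := by
      intro x y z hz h3 h4
      by_cases hzt : z = t
      · subst hzt; rwa [Function.update_self]
      · rw [Function.update_of_ne hzt]; exact h3 (by omega)
    have hcnt : ∀ x p, cnt p (Function.update (τ.A d) t x) b (t + 1) =
        cnt p f b i + cnt p f m j + (open Classical in if p x then 1 else 0) := by
      classical
      intro x p
      rw [cnt_succ (by omega), Function.update_self, ← i10 p]
      congr 1
      refine cnt_congr fun z _ hz => Function.update_of_ne (by omega) _ _
    classical
    refine ⟨fun ⟨hje, hX⟩ => ⟨⟨i1, i2, by omega, by omega, by omega, ?_, hout _, ?_, ?_, ?_⟩,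
      by push_cast; linarith⟩, fun hX => ?_⟩
    · exact hsort _ fun z hz hz' => i9 z j hz hz' le_rfl hje
    · intro z u hz hz' hu hu'
      refine hle _ _ z hz' (fun h3 => i8 z u hz h3 hu hu') ?_
      by_contra h3
      rw [not_le] at h3
      exact hX ⟨by omega, (h1 i u i1 hu hu').trans h3.le⟩
    · intro z u hz hz' hu hu'
      exact hle _ _ z hz' (fun h3 => i9 z u hz h3 (by omega) hu') (h2 j u i3 (by omega) hu')
    · intro p
      rw [hcnt, cnt_succ i3, add_assoc]
    · have hcase : i < m ∧ (j < e → f i ≤ f j) := by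
        by_cases h3 : j < e
        · have := not_not.1 (not_and.1 hX h3); exact ⟨this.1, fun _ => this.2⟩
        · exact ⟨by omega, fun h4 => absurd h4 h3⟩
      refine ⟨⟨by omega, by omega, i3, i4, by omega, ?_, hout _, ?_, ?_, ?_⟩,
        by push_cast; linarith⟩
      · exact hsort _ fun z hz hz' => i8 z i hz hz' le_rfl hcase.1
      · intro z u hz hz' hu hu'
        exact hle _ _ z hz' (fun h3 => i8 z u hz h3 (by omega) hu') (h1 i u i1 (by omega) hu')
      · intro z u hz hz' hu hu'
        exact hle _ _ z hz' (fun h3 => i9 z u hz h3 hu hu')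
          ((hcase.2 (by omega)).trans (h2 j u i3 hu hu'))
      · intro p
        rw [hcnt, cnt_succ i1]; ring
  · rintro τ c fr ⟨i1, i2, i3, i4, i5, i6, i7, i8, i9, i10⟩ hlt hc
    have e18 : τ.I 18 = e := by rw [fr.I 18 rfl]; simpa [reads] using he
    simp only [evals, e18, not_le, not_lt] at hlt
    have e15 : τ.I 15 = m := by omega
    have e16 : τ.I 16 = e := by omega
    have e19 : τ.I 19 = e := by omega
    rw [e19] at i6 i10
    rw [e15, e16] at i10
    refine ⟨i6, i7, fun p => ?_, ?_⟩
    · rw [i10, cnt_add hbm hme]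
    · simp only [reads, reduceIte, Nat.reduceEqDiff, costs, e19, hb] at hc ⊢
      push_cast at hc ⊢; linarith

/-- Replace register `x` by its minimum with register 12. -/
def capP (x : ℕ) : Program := .ite (ltI (iv 12) (iv x)) (I[x] ≔ iv 12) .skip

theorem capP_spec (x : ℕ) (σ : Store) :
    WP (capP x) (fun τ m => τ.I x = min (σ.I x) (σ.I 12) ∧ m ≤ 10) σ := by
  unfold capP
  simp only [wps, evals, costs, reads, reduceIte]
  exact ⟨fun h => ⟨(min_eq_right (not_le.1 h).le).symm, by norm_num⟩,
    fun h => ⟨(min_eq_left (not_not.1 h)).symm, by norm_num⟩⟩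

/-- Merge the blocks of length register 13 in pairs. -/
def mergeBlocksP (s d : ℕ) : Program :=
  I[14] ≔ ic 0 ;;
  .loop (ltI (iv 14) (iv 12)) (
    I[17] ≔ iv 14 + iv 13 ;; capP 17 ;;
    I[18] ≔ iv 14 + ic 2 * iv 13 ;; capP 18 ;;
    mergeP s d ;;
    I[14] ≔ iv 14 + ic 2 * iv 13)

/-- Each pass starts at a multiple `2hq` of the doubled length; capping at `M` accounts for an
incomplete or missing last block, and `mergeP` leaves the finished part before `b` untouched. -/
theorem mergeBlocksP_spec {s d : ℕ} (hsd : s ≠ d) {σ : Store} {M h : ℤ} (h12 : σ.I 12 = M)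
    (h13 : σ.I 13 = h) (hM : 0 ≤ M) (hh : 0 < h) (hf : SortedBlocks h M (σ.A s)) :
    WP (mergeBlocksP s d) (fun τ c => SortedBlocks (2 * h) M (τ.A d) ∧
      (∀ p, cnt p (τ.A d) 0 M = cnt p (σ.A s) 0 M) ∧ (c : ℝ) ≤ 120 * M + 10) σ := by
  have hds : d ≠ s := hsd.symm
  set f := σ.A s with hf'
  unfold mergeBlocksP
  simp only [wps, evals, costs]
  refine WP_loop (fun τ => (∃ q, 0 ≤ q ∧ τ.I 14 = 2 * h * q) ∧
      SortedBlocks (2 * h) (min (τ.I 14) M) (τ.A d) ∧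
      ∀ p, cnt p (τ.A d) 0 (min (τ.I 14) M) = cnt p f 0 (min (τ.I 14) M))
    (fun τ => (M - (min (τ.I 14) M : ℤ)) * 120) ?_ ?_ ?_ ?_
  · simp only [reads, reduceIte, min_eq_left hM]
    exact ⟨⟨0, le_rfl, by simp⟩, fun i j _ _ _ => by omega, by simp⟩
  · rintro τ - -
    have : ((min (τ.I 14) M : ℤ) : ℝ) ≤ M := by exact_mod_cast min_le_right _ _
    linarith
  · rintro τ fr ⟨⟨q, hq0, hq⟩, i2, i3⟩ hlt
    have e12 : τ.I 12 = M := by rw [fr.I 12 rfl]; simpa [reads] using h12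
    have e13 : τ.I 13 = h := by rw [fr.I 13 rfl]; simpa [reads] using h13
    have es : τ.A s = f := by
      rw [fr.A s (by simp [Program.modArr, mergeP, capP, hds])]; simp [reads, hf']
    obtain ⟨b, hb⟩ : ∃ b, τ.I 14 = b := ⟨_, rfl⟩
    rw [hb] at hq i2 i3
    simp only [evals, e12, not_le, hb] at hlt
    rw [min_eq_left hlt.le] at i2 i3
    have hb0 : 0 ≤ b := by rw [hq]; positivity
    have hdiv : ∀ i, b ≤ i → i < b + 2 * h → i / (2 * h) = q := fun i hi hi' => by
      rw [Int.ediv_eq_iff_of_pos (by omega)]; constructor <;> linarith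
    have hdiv1 : ∀ i, b ≤ i → i < b + h → i / h = 2 * q := fun i hi hi' => by
      rw [Int.ediv_eq_iff_of_pos (by omega)]; constructor <;> linarith
    have hdiv2 : ∀ i, b + h ≤ i → i < b + 2 * h → i / h = 2 * q + 1 := fun i hi hi' => by
      rw [Int.ediv_eq_iff_of_pos (by omega)]; constructor <;> linarith
    have hdiv0 : ∀ i, i < b → i / (2 * h) < q := fun i hi => by
      rw [Int.ediv_lt_iff_lt_mul (by omega)]; linarith
    simp only [wps, evals, costs, hb, e13, reads]
    refine (capP_spec 17 _).use ?_
    rintro τ1 c1 fr1 ⟨g1, hc1⟩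
    simp only [reads, reduceIte, Nat.reduceEqDiff, e12] at g1
    simp only [reads, fr1.I 14 rfl, fr1.I 13 rfl, reduceIte, Nat.reduceEqDiff, hb, e13]
    refine (capP_spec 18 _).use ?_
    rintro τ2 c2 fr2 ⟨g2, hc2⟩
    simp only [reads, reduceIte, Nat.reduceEqDiff, fr1.I 12 rfl, e12] at g2
    have e14 : τ2.I 14 = b := by rw [fr2.I 14 rfl]; simp [reads, fr1.I 14 rfl, hb]
    have e17 : τ2.I 17 = min (b + h) M := by rw [fr2.I 17 rfl]; simp [reads, g1]
    have e13' : τ2.I 13 = h := by rw [fr2.I 13 rfl]; simp [reads, fr1.I 13 rfl, e13]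
    have esd : ∀ a, τ2.A a = τ.A a := fun a => by
      rw [fr2.A a rfl]; simp only [reads]; rw [fr1.A a rfl]; simp only [reads]
    refine (mergeP_spec hsd e14 e17 g2 (by omega) (by omega) ?_ ?_).use ?_
    · intro i j hi hij hj
      rw [esd, es]
      exact hf i j (by omega) hij (by omega) (by rw [hdiv1 i hi (by omega), hdiv1 j (by omega) (by omega)])
    · intro i j hi hij hj
      rw [esd, es]
      exact hf i j (by omega) hij (by omega) (by rw [hdiv2 i (by omega) (by omega), hdiv2 j (by omega) (by omega)])
    rintro τ3 c3 fr3 ⟨m1, m2, m3, hc3⟩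
    have e14' : τ3.I 14 = b := by rw [fr3.I 14 rfl, e14]
    have e13'' : τ3.I 13 = h := by rw [fr3.I 13 rfl, e13']
    simp only [reads, reduceIte, e14', e13'']
    rw [esd] at m2
    simp only [esd, es] at m3
    refine ⟨⟨⟨q + 1, by omega, by rw [hq]; ring⟩, ?_, ?_⟩, ?_⟩
    · intro i j hi hij hj hd
      rcases lt_or_ge j b with h3 | h3
      · rw [m2 i (by omega), m2 j h3]; exact i2 i j hi hij h3 hd
      · rcases lt_or_ge i b with h4 | h4
        · have := hdiv0 i h4
          rw [hd, hdiv j h3 (by omega)] at this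
          omega
        · exact m1 i j h4 hij hj
    · intro p
      rw [← cnt_add hb0 (by omega : b ≤ min (b + 2 * h) M), m3, cnt_congr fun i _ hi => m2 i hi, i3,
        cnt_add hb0 (by omega)]
    · rw [min_eq_left hlt.le]
      have h5 : (b : ℝ) + 1 ≤ (min (b + 2 * h) M : ℤ) := by
        exact_mod_cast (by omega : b + 1 ≤ min (b + 2 * h) M)
      have hc1' : (c1 : ℝ) ≤ 10 := by exact_mod_cast hc1
      have hc2' : (c2 : ℝ) ≤ 10 := by exact_mod_cast hc2
      push_cast at h5 hc3 ⊢
      linarith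
  · rintro τ c fr ⟨⟨q, hq0, hq⟩, i2, i3⟩ hlt hc
    have e12 : τ.I 12 = M := by rw [fr.I 12 rfl]; simpa [reads] using h12
    simp only [evals, e12, not_le, not_lt] at hlt
    rw [min_eq_right hlt] at i2 i3
    refine ⟨i2, i3, ?_⟩
    simp only [reads, reduceIte, costs, min_eq_right hlt, min_eq_left hM] at hc ⊢
    push_cast at hc ⊢; linarith

/-- Omit every other entry of array 9. -/
def thinP : Program :=
  I[12] ≔ iv 12 / ic 2 ;; I[14] ≔ ic 0 ;;
  .loop (ltI (iv 14) (iv 12)) (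
    A[9, iv 14] ≔ ra 9 (ic 2 * iv 14 + ic 1) ;; I[14] ≔ iv 14 + ic 1)

/-- Thinning in place is safe: entry `2i + 1` is read before any position beyond `i` is overwritten.
-/
theorem thinP_spec {σ : Store} {M : ℤ} (h12 : σ.I 12 = M) (hM : 0 ≤ M) :
    WP thinP (fun τ c => τ.I 12 = M / 2 ∧
      (∀ i, 0 ≤ i → i < M / 2 → τ.A 9 i = σ.A 9 (2 * i + 1)) ∧ (c : ℝ) ≤ 20 * (M / 2 : ℤ) + 20) σ := by
  unfold thinP
  simp only [wps, evals, costs, h12, Int.fdiv_eq_ediv_of_nonneg M (by norm_num : (0:ℤ) ≤ 2)]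
  have hM2 : 0 ≤ M / 2 := by omega
  refine WP_loop (fun τ => 0 ≤ τ.I 14 ∧ τ.I 14 ≤ M / 2 ∧
      (∀ i, 0 ≤ i → i < τ.I 14 → τ.A 9 i = σ.A 9 (2 * i + 1)) ∧
      (∀ i, τ.I 14 ≤ i → τ.A 9 i = σ.A 9 i))
    (fun τ => ((M / 2 : ℤ) - τ.I 14) * 20) ?_ ?_ ?_ ?_
  · simp only [reads, reduceIte]
    exact ⟨le_rfl, hM2, fun i _ _ => by omega, fun i _ => trivial⟩
  · rintro τ - ⟨-, h, -⟩
    have : (τ.I 14 : ℝ) ≤ (M / 2 : ℤ) := by exact_mod_cast h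
    linarith
  · rintro τ fr ⟨i1, i2, i3, i4⟩ hb
    have e12 : τ.I 12 = M / 2 := by rw [fr.I 12 rfl]; simp [reads]
    obtain ⟨t, ht⟩ : ∃ t, τ.I 14 = t := ⟨_, rfl⟩
    simp only [evals, e12, not_le, ht] at hb
    rw [ht] at i1 i2 i3 i4
    simp only [wps, evals, costs, reads, reduceIte, ht]
    refine ⟨⟨by omega, by omega, fun i hi hi' => ?_, fun i hi => ?_⟩, by push_cast; linarith⟩
    · by_cases h : i = t
      · subst h; rw [Function.update_self]; exact i4 _ (by omega)
      · rw [Function.update_of_ne h]; exact i3 i hi (by omega)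
    · rw [Function.update_of_ne (by omega)]; exact i4 i (by omega)
  · rintro τ c fr ⟨i1, i2, i3, i4⟩ hb hc
    have e12 : τ.I 12 = M / 2 := by rw [fr.I 12 rfl]; simp [reads]
    simp only [evals, e12, not_le, not_lt] at hb
    have e14 : τ.I 14 = M / 2 := le_antisymm i2 hb
    rw [e14] at i3
    refine ⟨e12, i3, ?_⟩
    simp only [reads, reduceIte, costs, e14] at hc ⊢
    push_cast at hc ⊢; linarith

/-- Copy the list in array 8 to array 9. -/
def copyP : Program :=
  I[12] ≔ iv 11 ;; I[14] ≔ ic 0 ;;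
  .loop (ltI (iv 14) (iv 12)) (A[9, iv 14] ≔ ra 8 (iv 14) ;; I[14] ≔ iv 14 + ic 1)

theorem copyP_spec {σ : Store} {M : ℤ} (h11 : σ.I 11 = M) (hM : 0 ≤ M) :
    WP copyP (fun τ c => τ.I 12 = M ∧ (∀ i, 0 ≤ i → i < M → τ.A 9 i = σ.A 8 i) ∧
      (c : ℝ) ≤ 20 * M + 20) σ := by
  unfold copyP
  simp only [wps, evals, costs, h11]
  refine WP_loop (fun τ => 0 ≤ τ.I 14 ∧ τ.I 14 ≤ M ∧
      (∀ i, 0 ≤ i → i < τ.I 14 → τ.A 9 i = σ.A 8 i))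
    (fun τ => (M - τ.I 14) * 20) ?_ ?_ ?_ ?_
  · simp only [reads, reduceIte]
    exact ⟨le_rfl, hM, fun i _ _ => by omega⟩
  · rintro τ - ⟨-, h, -⟩
    have : (τ.I 14 : ℝ) ≤ M := by exact_mod_cast h
    linarith
  · rintro τ fr ⟨i1, i2, i3⟩ hb
    have e12 : τ.I 12 = M := by rw [fr.I 12 rfl]; simp [reads]
    have e8 : τ.A 8 = σ.A 8 := by rw [fr.A 8 rfl]; simp [reads]
    obtain ⟨t, ht⟩ : ∃ t, τ.I 14 = t := ⟨_, rfl⟩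
    simp only [evals, e12, not_le, ht] at hb
    rw [ht] at i1 i2 i3
    simp only [wps, evals, costs, reads, reduceIte, ht, e8]
    refine ⟨⟨by omega, by omega, fun i hi hi' => ?_⟩, by push_cast; linarith⟩
    by_cases h : i = t
    · subst h; rw [Function.update_self]
    · rw [Function.update_of_ne h]; exact i3 i hi (by omega)
  · rintro τ c fr ⟨i1, i2, i3⟩ hb hc
    have e12 : τ.I 12 = M := by rw [fr.I 12 rfl]; simp [reads]
    simp only [evals, e12, not_le, not_lt] at hb
    have e14 : τ.I 14 = M := le_antisymm i2 hb
    rw [e14] at i3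
    refine ⟨e12, i3, ?_⟩
    simp only [reads, reduceIte, costs, e14] at hc ⊢
    push_cast at hc ⊢; linarith

/-- Write an approximate median of the list in array 8 into register 8. -/
def pivotP : Program :=
  copyP ;; I[13] ≔ ic 1 ;;
  .loop (ltI (iv 13) (iv 12)) (
    mergeBlocksP 9 10 ;; I[13] ≔ ic 2 * iv 13 ;; mergeBlocksP 10 9 ;; thinP) ;;
  R[8] ≔ ra 9 (iv 12 / ic 4)

/-- A quarter point of a sorted list with multiplicity `s` that represents a list of length `N`. -/
theorem quarter_bounds {f g : ℤ → ℝ} {s M N : ℤ} (hM : 1 ≤ M) (hs : 1 ≤ s) (hsM : M ≤ s)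
    (hs4 : s ≤ 4 * M) (hN : s * M ≤ N) (hN' : N < s * (M + 1)) (hg : SortedBlocks s M g)
    (hc : ∀ p, cnt p g 0 M ≤ cnt p f 0 N)
    (hl : ∀ p : ℝ → Prop, (∀ x y, x ≤ y → p y → p x) → s * cnt p g 0 M ≤ cnt p f 0 N ∧
      2 * (cnt p f 0 N : ℤ) ≤ 2 * s * cnt p g 0 M + (N - M) + 2 * s) :
    N ≤ 256 * (cnt (fun x => x ≤ g (M / 4)) f 0 N : ℤ) ∧
      N ≤ 256 * (cnt (fun x => g (M / 4) ≤ x) f 0 N : ℤ) ∧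
      ∃ i, 0 ≤ i ∧ i < N ∧ f i = g (M / 4) := by
  have hsort : ∀ i j, 0 ≤ i → i ≤ j → j < M → g i ≤ g j := fun i j hi hij hj =>
    hg i j hi hij hj (by
      rw [Int.ediv_eq_zero_of_lt hi (by omega), Int.ediv_eq_zero_of_lt (by omega) (by omega)])
  set v := g (M / 4) with hv
  have h1 := hl (fun x => x ≤ v) fun x y => le_trans
  have h2 := hl (fun x => x < v) fun x y => lt_of_le_of_lt
  have h3 : M / 4 + 1 ≤ (cnt (fun x => x ≤ v) g 0 M : ℤ) := by
    rw [← cnt_add (b := M / 4 + 1) (by omega) (by omega)]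
    have := cnt_of_forall (p := fun x => x ≤ v) (f := g) (show 0 ≤ M / 4 + 1 by omega) fun i hi hi' =>
      hsort i (M / 4) (by omega) (by omega) (by omega)
    push_cast; omega
  have h4 : (cnt (fun x => x < v) g 0 M : ℤ) ≤ M / 4 := by
    rw [← cnt_add (b := M / 4) (by omega) (by omega)]
    have h5 : cnt (fun x => x < v) g (M / 4) M = 0 := by
      by_contra h6
      obtain ⟨i, hi, hi', h7⟩ := exists_of_cnt_pos (Nat.one_le_iff_ne_zero.2 h6)
      exact absurd h7 (not_lt.2 (hsort (M / 4) i (by omega) hi hi'))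
    have := cnt_le (p := fun x => x < v) (f := g) (show 0 ≤ M / 4 by omega)
    push_cast; omega
  obtain ⟨i, hi, hi', h7⟩ := exists_of_cnt_pos
    ((cnt_pos (p := fun x => x = v) (f := g) (by omega) (by omega) rfl : 1 ≤ cnt _ g 0 M).trans
      (hc fun x => x = v))
  have h8 : 1 ≤ cnt (fun x => v ≤ x) f 0 N := cnt_pos hi hi' h7.ge
  have h9 : (cnt (fun x => x < v) f 0 N : ℤ) + cnt (fun x => v ≤ x) f 0 N = N := by
    have := cnt_add_cnt_not (p := fun x => x < v) (f := f) (a := 0) (b := N)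
    simp only [not_lt] at this
    have h10 := cnt_true (f := f) (show 0 ≤ N by omega)
    omega
  refine ⟨?_, ?_, i, hi, hi', h7⟩
  · have : s * (M + 1) ≤ s * (4 * (M / 4 + 1)) := mul_le_mul_of_nonneg_left (by omega) (by omega)
    have := mul_le_mul_of_nonneg_left h3 (show 0 ≤ s by omega)
    nlinarith [h1.1]
  -- Short lists need only one entry above the pivot, namely the pivot itself. For `N ≥ 256`, `s² ≤
  -- 4sM ≤ 4N` gives `8s ≤ N`, so the rounding error `2s` is at most a quarter of the list.
  · rcases lt_or_ge N 256 with h10 | h10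
    · omega
    · have h11 : 8 * s ≤ N := by
        by_contra h12
        have : s * s ≤ 4 * N := by nlinarith
        nlinarith
      have h12 := mul_le_mul_of_nonneg_left h4 (show 0 ≤ s by omega)
      have h13 : s * (4 * (M / 4)) ≤ s * M := mul_le_mul_of_nonneg_left (by omega) (by omega)
      have := h2.2
      nlinarith

/-- The list has `M` entries in sorted blocks of length `s`, each standing for `s` original ones. A
round merges twice, to blocks of length `4s`, and drops every other entry: `M` halves while `s`
doubles. Merging twice per thinning keeps the blocks so few that the total counting error stays
below `(N - M)/2 + s`. When `s ≥ M` there is a single sorted block and a quarter point can be read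
off. The lengths halve, so the total time is linear. -/
theorem pivotP_spec {σ : Store} {N : ℤ} (h11 : σ.I 11 = N) (hN : 1 ≤ N) :
    WP pivotP (fun τ c => N ≤ 256 * (cnt (fun x => x ≤ τ.R 8) (σ.A 8) 0 N : ℤ) ∧
      N ≤ 256 * (cnt (fun x => τ.R 8 ≤ x) (σ.A 8) 0 N : ℤ) ∧
      (∃ i, 0 ≤ i ∧ i < N ∧ σ.A 8 i = τ.R 8) ∧ (c : ℝ) ≤ 1000 * N) σ := by
  have hN' : (1:ℝ) ≤ N := by exact_mod_cast hN
  set f := σ.A 8 with hf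
  unfold pivotP
  rw [WP_seq]
  refine (copyP_spec h11 (by omega)).use ?_
  rintro τ0 c0 fr0 ⟨e12, e9, hc0⟩
  simp only [wps, evals, costs]
  refine WP_loop (fun τ => 1 ≤ τ.I 12 ∧ 1 ≤ τ.I 13 ∧ τ.I 13 ≤ 4 * τ.I 12 ∧ τ.I 13 * τ.I 12 ≤ N ∧
      N < τ.I 13 * (τ.I 12 + 1) ∧ SortedBlocks (τ.I 13) (τ.I 12) (τ.A 9) ∧
      (∀ p, cnt p (τ.A 9) 0 (τ.I 12) ≤ cnt p f 0 N) ∧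
      (∀ p : ℝ → Prop, (∀ x y, x ≤ y → p y → p x) →
        τ.I 13 * cnt p (τ.A 9) 0 (τ.I 12) ≤ cnt p f 0 N ∧
        2 * (cnt p f 0 N : ℤ) ≤ 2 * τ.I 13 * cnt p (τ.A 9) 0 (τ.I 12) + (N - τ.I 12) + 2 * τ.I 13))
    (fun τ => τ.I 12 * 800) ?_ ?_ ?_ ?_
  · simp only [reads, reduceIte, Nat.reduceEqDiff, e12]
    have hcnt : ∀ p, cnt p (τ0.A 9) 0 N = cnt p f 0 N := fun p => cnt_congr e9
    refine ⟨hN, le_rfl, by omega, by omega, by omega, ?_, fun p => (hcnt p).le, fun p _ => ?_⟩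
    · intro i j _ hij _ hd
      obtain rfl : i = j := by simpa using hd
      exact le_rfl
    · rw [hcnt]; omega
  · rintro τ - ⟨h, -⟩
    have : (1:ℝ) ≤ τ.I 12 := by exact_mod_cast h
    linarith
  · rintro τ fr ⟨i1, i2, i3, i4, i5, i6, i7, i8⟩ hlt
    obtain ⟨M, hM⟩ : ∃ M, τ.I 12 = M := ⟨_, rfl⟩
    obtain ⟨s, hs⟩ : ∃ s, τ.I 13 = s := ⟨_, rfl⟩
    simp only [evals, hM, hs, not_le] at hlt
    rw [hM] at i1 i3 i4 i5 i6 i7 i8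
    rw [hs] at i2 i3 i4 i5 i6 i8
    rw [WP_seq]
    refine (mergeBlocksP_spec (by norm_num) hM hs (by omega) (by omega) i6).use ?_
    rintro τ1 c1 fr1 ⟨s1, k1, hc1⟩
    have e12' : τ1.I 12 = M := by rw [fr1.I 12 rfl, hM]
    have e13' : τ1.I 13 = s := by rw [fr1.I 13 rfl, hs]
    simp only [wps, evals, costs, e13']
    refine (mergeBlocksP_spec (M := M) (h := 2 * s) (by norm_num) (by simpa [reads] using e12')
      (by simp [reads]) (by omega) (by omega) (by simpa [reads] using s1)).use ?_
    rintro τ2 c2 fr2 ⟨s2, k2, hc2⟩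
    simp only [reads] at k2
    have e12'' : τ2.I 12 = M := by rw [fr2.I 12 rfl]; simpa [reads] using e12'
    have e13'' : τ2.I 13 = 2 * s := by rw [fr2.I 13 rfl]; simp [reads]
    refine (thinP_spec e12'' (by omega)).use ?_
    rintro τ3 c3 fr3 ⟨t1, t2, hc3⟩
    have e13t : τ3.I 13 = 2 * s := by rw [fr3.I 13 rfl, e13'']
    rw [t1, e13t]
    have hthin : ∀ p, cnt p (τ3.A 9) 0 (M / 2) = cnt p (fun i => τ2.A 9 (2 * i + 1)) 0 (M / 2) :=
      fun p => cnt_congr t2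
    have h2M : 2 * (M / 2) ≤ M := by omega
    have h2M' : M ≤ 2 * (M / 2) + 1 := by omega
    refine ⟨⟨by omega, by omega, by omega, ?_, ?_, ?_, fun p => ?_, fun p hp => ?_⟩, ?_⟩
    · have := mul_le_mul_of_nonneg_left h2M (show 0 ≤ s by omega)
      linarith
    · have := mul_le_mul_of_nonneg_left h2M' (show 0 ≤ s by omega)
      linarith
    · intro i j hi hij hj hd
      rw [t2 i hi (by omega), t2 j (by omega) hj]
      exact s2.thin i j hi hij hj hd
    · rw [hthin]
      exact cnt_thin_le.trans (by rw [k2, k1]; exact i7 p)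
    · obtain ⟨a1, a2⟩ := i8 p hp
      obtain ⟨b1, b2⟩ := s2.cnt_thin (p := p) (by omega) (by omega) hp
      rw [← hthin, k2, k1] at b1 b2
      have h3 : 2 * (2 * s) * (M / (2 * (2 * s))) ≤ M := Int.mul_ediv_self_le (by omega)
      have b1' : 2 * (cnt p (τ3.A 9) 0 (M / 2) : ℤ) ≤ cnt p (τ.A 9) 0 M := by exact_mod_cast b1
      have b3 := mul_le_mul_of_nonneg_left b1' (show 0 ≤ s by omega)
      have b4 := mul_le_mul_of_nonneg_left b2 (show 0 ≤ s by omega)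
      constructor
      · linarith
      -- The error of one unit per complete block is charged to the decrease of `M`; the remaining
      -- unit is absorbed by the doubling of `2 * s`.
      · have : 2 * (s * (M / (2 * (2 * s)))) ≤ M - M / 2 := by
          have : 4 * (s * (M / (2 * (2 * s)))) ≤ M := by linarith
          omega
        linarith
    · have h2 : (2:ℝ) ≤ M := by exact_mod_cast (by omega : 2 ≤ M)
      have h3 : 2 * ((M / 2 : ℤ) : ℝ) ≤ M := by exact_mod_cast h2M
      rw [hM]
      push_cast at *
      linarith
  · rintro τ c fr ⟨i1, i2, i3, i4, i5, i6, i7, i8⟩ hlt hc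
    simp only [evals, not_le, not_lt] at hlt
    simp only [reads, reduceIte, Int.fdiv_eq_ediv_of_nonneg _ (by norm_num : (0:ℤ) ≤ 4)]
    obtain ⟨q1, q2, q3⟩ := quarter_bounds i1 i2 hlt i3 i4 i5 i6 i7 i8
    refine ⟨q1, q2, q3, ?_⟩
    have h1 : (1:ℝ) ≤ τ.I 12 := by exact_mod_cast i1
    simp only [reads, reduceIte, Nat.reduceEqDiff, e12, costs] at hc
    push_cast at hc ⊢
    linarith

end RealRAM
end

noncomputable section

/-! ## Counting candidate radii -/

theorem Int.sum_Ico_succ {β : Type*} [AddCommMonoid β] {a b : ℤ} (h : a ≤ b) (f : ℤ → β) :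
    ∑ i ∈ Finset.Ico a (b + 1), f i = ∑ i ∈ Finset.Ico a b, f i + f b := by
  have : Finset.Ico a (b + 1) = insert b (Finset.Ico a b) := by ext; simp; omega
  rw [this, Finset.sum_insert (by simp), add_comm]

theorem Int.sum_Ico_eq_add {β : Type*} [AddCommMonoid β] {a b : ℤ} (h : a < b) (f : ℤ → β) :
    ∑ i ∈ Finset.Ico a b, f i = f a + ∑ i ∈ Finset.Ico (a + 1) b, f i := by
  have : Finset.Ico a b = insert a (Finset.Ico (a + 1) b) := by ext; simp; omega
  rw [this, Finset.sum_insert (by simp)]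

/-- The radii `v t` are at least `hi` (or zero) for `t ≤ y` and are smaller than `hi` and
decreasing afterwards. -/
structure Threshold (v : ℤ → ℝ) (y hi : ℝ) : Prop where
  before : ∀ t : ℤ, 0 ≤ t → (t : ℝ) ≤ y → v t = 0 ∨ hi ≤ v t
  lt : ∀ t : ℤ, 0 ≤ t → y < t → v t < hi
  anti : ∀ t t' : ℤ, 0 ≤ t → t ≤ t' → y < t → v t' ≤ v t

/-- At the radius `hi` the left-hand side is affine in `t` and passes `ω` at the stated threshold.
Up to it, there is no root strictly between 0 and `hi`; beyond it, the radius is below `hi` and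
decreases with `t`. -/
theorem RealRAM.threshold_candidateRoot {ω d₁ d₂ r α hi : ℝ} (h₁ : 0 < d₁) (h₂ : 0 < d₂)
    (hr : 0 < r) (hα : 0 < α) (hhi : 0 < hi) (hhi' : hi ≤ 2 * α * r) :
    Threshold (fun t => candidateRoot ω d₁ d₂ r α t)
      ((ω - halfArc d₁ r hi - halfArc d₂ r hi) / stepAngle r α hi) hi := by
  have hs := stepAngle_pos hr hα hhi
  refine ⟨fun t ht hy => ?_, fun t ht hy => ?_, fun t t' ht htt hy => ?_⟩
  · rw [le_div_iff₀ hs] at hy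
    exact candidateRoot_not_mem h₁ h₂ hr hα ht hhi.le hhi' (by unfold rootFn; linarith)
  · rw [div_lt_iff₀ hs] at hy
    exact candidateRoot_lt h₁ h₂ hr hα ht hhi hhi' (by unfold rootFn; linarith)
  · rw [div_lt_iff₀ hs] at hy
    exact candidateRoot_anti h₁ h₂ hr hα ht htt hhi hhi' (by unfold rootFn; linarith)

/-- `t` is a multiple of `q`, `v t` is between `lo` and `hi`, and `p (v t)`. -/
def IsMult (p : ℝ → Prop) (v : ℤ → ℝ) (q : ℤ) (lo hi : ℝ) (t : ℤ) : Prop :=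
  q ∣ t ∧ lo < v t ∧ v t < hi ∧ p (v t)

/-- `t` is a multiple of `q` above `y`, `v t` is above `lo`, and `p (v t)`. -/
def IsMultAbove (p : ℝ → Prop) (v : ℤ → ℝ) (q : ℤ) (lo y : ℝ) (t : ℤ) : Prop :=
  q ∣ t ∧ y < t ∧ lo < v t ∧ p (v t)

open Classical in
/-- The number of multiples `t` of `q` in `[0, k)` with `v t` between `lo` and `hi` and `p (v t)`. -/
def multCount (p : ℝ → Prop) (v : ℤ → ℝ) (k q : ℤ) (lo hi : ℝ) : ℕ :=
  ((Finset.Ico 0 k).filter (IsMult p v q lo hi)).card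

-- The upper bound on a radius becomes a lower bound on `t`: up to the threshold the radii are zero
-- or at least `hi`, and both are excluded by `0 ≤ lo` and the bracket.
open Classical in
theorem multCount_eq {p : ℝ → Prop} {v : ℤ → ℝ} {k q : ℤ} {lo hi y : ℝ} (T : Threshold v y hi)
    (hlo : 0 ≤ lo) :
    multCount p v k q lo hi = ((Finset.Ico 0 k).filter (IsMultAbove p v q lo y)).card := by
  unfold multCount
  congr 1
  refine Finset.filter_congr fun t ht => ?_
  rw [Finset.mem_Ico] at ht
  constructor
  · rintro ⟨h1, h2, h3, h4⟩
    refine ⟨h1, ?_, h2, h4⟩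
    by_contra h5
    rcases T.before t ht.1 (not_lt.1 h5) with h6 | h6 <;> linarith
  · rintro ⟨h1, h2, h3, h4⟩
    exact ⟨h1, h3, T.lt t ht.1 h2, h4⟩

/-- By monotonicity, the counted `t` are consecutive multiples of `q`. Each one that is not a
multiple of `2q`, except the largest such, is followed by a counted multiple of `2q`, and `t ↦ t +
q` is injective. -/
theorem multCount_le_two_mul {v : ℤ → ℝ} {k q : ℤ} {lo hi y : ℝ} (T : Threshold v y hi)
    (hlo : 0 ≤ lo) (hq : 0 < q) : multCount (fun _ => True) v k q lo hi ≤
      2 * multCount (fun _ => True) v k (2 * q) lo hi + 1 := by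
  classical
  rw [multCount_eq T hlo, multCount_eq T hlo]
  set G := (Finset.Ico 0 k).filter (IsMultAbove (fun _ => True) v q lo y) with hG
  set E := (Finset.Ico 0 k).filter (IsMultAbove (fun _ => True) v (2 * q) lo y) with hE
  rw [← Finset.card_filter_add_card_filter_not (s := G) fun t => 2 * q ∣ t]
  have h1 : (G.filter fun t => 2 * q ∣ t).card ≤ E.card := by
    refine Finset.card_le_card fun t ht => ?_
    simp only [hG, hE, Finset.mem_filter, IsMultAbove] at ht ⊢
    exact ⟨ht.1.1, ht.2, ht.1.2.2⟩
  suffices h2 : (G.filter fun t => ¬ 2 * q ∣ t).card ≤ E.card + 1 by omega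
  rcases (G.filter fun t => ¬ 2 * q ∣ t).eq_empty_or_nonempty with h3 | h3
  · rw [h3]; simp
  obtain ⟨x, hx, hmax⟩ := Finset.exists_max_image _ (fun t : ℤ => t) h3
  rw [← Finset.card_erase_add_one hx]
  refine Nat.add_le_add_right ?_ 1
  refine Finset.card_le_card_of_injOn (fun t => t + q) (fun t ht => ?_)
    fun i _ j _ hij => by simpa using hij
  simp only [hG, hE, Finset.coe_erase, Finset.coe_filter, Finset.mem_filter, Finset.mem_Ico,
    Set.mem_sdiff, Set.mem_ofPred_eq, Set.mem_singleton_iff, IsMultAbove] at ht hx hmax ⊢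
  obtain ⟨⟨⟨⟨h4, h5⟩, ⟨a, rfl⟩, h6, h7, -⟩, h8⟩, h9⟩ := ht
  obtain ⟨⟨⟨h10, h11⟩, ⟨b, rfl⟩, h12, h13, -⟩, h14⟩ := hx
  have h15 := hmax (q * a) ⟨⟨⟨h4, h5⟩, ⟨a, rfl⟩, h6, h7, trivial⟩, h8⟩
  have hab : a < b := by
    have := lt_of_le_of_ne h15 h9
    exact lt_of_mul_lt_mul_left this hq.le
  have h16 : q * a + q ≤ q * b := by nlinarith
  have ha : ¬ 2 ∣ a := fun ⟨z, hz⟩ => h8 ⟨z, by rw [hz]; ring⟩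
  have h17 : y < ((q * a + q : ℤ) : ℝ) := h6.trans (by exact_mod_cast (by omega))
  refine ⟨⟨by omega, by omega⟩, ?_, h17, h13.trans_le (T.anti _ _ (by omega) h16 h17), trivial⟩
  exact ⟨(a + 1) / 2, by rw [mul_assoc, mul_comm 2, mul_assoc, show (a + 1) / 2 * 2 = a + 1 by omega]; ring⟩

/-- Only `t = 0` is a multiple of `q` in `[0, k)`. This starts the descent of `q`. -/
theorem multCount_le_one {p : ℝ → Prop} {v : ℤ → ℝ} {k q : ℤ} {lo hi : ℝ} (hkq : k ≤ q) :
    multCount p v k q lo hi ≤ 1 := by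
  classical
  unfold multCount
  rw [Finset.card_le_one]
  intro a ha b hb
  simp only [Finset.mem_filter, Finset.mem_Ico, IsMult] at ha hb
  rw [Int.eq_zero_of_dvd_of_nonneg_of_lt ha.1.1 (by omega) ha.2.1,
    Int.eq_zero_of_dvd_of_nonneg_of_lt hb.1.1 (by omega) hb.2.1]

namespace RealRAM
open Syn

/-- The number of candidate radii between `lo` and `hi` for step numbers divisible by `q` that
satisfy `p`. -/
def candCount (n k : ℕ) (α r : ℝ) (φ D : ℤ → ℝ) (q : ℤ) (lo hi : ℝ) (p : ℝ → Prop) : ℕ :=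
  ∑ i ∈ Finset.Ico (0:ℤ) n, ∑ j ∈ Finset.Ico (0:ℤ) (3 * n),
    multCount p (fun t => candidateRoot (φ j - φ i) (D i) (D j) r α t) k q lo hi

section
variable {n k w : ℕ} {α r : ℝ} {φ D : ℤ → ℝ} {σ : Store} {q : ℤ} {lo hi : ℝ} {p : ℝ → Prop}

theorem candCount_le_two_mul (H : Demands n φ D) (hr : 0 < r) (hα : 0 < α) (hq : 0 < q)
    (hlo : 0 ≤ lo) (hhi : 0 < hi) (hhi' : hi ≤ 2 * α * r) :
    candCount n k α r φ D q lo hi (fun _ => True) ≤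
      2 * candCount n k α r φ D (2 * q) lo hi (fun _ => True) + 3 * n ^ 2 := by
  unfold candCount
  have : 3 * n ^ 2 = ∑ i ∈ Finset.Ico (0:ℤ) n, ∑ j ∈ Finset.Ico (0:ℤ) (3 * n), 1 := by
    simp
    rw [show (3 * (n:ℤ)).toNat = 3 * n by omega]; ring
  rw [this, Finset.mul_sum, ← Finset.sum_add_distrib]
  refine Finset.sum_le_sum fun i _ => ?_
  rw [Finset.mul_sum, ← Finset.sum_add_distrib]
  exact Finset.sum_le_sum fun j _ => multCount_le_two_mul
    (threshold_candidateRoot (H.dist_pos i) (H.dist_pos j) hr hα hhi hhi') hlo hq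

theorem candCount_le_of_le (hkq : k ≤ q) : candCount n k α r φ D q lo hi p ≤ 3 * n ^ 2 := by
  unfold candCount
  have : 3 * n ^ 2 = ∑ i ∈ Finset.Ico (0:ℤ) n, ∑ j ∈ Finset.Ico (0:ℤ) (3 * n), 1 := by
    simp
    rw [show (3 * (n:ℤ)).toNat = 3 * n by omega]; ring
  rw [this]
  exact Finset.sum_le_sum fun i _ => Finset.sum_le_sum fun j _ => multCount_le_one hkq

theorem candCount_restrict {lo' hi' : ℝ} (h1 : lo ≤ lo') (h2 : hi' ≤ hi) :
    candCount n k α r φ D q lo hi (fun x => lo' < x ∧ x < hi' ∧ p x) =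
      candCount n k α r φ D q lo' hi' p := by
  classical
  unfold candCount multCount
  refine Finset.sum_congr rfl fun i _ => Finset.sum_congr rfl fun j _ => ?_
  congr 1
  refine Finset.filter_congr fun t _ => ?_
  constructor
  · rintro ⟨h3, -, -, h4⟩; exact ⟨h3, h4⟩
  · rintro ⟨h3, h4, h5, h6⟩
    exact ⟨h3, h1.trans_lt h4, h5.trans_le h2, h4, h5, h6⟩

theorem candCount_outside (h : ∀ x, lo < x → x < hi → ¬ p x) :
    candCount n k α r φ D q lo hi p = 0 := by
  classical
  unfold candCount multCount
  refine Finset.sum_eq_zero fun i _ => Finset.sum_eq_zero fun j _ => ?_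
  rw [Finset.card_eq_zero, Finset.filter_eq_empty_iff]
  rintro t - ⟨-, h1, h2, h3⟩
  exact h _ h1 h2 h3

theorem not_candidate_of_candCount (h : candCount n k α r φ D 1 lo hi (fun _ => True) = 0)
    (i j : ℤ) (t : ℕ) (hi0 : 0 ≤ i) (hin : i < n) (hj0 : 0 ≤ j) (hjn : j < 3 * n) (htk : t < k) :
    ¬ (lo < candidateRoot (φ j - φ i) (D i) (D j) r α t ∧
        candidateRoot (φ j - φ i) (D i) (D j) r α t < hi) := by
  classical
  rintro ⟨h1, h2⟩
  unfold candCount multCount at h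
  rw [Finset.sum_eq_zero_iff] at h
  have h3 := h i (Finset.mem_Ico.2 ⟨hi0, hin⟩)
  rw [Finset.sum_eq_zero_iff] at h3
  have h4 := h3 j (Finset.mem_Ico.2 ⟨hj0, hjn⟩)
  rw [Finset.card_eq_zero, Finset.filter_eq_empty_iff] at h4
  exact h4 (x := (t:ℤ)) (Finset.mem_Ico.2 ⟨by omega, by omega⟩) ⟨one_dvd _, h1, h2, trivial⟩

/-! ## Listing candidate radii -/

/-- The candidate radius for the demand points in registers 2 and 3 and the number of steps in
register 8. -/
abbrev candE : Expr .real :=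
  .root (ra 2 (iv 3) - ra 2 (iv 2)) (ra 3 (iv 2)) (ra 3 (iv 3)) (rv 1) (rv 0) (iv 8)

/-- Append the candidates for the demand points in registers 2 and 3 to the list in array 8. -/
def pairP : Program :=
  R[13] ≔ (ra 2 (iv 3) - ra 2 (iv 2) - halfArcE (iv 2) 7 - halfArcE (iv 3) 7) / stepE 7 ;;
  I[8] ≔ iv 20 * (.floor (rv 13 / .toReal (iv 20)) + ic 1) ;;
  .ite (ltI (iv 8) (ic 0)) (I[8] ≔ ic 0) .skip ;;
  R[13] ≔ candE ;;
  .loop (.and (ltI (iv 8) (iv 1)) (ltR (rv 6) (rv 13))) (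
    A[8, iv 11] ≔ rv 13 ;; I[11] ≔ iv 11 + ic 1 ;; I[8] ≔ iv 8 + iv 20 ;; R[13] ≔ candE)

theorem first_multiple {q : ℤ} (hq : 0 < q) (y : ℝ) {T : ℤ} (hT : T = q * (⌊y / q⌋ + 1)) :
    q ∣ T ∧ y < T ∧ ∀ t : ℤ, q ∣ t → y < t → T ≤ t := by
  have hq' : (0:ℝ) < q := by exact_mod_cast hq
  refine ⟨⟨_, hT⟩, ?_, ?_⟩
  · have := Int.lt_floor_add_one (y / q)
    rw [div_lt_iff₀ hq'] at this
    rw [hT]; push_cast; linarith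
  · rintro t ⟨a, rfl⟩ hy
    push_cast at hy
    have : ⌊y / q⌋ < a := by
      rw [Int.floor_lt, div_lt_iff₀ hq']; linarith
    rw [hT]
    exact mul_le_mul_of_nonneg_left (by omega) hq.le

/-- From the first multiple above the threshold the radii are below `hi` and decreasing, so the scan
may stop at the first one not above `lo`. The time is proportional to one plus the number of entries
listed. -/
theorem pairP_spec (H : Demands n φ D) (hr : 0 < r) (hα : 0 < α) (S : Ready n k w α r φ D σ)
    (hq : σ.I 20 = q) (hq0 : 0 < q) (hlo : σ.R 6 = lo) (hhi : σ.R 7 = hi) (hlo0 : 0 ≤ lo)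
    (hhi0 : 0 < hi) (hhi' : hi ≤ 2 * α * r) {i j N : ℤ} (hi2 : σ.I 2 = i) (hj3 : σ.I 3 = j)
    (hi0 : 0 ≤ i) (hin : i < 4 * n) (hj0 : 0 ≤ j) (hjn : j < 4 * n) (hN : σ.I 11 = N) :
    WP pairP (fun τ m => N ≤ τ.I 11 ∧ (∀ u, u < N → τ.A 8 u = σ.A 8 u) ∧
      (∀ p, cnt p (τ.A 8) N (τ.I 11) =
        multCount p (fun t => candidateRoot (φ j - φ i) (D i) (D j) r α t) k q lo hi) ∧
      (m : ℝ) ≤ 150 + 60 * multCount (fun _ => True)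
        (fun t => candidateRoot (φ j - φ i) (D i) (D j) r α t) k q lo hi) σ := by
  classical
  set v : ℤ → ℝ := fun t => candidateRoot (φ j - φ i) (D i) (D j) r α t with hv
  set y := (φ j - φ i - halfArc (D i) r hi - halfArc (D j) r hi) / stepAngle r α hi with hy
  have T : Threshold v y hi :=
    threshold_candidateRoot (H.dist_pos i) (H.dist_pos j) hr hα hhi0 hhi'
  have eφi := S.hφ i hi0 hin
  have eφj := S.hφ j hj0 hjn
  have eDi := S.hD i hi0 hin
  have eDj := S.hD j hj0 hjn
  have ey : (φ j - φ i - arccos ((D i * D i + r * r - hi * hi) / (2 * D i * r)) -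
      arccos ((D j * D j + r * r - hi * hi) / (2 * D j * r))) / (2 * arcsin (hi / (2 * α * r))) = y := by
    rw [hy]; unfold halfArc stepAngle
    simp only [pow_two]
  let Inv : Store → Prop := fun τ => N ≤ τ.I 11 ∧ (∀ u, u < N → τ.A 8 u = σ.A 8 u) ∧
    0 ≤ τ.I 8 ∧ q ∣ τ.I 8 ∧ y < τ.I 8 ∧ τ.R 13 = v (τ.I 8) ∧
    (∀ p, cnt p (τ.A 8) N (τ.I 11) = ((Finset.Ico 0 (k:ℤ)).filter fun t =>
      IsMultAbove p v q lo y t ∧ t < τ.I 8).card)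
  -- Shared by the two ways of entering the loop; `c` is the time spent before it.
  have hloop : ∀ (ρ : Store) (c : ℕ), (ρ.I 1 = k ∧ ρ.I 20 = q ∧ ρ.I 2 = i ∧ ρ.I 3 = j ∧ ρ.R 6 = lo ∧ ρ.R 0 = α ∧ ρ.R 1 = r ∧
      ρ.A 2 = σ.A 2 ∧ ρ.A 3 = σ.A 3) → Inv ρ → ρ.I 11 = N → c ≤ 120 →
      WP (.loop (.and (ltI (iv 8) (iv 1)) (ltR (rv 6) (rv 13))) (
          A[8, iv 11] ≔ rv 13 ;; I[11] ≔ iv 11 + ic 1 ;; I[8] ≔ iv 8 + iv 20 ;; R[13] ≔ candE))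
        (fun τ m => N ≤ τ.I 11 ∧ (∀ u, u < N → τ.A 8 u = σ.A 8 u) ∧
          (∀ p, cnt p (τ.A 8) N (τ.I 11) = multCount p v k q lo hi) ∧
          ((c + m : ℕ) : ℝ) ≤ 150 + 60 * multCount (fun _ => True) v k q lo hi) ρ := by
    rintro ρ c ⟨w1, w20, w2, w3, w6, w0, w7, wa2, wa3⟩ hρ hρN hc
    have hsub : ∀ (p : ℝ → Prop) (b : ℤ), ((Finset.Ico 0 (k:ℤ)).filter fun t =>
        IsMultAbove p v q lo y t ∧ t < b).card ≤ multCount p v k q lo hi := by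
      intro p b
      rw [multCount_eq T hlo0]
      exact Finset.card_le_card (Finset.monotone_filter_right _ fun t _ h => h.1)
    refine WP_loop Inv (fun τ => (multCount (fun _ => True) v k q lo hi - (τ.I 11 - N)) * 60)
      hρ ?_ ?_ ?_
    · rintro τ - ⟨i1, -, -, -, -, -, i7⟩
      have h1 := hsub (fun _ => True) (τ.I 8)
      rw [← i7] at h1
      have h2 := cnt_true (f := τ.A 8) i1
      have : ((τ.I 11 : ℝ) - N) ≤ multCount (fun _ => True) v k q lo hi := by
        have : τ.I 11 - N ≤ multCount (fun _ => True) v k q lo hi := by omega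
        exact_mod_cast this
      linarith
    · rintro τ fr ⟨i1, i2, i3, i4, i5, i6, i7⟩ hb
      have e1 : τ.I 1 = k := by rw [fr.I 1 rfl, w1]
      have e20 : τ.I 20 = q := by rw [fr.I 20 rfl, w20]
      have e2 : τ.I 2 = i := by rw [fr.I 2 rfl, w2]
      have e3 : τ.I 3 = j := by rw [fr.I 3 rfl, w3]
      have er6 : τ.R 6 = lo := by rw [fr.R 6 rfl, w6]
      have er0 : τ.R 0 = α := by rw [fr.R 0 rfl, w0]
      have er1 : τ.R 1 = r := by rw [fr.R 1 rfl, w7]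
      have ea2 : τ.A 2 = σ.A 2 := by rw [fr.A 2 rfl, wa2]
      have ea3 : τ.A 3 = σ.A 3 := by rw [fr.A 3 rfl, wa3]
      obtain ⟨t, ht⟩ : ∃ t, τ.I 8 = t := ⟨_, rfl⟩
      obtain ⟨M, hM⟩ : ∃ M, τ.I 11 = M := ⟨_, rfl⟩
      rw [ht] at i3 i4 i5 i6 i7
      rw [hM] at i1 i7
      simp only [evals, e1, er6, ht, i6, not_le] at hb
      simp only [wps, evals, costs, reads, reduceIte, Nat.reduceEqDiff, Nat.reduceAdd, ht, hM, e20,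
        e2, e3, er0, er1, ea2, ea3, eφi, eφj, eDi, eDj, i6, Inv]
      refine ⟨⟨by omega, fun u hu => ?_, by omega, dvd_add i4 (dvd_refl q), ?_, rfl, fun p => ?_⟩,
        by push_cast; linarith⟩
      · rw [Function.update_of_ne (by omega)]; exact i2 u hu
      · have : (0:ℝ) < q := by exact_mod_cast hq0
        push_cast; linarith
      · rw [cnt_succ i1, Function.update_self,
          cnt_congr fun u _ hu => Function.update_of_ne (by omega) _ _, i7 p]
        have hnext : ∀ z : ℤ, q ∣ z → (z < t + q ↔ z < t ∨ z = t) := by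
          rintro z ⟨a, rfl⟩
          obtain ⟨b, rfl⟩ := i4
          constructor
          · intro h
            have : a < b + 1 := by
              have : q * a < q * (b + 1) := by linarith
              exact lt_of_mul_lt_mul_left this hq0.le
            rcases (show a < b ∨ a = b by omega) with h1 | h1
            · left; exact mul_lt_mul_of_pos_left h1 hq0
            · right; rw [h1]
          · rintro (h | h) <;> omega
        have hset : ((Finset.Ico 0 (k:ℤ)).filter fun z =>
            IsMultAbove p v q lo y z ∧ z < t + q) =
            ((Finset.Ico 0 (k:ℤ)).filter fun z =>
            IsMultAbove p v q lo y z ∧ z < t) ∪ (if p (v t) then {t} else ∅) := by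
          ext z
          simp only [Finset.mem_filter, Finset.mem_Ico, Finset.mem_union]
          constructor
          · rintro ⟨h1, h2, h3⟩
            rcases (hnext z h2.1).1 h3 with h4 | h4
            · exact Or.inl ⟨h1, h2, h4⟩
            · right; subst h4; rw [if_pos h2.2.2.2]; simp
          · rintro (⟨h1, h2, h3⟩ | h1)
            · exact ⟨h1, h2, (hnext z h2.1).2 (Or.inl h3)⟩
            · split_ifs at h1 with h2
              · rw [Finset.mem_singleton] at h1
                subst h1
                exact ⟨⟨i3, hb.1⟩, ⟨i4, i5, hb.2, h2⟩, by omega⟩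
              · simp at h1
        rw [hset, Finset.card_union_of_disjoint]
        · congr 1
          split_ifs <;> simp
        · split_ifs
          · simp
          · simp
    · rintro τ m fr ⟨i1, i2, i3, i4, i5, i6, i7⟩ hb hcost
      have e1 : τ.I 1 = k := by rw [fr.I 1 rfl, w1]
      have er6 : τ.R 6 = lo := by rw [fr.R 6 rfl, w6]
      simp only [evals, e1, er6, i6, not_le] at hb
      have hall : ∀ p, cnt p (τ.A 8) N (τ.I 11) = multCount p v k q lo hi := by
        intro p
        rw [i7 p, multCount_eq T hlo0]
        congr 1
        refine Finset.filter_congr fun t ht => ?_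
        rw [Finset.mem_Ico] at ht
        refine ⟨fun h => h.1, fun h => ⟨h, ?_⟩⟩
        by_contra h1
        rw [not_lt] at h1
        exact hb ⟨by omega, h.2.2.1.trans_le (T.anti _ _ i3 h1 i5)⟩
      refine ⟨i1, i2, hall, ?_⟩
      have h1 := hsub (fun _ => True) (τ.I 8)
      rw [← i7] at h1
      have h2 := cnt_true (f := τ.A 8) i1
      have : ((τ.I 11 : ℝ) - N) ≤ multCount (fun _ => True) v k q lo hi := by
        have : τ.I 11 - N ≤ multCount (fun _ => True) v k q lo hi := by omega
        exact_mod_cast this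
      have hc' : (c:ℝ) ≤ 120 := by exact_mod_cast hc
      simp only [costs, hρN] at hcost
      push_cast at hcost ⊢
      linarith
  have hfirst : ∀ t0 : ℤ, 0 ≤ t0 → q ∣ t0 → y < t0 → (∀ t : ℤ, 0 ≤ t → q ∣ t → y < t → t0 ≤ t) →
      ∀ p, cnt p (σ.A 8) N N = ((Finset.Ico 0 (k:ℤ)).filter fun t =>
        IsMultAbove p v q lo y t ∧ t < t0).card := by
    intro t0 h1 h2 h3 h4 p
    rw [cnt_self, eq_comm, Finset.card_eq_zero, Finset.filter_eq_empty_iff]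
    rintro t ht ⟨h5, h6⟩
    rw [Finset.mem_Ico] at ht
    exact absurd (h4 t ht.1 h5.1 h5.2.1) (by omega)
  obtain ⟨T0, hT0⟩ : ∃ T0, q * (⌊y / q⌋ + 1) = T0 := ⟨_, rfl⟩
  obtain ⟨k1, k2, k3⟩ := first_multiple hq0 y hT0.symm
  unfold pairP
  simp only [wps, evals, costs, reads, reduceIte, Nat.reduceEqDiff, Nat.reduceAdd, hq, hlo, hhi,
    hi2, hj3, S.hα, S.hr, eφi, eφj, eDi, eDj, Rat.cast_ofNat, ey, hT0, not_le, not_lt]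
  -- A negative first multiple is replaced by 0, which is also a multiple of `q` above the
  -- threshold.
  refine ⟨fun hneg => ?_, fun hpos => ?_⟩
  · simp only [← add_assoc, Nat.reduceAdd]
    have hy0 : y < ((0:ℤ) : ℝ) := k2.trans (by exact_mod_cast hneg)
    refine hloop _ 92 (by simp [reads, S.hk, hq, hi2, hj3, hlo, S.hα, S.hr]) ?_
      (by simp [reads, hN]) (by norm_num)
    simp only [Inv, reads, reduceIte, Nat.reduceEqDiff, hN]
    exact ⟨le_rfl, fun u _ => trivial, le_rfl, dvd_zero q, hy0, rfl,
      hfirst 0 le_rfl (dvd_zero q) hy0 fun t ht _ _ => ht⟩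
  · simp only [← add_assoc, Nat.reduceAdd]
    refine hloop _ 91 (by simp [reads, S.hk, hq, hi2, hj3, hlo, S.hα, S.hr]) ?_
      (by simp [reads, hN]) (by norm_num)
    simp only [Inv, reads, reduceIte, Nat.reduceEqDiff, hN]
    exact ⟨le_rfl, fun u _ => trivial, hpos, k1, k2, rfl, hfirst T0 hpos k1 k2 fun t _ => k3 t⟩

/-- List the candidate radii between registers 6 and 7 for step numbers divisible by register
20. -/
def buildP : Program :=
  I[11] ≔ ic 0 ;; I[2] ≔ ic 0 ;;
  .loop (ltI (iv 2) (iv 0)) (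
    I[3] ≔ ic 0 ;;
    .loop (ltI (iv 3) (ic 3 * iv 0)) (pairP ;; I[3] ≔ iv 3 + ic 1) ;;
    I[2] ≔ iv 2 + ic 1)

theorem buildP_spec (H : Demands n φ D) (hr : 0 < r) (hα : 0 < α) (S : Ready n k w α r φ D σ)
    (hq : σ.I 20 = q) (hq0 : 0 < q) (hlo : σ.R 6 = lo) (hhi : σ.R 7 = hi) (hlo0 : 0 ≤ lo)
    (hhi0 : 0 < hi) (hhi' : hi ≤ 2 * α * r) :
    WP buildP (fun τ m => 0 ≤ τ.I 11 ∧
      (∀ p, cnt p (τ.A 8) 0 (τ.I 11) = candCount n k α r φ D q lo hi p) ∧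
      (m : ℝ) ≤ 600 * n ^ 2 + 60 * candCount n k α r φ D q lo hi (fun _ => True)) σ := by
  have hn0 := H.pos
  have hn1 : (1:ℝ) ≤ n := by exact_mod_cast hn0
  set g : (ℝ → Prop) → ℤ → ℤ → ℕ := fun p i j =>
    multCount p (fun t => candidateRoot (φ j - φ i) (D i) (D j) r α t) k q lo hi with hg
  -- The potentials are the exact sums over the pairs still to come, so that the cost of long lists
  -- is charged to their entries.
  let cost : ℤ → ℝ := fun i => 50 + ∑ j ∈ Finset.Ico (0:ℤ) (3 * n), (170 + 60 * (g (fun _ => True) i j : ℝ))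
  have hcost0 : ∀ i, 0 ≤ cost i := fun i => by
    have : 0 ≤ ∑ j ∈ Finset.Ico (0:ℤ) (3 * n), (170 + 60 * (g (fun _ => True) i j : ℝ)) :=
      Finset.sum_nonneg fun j _ => by positivity
    simp only [cost]; linarith
  unfold buildP
  simp only [wps, evals, costs]
  refine WP_loop (fun τ => 0 ≤ τ.I 2 ∧ τ.I 2 ≤ n ∧ 0 ≤ τ.I 11 ∧ ∀ p, cnt p (τ.A 8) 0 (τ.I 11) =
      ∑ i ∈ Finset.Ico (0:ℤ) (τ.I 2), ∑ j ∈ Finset.Ico (0:ℤ) (3 * n), g p i j)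
    (fun τ => ∑ i ∈ Finset.Ico (τ.I 2) n, cost i) ?_ ?_ ?_ ?_
  · simp [reads]
  · rintro τ - -
    exact Finset.sum_nonneg fun i _ => hcost0 i
  · rintro τ fr ⟨i1, i2, i3, i4⟩ hb
    have e0 : τ.I 0 = n := by rw [fr.I 0 rfl]; simpa [reads] using S.hn
    obtain ⟨i, hi2⟩ : ∃ i, τ.I 2 = i := ⟨_, rfl⟩
    simp only [evals, e0, hi2, not_le] at hb
    rw [hi2] at i1 i2 i4
    simp only [wps, evals, costs]
    refine WP_loop (fun υ => 0 ≤ υ.I 3 ∧ υ.I 3 ≤ 3 * n ∧ 0 ≤ υ.I 11 ∧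
        ∀ p, cnt p (υ.A 8) 0 (υ.I 11) =
        ∑ i ∈ Finset.Ico (0:ℤ) i, ∑ j ∈ Finset.Ico (0:ℤ) (3 * n), g p i j +
          ∑ j ∈ Finset.Ico (0:ℤ) (υ.I 3), g p i j)
      (fun υ => ∑ j ∈ Finset.Ico (υ.I 3) (3 * n), (170 + 60 * (g (fun _ => True) i j : ℝ))) ?_ ?_ ?_ ?_
    · simp only [reads, reduceIte, Nat.reduceEqDiff]
      exact ⟨le_rfl, by omega, i3, by simpa using i4⟩
    · rintro υ - -
      exact Finset.sum_nonneg fun j _ => by positivity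
    · rintro υ fr' ⟨j1, j2, j3, j4⟩ hb'
      have e0' : υ.I 0 = n := by rw [fr'.I 0 rfl]; simpa [reads] using e0
      have e2' : υ.I 2 = i := by rw [fr'.I 2 rfl]; simpa [reads] using hi2
      obtain ⟨j, hj⟩ : ∃ j, υ.I 3 = j := ⟨_, rfl⟩
      obtain ⟨N, hN⟩ : ∃ N, υ.I 11 = N := ⟨_, rfl⟩
      simp only [evals, e0', hj, not_le] at hb'
      rw [hj] at j1 j2 j4
      rw [hN] at j3 j4
      have S' : Ready n k w α r φ D υ :=
        ⟨e0', by rw [fr'.I 1 rfl]; simp only [reads]; rw [if_neg (by norm_num), fr.I 1 rfl]; simpa [reads] using S.hk,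
          by rw [fr'.I 4 rfl]; simp only [reads]; rw [if_neg (by norm_num), fr.I 4 rfl]; simpa [reads] using S.hw,
          by rw [fr'.R 0 rfl]; simp only [reads]; rw [fr.R 0 rfl]; simpa [reads] using S.hα,
          by rw [fr'.R 1 rfl]; simp only [reads]; rw [fr.R 1 rfl]; simpa [reads] using S.hr,
          by rw [fr'.R 4 rfl]; simp only [reads]; rw [fr.R 4 rfl]; simpa [reads] using S.hpi,
          by rw [fr'.A 2 rfl]; simp only [reads]; rw [fr.A 2 rfl]; simpa [reads] using S.hφ,
          by rw [fr'.A 3 rfl]; simp only [reads]; rw [fr.A 3 rfl]; simpa [reads] using S.hD⟩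
      have f20 : υ.I 20 = q := by
        rw [fr'.I 20 rfl]; simp only [reads]; rw [if_neg (by norm_num), fr.I 20 rfl]; simpa [reads] using hq
      have f6 : υ.R 6 = lo := by
        rw [fr'.R 6 rfl]; simp only [reads]; rw [fr.R 6 rfl]; simpa [reads] using hlo
      have f7 : υ.R 7 = hi := by
        rw [fr'.R 7 rfl]; simp only [reads]; rw [fr.R 7 rfl]; simpa [reads] using hhi
      rw [WP_seq]
      refine (pairP_spec H hr hα S' f20 hq0 f6 f7 hlo0 hhi0 hhi' e2' hj i1 (by omega) j1 (by omega)
        hN).use ?_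
      rintro x m frx ⟨h1, h2, h3, hm⟩
      have ex3 : x.I 3 = j := by rw [frx.I 3 rfl, hj]
      simp only [wps, evals, costs, reads, reduceIte, Nat.reduceEqDiff, ex3]
      refine ⟨⟨by omega, by omega, by omega, fun p => ?_⟩, ?_⟩
      · rw [← cnt_add j3 h1, h3 p, Int.sum_Ico_succ j1, ← add_assoc, ← j4 p]
        congr 1
        exact cnt_congr fun u _ hu => h2 u hu
      · rw [hj, Int.sum_Ico_eq_add hb']
        push_cast
        simp only [hg]
        linarith
    · rintro υ m fr' ⟨j1, j2, j3, j4⟩ hb' hc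
      have e0' : υ.I 0 = n := by rw [fr'.I 0 rfl]; simpa [reads] using e0
      have e2' : υ.I 2 = i := by rw [fr'.I 2 rfl]; simpa [reads] using hi2
      simp only [evals, e0', not_le, not_lt] at hb'
      have e3 : υ.I 3 = 3 * n := le_antisymm j2 hb'
      rw [e3] at j4
      simp only [reads, reduceIte, Nat.reduceEqDiff, e2']
      refine ⟨⟨by omega, by omega, j3, fun p => ?_⟩, ?_⟩
      · rw [Int.sum_Ico_succ i1]; exact j4 p
      · rw [hi2, Int.sum_Ico_eq_add hb]
        simp only [reads, reduceIte, e3, costs, Finset.Ico_self, Finset.sum_empty] at hc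
        simp only [cost]
        push_cast at hc ⊢
        linarith
  · rintro τ m fr ⟨i1, i2, i3, i4⟩ hb hc
    have e0 : τ.I 0 = n := by rw [fr.I 0 rfl]; simpa [reads] using S.hn
    simp only [evals, e0, not_le, not_lt] at hb
    have e2 : τ.I 2 = n := le_antisymm i2 hb
    rw [e2] at i4
    refine ⟨i3, i4, ?_⟩
    simp only [reads, reduceIte, Nat.reduceEqDiff, e2, costs, Finset.Ico_self, Finset.sum_empty] at hc
    have h1 : ∑ i ∈ Finset.Ico (0:ℤ) n, cost i = 50 * n + 510 * n ^ 2 +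
        60 * candCount n k α r φ D q lo hi (fun _ => True) := by
      simp only [cost, candCount, Finset.sum_add_distrib, ← Finset.mul_sum, Finset.sum_const, hg]
      simp
      rw [show (3 * (n:ℤ)).toNat = 3 * n by omega]
      push_cast; ring
    rw [h1] at hc
    push_cast at hc ⊢
    nlinarith

/-- Keep only the entries of the list that lie strictly between registers 6 and 7. -/
def filterP : Program :=
  I[12] ≔ ic 0 ;; I[14] ≔ ic 0 ;;
  .loop (ltI (iv 14) (iv 11)) (
    .ite (.and (ltR (rv 6) (ra 8 (iv 14))) (ltR (ra 8 (iv 14)) (rv 7)))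
      (A[8, iv 12] ≔ ra 8 (iv 14) ;; I[12] ≔ iv 12 + ic 1) .skip ;;
    I[14] ≔ iv 14 + ic 1) ;;
  I[11] ≔ iv 12

/-- Compaction in place: the writing position never overtakes the reading position, so unread
entries are intact. -/
theorem filterP_spec {N : ℤ} (hN : σ.I 11 = N) (hN0 : 0 ≤ N) (hlo : σ.R 6 = lo)
    (hhi : σ.R 7 = hi) :
    WP filterP (fun τ m => 0 ≤ τ.I 11 ∧
      (∀ p, cnt p (τ.A 8) 0 (τ.I 11) = cnt (fun x => lo < x ∧ x < hi ∧ p x) (σ.A 8) 0 N) ∧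
      (m : ℝ) ≤ 50 * N + 20) σ := by
  classical
  set f := σ.A 8 with hf
  unfold filterP
  simp only [wps, evals, costs]
  refine WP_loop (fun τ => 0 ≤ τ.I 12 ∧ τ.I 12 ≤ τ.I 14 ∧ τ.I 14 ≤ N ∧
      (∀ i, τ.I 14 ≤ i → τ.A 8 i = f i) ∧
      (∀ p, cnt p (τ.A 8) 0 (τ.I 12) = cnt (fun x => lo < x ∧ x < hi ∧ p x) f 0 (τ.I 14)))
    (fun τ => (N - τ.I 14) * 50) ?_ ?_ ?_ ?_
  · simp only [reads, reduceIte, Nat.reduceEqDiff]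
    exact ⟨le_rfl, le_rfl, hN0, fun i _ => rfl, by simp⟩
  · rintro τ - ⟨-, -, h, -⟩
    have : (τ.I 14 : ℝ) ≤ N := by exact_mod_cast h
    linarith
  · rintro τ fr ⟨i1, i2, i3, i4, i5⟩ hb
    have e11 : τ.I 11 = N := by rw [fr.I 11 rfl]; simpa [reads] using hN
    have e6 : τ.R 6 = lo := by rw [fr.R 6 rfl]; simpa [reads] using hlo
    have e7 : τ.R 7 = hi := by rw [fr.R 7 rfl]; simpa [reads] using hhi
    obtain ⟨t, ht⟩ : ∃ t, τ.I 14 = t := ⟨_, rfl⟩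
    obtain ⟨M, hM⟩ : ∃ M, τ.I 12 = M := ⟨_, rfl⟩
    simp only [evals, e11, not_le, ht] at hb
    rw [ht] at i2 i3 i4 i5
    rw [hM] at i1 i2 i5
    have et := i4 t le_rfl
    simp only [wps, evals, costs, reads, reduceIte, Nat.reduceEqDiff, Nat.reduceAdd, ht, hM, e6, e7,
      et, not_le]
    refine ⟨fun hX => ⟨⟨by omega, by omega, by omega, fun i hi => ?_, fun p => ?_⟩,
      by push_cast; linarith⟩, fun hX => ⟨⟨by omega, by omega, by omega,
      fun i hi => i4 i (by omega), fun p => ?_⟩, by push_cast; linarith⟩⟩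
    · rw [Function.update_of_ne (by omega)]; exact i4 i (by omega)
    · rw [cnt_succ i1, cnt_succ (by omega), Function.update_self,
        cnt_congr fun u _ hu => Function.update_of_ne (by omega) _ _, i5 p]
      simp only [hX.1, hX.2, true_and]
    · rw [cnt_succ (by omega), i5 p, if_neg fun h => hX ⟨h.1, h.2.1⟩, add_zero]
  · rintro τ m fr ⟨i1, i2, i3, i4, i5⟩ hb hc
    have e11 : τ.I 11 = N := by rw [fr.I 11 rfl]; simpa [reads] using hN
    simp only [evals, e11, not_le, not_lt] at hb
    have e14 : τ.I 14 = N := le_antisymm i3 hb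
    rw [e14] at i5
    simp only [reads, reduceIte]
    refine ⟨i1, i5, ?_⟩
    simp only [reads, reduceIte, Nat.reduceEqDiff, e14, costs] at hc ⊢
    push_cast at hc ⊢; linarith

end
end RealRAM
end

noncomputable section

namespace RealRAM
open Syn

/-! ## Parametric search -/

/-- A bound for the time of the decision procedure. -/
def testCost (n k w : ℕ) : ℝ :=
  900 * n + n * min (k * (42 * ((n:ℝ) / w) + 10 * w + 150)) (200 * n + 200)

theorem testCost_nonneg (n k w : ℕ) : 0 ≤ testCost n k w := by
  unfold testCost; positivity

/-- The optimum is at least `lo` and smaller than `hi`; these are the contents of the registers 6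
and 7. -/
structure Bracket (n k w : ℕ) (α r : ℝ) (φ D : ℤ → ℝ) (X lo hi : ℝ) (σ : Store) : Prop where
  ready : Ready n k w α r φ D σ
  eq_lo : σ.R 6 = lo
  eq_hi : σ.R 7 = hi
  nonneg : 0 ≤ lo
  lt : lo < hi
  le : hi ≤ X
  chain : lo = 0 ∨ HasChain (Demands.free φ D r lo) (stepAngle r α lo) k
  not_chain : ¬ HasChain (Demands.free φ D r hi) (stepAngle r α hi) k

theorem Bracket.of_frame {n k w : ℕ} {α r : ℝ} {φ D : ℤ → ℝ} {X lo hi : ℝ} {σ τ : Store}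
    {P : Program} (b : Bracket n k w α r φ D X lo hi σ) (fr : Frame P σ τ)
    (hP : (P.modVar .int 0 || P.modVar .int 1 || P.modVar .int 4 || P.modVar .real 0 ||
      P.modVar .real 1 || P.modVar .real 4 || P.modArr .real 2 || P.modArr .real 3) = false)
    (h6 : P.modVar .real 6 = false) (h7 : P.modVar .real 7 = false) :
    Bracket n k w α r φ D X lo hi τ :=
  ⟨b.ready.of_frame fr hP, by rw [fr.R 6 h6, b.eq_lo], by rw [fr.R 7 h7, b.eq_hi], b.nonneg, b.lt,
    b.le, b.chain, b.not_chain⟩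

/-- The list in array 8 consists of the candidates between `lo` and `hi`. -/
def Listed (n k : ℕ) (α r : ℝ) (φ D : ℤ → ℝ) (q : ℤ) (lo hi : ℝ) (σ : Store) : Prop :=
  0 ≤ σ.I 11 ∧ ∀ p, cnt p (σ.A 8) 0 (σ.I 11) = candCount n k α r φ D q lo hi p

theorem Listed.length {n k : ℕ} {α r : ℝ} {φ D : ℤ → ℝ} {q : ℤ} {lo hi : ℝ} {σ : Store}
    (h : Listed n k α r φ D q lo hi σ) :
    σ.I 11 = candCount n k α r φ D q lo hi (fun _ => True) := by
  rw [← h.2, cnt_true h.1, sub_zero]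

/-- Decide the radius of an approximate median and discard the candidates that are settled. -/
def halveP : Program :=
  pivotP ;; testP ;; .ite (.intLe (ic 1) (iv 7)) (R[6] ≔ rv 8) (R[7] ≔ rv 8) ;; filterP

/-- Reduce the list to at most as many candidates as register 21 says. -/
def pruneP : Program := .loop (ltI (iv 21) (iv 11)) halveP

/-- Settle the candidates for step numbers divisible by register 20, up to a few. -/
def stageP : Program :=
  buildP ;; .ite (.intLe (iv 20) (ic 1)) (I[21] ≔ ic 0) (I[21] ≔ ic 3 * iv 0 * iv 0) ;; pruneP

/-- Settle all candidates. -/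
def stagesP : Program :=
  I[20] ≔ ic 1 ;; .loop (ltI (iv 20) (iv 1)) (I[20] ≔ ic 2 * iv 20) ;;
  .loop (.intLe (ic 1) (iv 20)) (stageP ;; I[20] ≔ iv 20 / ic 2)

section
variable {n k w : ℕ} {α r : ℝ} {φ D : ℤ → ℝ} {σ : Store} {q : ℤ} {X lo hi : ℝ}

/-- The pivot `v` is a list entry, hence strictly inside the bracket. Deciding it makes `v` an end
of the open bracket, which removes `v` and all entries on one side of it, at least a fraction 1/256.
-/
theorem halveP_spec (H : Demands n φ D) (hr : 0 < r) (hα : 0 < α) (hk : 1 ≤ k) (hw : 1 ≤ w)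
    (B : Bracket n k w α r φ D X lo hi σ)
    (L : Listed n k α r φ D q lo hi σ) {N : ℤ} (hN : σ.I 11 = N) (hN1 : 1 ≤ N) :
    WP halveP (fun τ m => (∃ lo' hi', Bracket n k w α r φ D X lo' hi' τ ∧
      Listed n k α r φ D q lo' hi' τ) ∧ 256 * τ.I 11 ≤ 255 * N ∧
      (m : ℝ) ≤ 1150 * N + testCost n k w) σ := by
  classical
  have hN1' : (1:ℝ) ≤ N := by exact_mod_cast hN1
  unfold halveP
  rw [WP_seq]
  refine (pivotP_spec hN hN1).use ?_
  rintro τ1 m1 fr1 ⟨p1, p2, ⟨i, hi0, hiN, hiv⟩, hm1⟩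
  have B1 := B.of_frame fr1 rfl rfl rfl
  obtain ⟨v, hv⟩ : ∃ v, τ1.R 8 = v := ⟨_, rfl⟩
  rw [hv] at p1 p2 hiv
  have hcount : ∀ p, cnt p (σ.A 8) 0 N = candCount n k α r φ D q lo hi p := hN ▸ L.2
  -- Test the counts with the predicate "outside the bracket": no candidate counted satisfies it, so
  -- no list entry does.
  have hvr : lo < v ∧ v < hi := by
    by_contra hc
    have h1 : cnt (fun x => ¬ (lo < x ∧ x < hi)) (σ.A 8) 0 N = 0 := by
      rw [hcount]; exact candCount_outside fun x h1 h2 h3 => h3 ⟨h1, h2⟩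
    have h2 := cnt_pos (p := fun x => ¬ (lo < x ∧ x < hi)) (f := σ.A 8) hi0 hiN
      (by rw [hiv]; exact hc)
    omega
  have hv0 : 0 < v := B.nonneg.trans_lt hvr.1
  rw [WP_seq]
  refine (testP_spec H hk hw B1.ready (by rw [hv]; exact stepAngle_pos hr hα hv0)).use ?_
  rintro τ2 m2 fr2 ⟨t7, hm2⟩
  have B2 := B1.of_frame fr2 rfl rfl rfl
  have e8 : τ2.R 8 = v := by rw [fr2.R 8 rfl, hv]
  have eA : τ2.A 8 = σ.A 8 := by rw [fr2.A 8 rfl, fr1.A 8 rfl]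
  have e11 : τ2.I 11 = N := by rw [fr2.I 11 rfl, fr1.I 11 rfl, hN]
  rw [hv] at t7
  have hm2' : (m2:ℝ) ≤ testCost n k w := hm2
  have fin : ∀ (ρ : Store) (c : ℕ) (lo' hi' : ℝ), Bracket n k w α r φ D X lo' hi' ρ → lo ≤ lo' →
      hi' ≤ hi → ρ.A 8 = σ.A 8 → ρ.I 11 = N →
      256 * (cnt (fun x => lo' < x ∧ x < hi' ∧ True) (σ.A 8) 0 N : ℤ) ≤ 255 * N → c ≤ 10 →
      WP filterP (fun τ m => (∃ lo' hi', Bracket n k w α r φ D X lo' hi' τ ∧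
        Listed n k α r φ D q lo' hi' τ) ∧ 256 * τ.I 11 ≤ 255 * N ∧
        ((m1 + (m2 + (c + m)) : ℕ) : ℝ) ≤ 1150 * N + testCost n k w) ρ := by
    intro ρ c lo' hi' Bρ h1 h2 h3 h4 h5 hc
    refine (filterP_spec h4 (by omega) Bρ.eq_lo Bρ.eq_hi).use ?_
    rintro τ m fr ⟨f1, f2, f3⟩
    rw [h3] at f2
    have hc' : (c:ℝ) ≤ 10 := by exact_mod_cast hc
    refine ⟨⟨lo', hi', Bρ.of_frame fr rfl rfl rfl, f1, fun p => ?_⟩, ?_, ?_⟩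
    · rw [f2, hcount, candCount_restrict h1 h2]
    · rw [← f2, cnt_true f1] at h5; omega
    · push_cast; linarith
  have hcompl : ∀ p q' : ℝ → Prop, (∀ x, q' x → ¬ p x) → N ≤ 256 * (cnt p (σ.A 8) 0 N : ℤ) →
      256 * (cnt q' (σ.A 8) 0 N : ℤ) ≤ 255 * N := by
    intro p q' hpq h1
    have h2 := cnt_imp (f := σ.A 8) (a := 0) (b := N) hpq
    have h3 := cnt_add_cnt_not (p := p) (f := σ.A 8) (a := 0) (b := N)
    have h4 := cnt_true (f := σ.A 8) (show 0 ≤ N by omega)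
    omega
  have hsr := B2.ready
  simp only [wps, evals, costs, e8, t7]
  refine ⟨fun hyes => ?_, fun hno => ?_⟩
  · have hch : HasChain (Demands.free φ D r v) (stepAngle r α v) k := by
      by_contra h; rw [if_neg h] at hyes; omega
    refine fin _ 6 v hi ⟨⟨?_, ?_, ?_, ?_, ?_, ?_, ?_, ?_⟩, by simp [reads], ?_, hv0.le, hvr.2, B.le,
      Or.inr hch, B.not_chain⟩ hvr.1.le le_rfl (by simp [reads, eA]) (by simp [reads, e11])
      (hcompl _ _ (fun x h1 h2 => absurd h1.1 (not_lt.2 h2)) p1) (by norm_num)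
    · simpa [reads] using hsr.hn
    · simpa [reads] using hsr.hk
    · simpa [reads] using hsr.hw
    · simpa [reads] using hsr.hα
    · simpa [reads] using hsr.hr
    · simpa [reads] using hsr.hpi
    · exact hsr.hφ
    · exact hsr.hD
    · simpa [reads] using B2.eq_hi
  · have hch : ¬ HasChain (Demands.free φ D r v) (stepAngle r α v) k := by
      intro h; rw [if_pos h] at hno; omega
    refine fin _ 6 lo v ⟨⟨?_, ?_, ?_, ?_, ?_, ?_, ?_, ?_⟩, ?_, by simp [reads], B.nonneg, hvr.1,
      hvr.2.le.trans B.le, B.chain, hch⟩ le_rfl hvr.2.le (by simp [reads, eA]) (by simp [reads, e11])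
      (hcompl _ _ (fun x h1 h2 => absurd h1.2.1 (not_lt.2 h2)) p2) (by norm_num)
    · simpa [reads] using hsr.hn
    · simpa [reads] using hsr.hk
    · simpa [reads] using hsr.hw
    · simpa [reads] using hsr.hα
    · simpa [reads] using hsr.hr
    · simpa [reads] using hsr.hpi
    · exact hsr.hφ
    · exact hsr.hD
    · simpa [reads] using B2.eq_lo

/-- A bound for the number of decisions in reducing a list of length `N` to length `th`. -/
def halvings (th : ℤ) (N : ℝ) : ℝ := if N ≤ th then 0 else 1 + 256 * log (N / max (th : ℝ) 1)

theorem halvings_nonneg (th : ℤ) {N : ℝ} (hN : 1 ≤ N) : 0 ≤ halvings th N := by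
  unfold halvings
  split_ifs with h
  · exact le_rfl
  · have h0 : (0:ℝ) < max (th : ℝ) 1 := lt_max_of_lt_right one_pos
    have : 1 ≤ N / max (th:ℝ) 1 := by
      rw [le_div_iff₀ h0, one_mul]; exact max_le (not_le.1 h).le hN
    have := log_nonneg this
    linarith

/-- One decision multiplies the length by at most 255/256, whose logarithm is at most -1/256; the
summand 1 pays for the step that reaches the threshold. -/
theorem halvings_step {th : ℤ} {N N' : ℝ} (hth : 0 ≤ th) (hN : 1 ≤ N) (hthN : th < N)
    (hN' : 256 * N' ≤ 255 * N) : halvings th N' + 1 ≤ halvings th N := by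
  have hth' : (0:ℝ) ≤ th := by exact_mod_cast hth
  have h0 : (0:ℝ) < max (th : ℝ) 1 := lt_max_of_lt_right one_pos
  have h1 : 1 ≤ N / max (th:ℝ) 1 := by
    rw [le_div_iff₀ h0, one_mul]; exact max_le hthN.le hN
  have h2 := log_nonneg h1
  unfold halvings
  rw [if_neg (not_le.2 hthN)]
  split_ifs with h3
  · linarith
  · have hN0 : 0 < N' := by linarith [not_le.1 h3]
    have h4 : log (N' / max (th:ℝ) 1) ≤ log (N / max (th:ℝ) 1) + log (255 / 256) := by
      rw [← log_mul (by positivity) (by norm_num)]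
      apply log_le_log (by positivity)
      rw [div_mul_eq_mul_div]
      gcongr; linarith
    have h5 : log (255 / 256 : ℝ) ≤ 255 / 256 - 1 := log_le_sub_one_of_pos (by norm_num)
    linarith

/-- List lengths decrease geometrically, so a potential linear in the length pays for pivoting and
filtering: `300000 / 256` exceeds the 1150 units per entry. `halvings` counts the decisions. -/
theorem pruneP_spec (H : Demands n φ D) (hr : 0 < r) (hα : 0 < α) (hk : 1 ≤ k) (hw : 1 ≤ w)
    (B : Bracket n k w α r φ D X lo hi σ)
    (L : Listed n k α r φ D q lo hi σ) {th : ℤ} (hth : σ.I 21 = th) (hth0 : 0 ≤ th) :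
    WP pruneP (fun τ m => (∃ lo' hi', Bracket n k w α r φ D X lo' hi' τ ∧
      Listed n k α r φ D q lo' hi' τ) ∧ τ.I 11 ≤ th ∧
      (m : ℝ) ≤ 300000 * σ.I 11 + testCost n k w * halvings th (σ.I 11) + 5) σ := by
  have hT := testCost_nonneg n k w
  have hth' : (0:ℝ) ≤ th := by exact_mod_cast hth0
  have hhalf : ∀ N : ℤ, 0 ≤ N → 0 ≤ halvings th N := fun N hN => by
    rcases (show N = 0 ∨ 1 ≤ N by omega) with rfl | h
    · unfold halvings; rw [if_pos (by exact_mod_cast hth0)]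
    · exact halvings_nonneg th (by exact_mod_cast h)
  unfold pruneP
  refine WP_loop (fun τ => ∃ lo' hi', Bracket n k w α r φ D X lo' hi' τ ∧
      Listed n k α r φ D q lo' hi' τ)
    (fun τ => 300000 * τ.I 11 + testCost n k w * halvings th (τ.I 11)) ⟨lo, hi, B, L⟩ ?_ ?_ ?_
  · rintro τ - ⟨lo', hi', -, L', -⟩
    have : (0:ℝ) ≤ τ.I 11 := by exact_mod_cast L'
    have := mul_nonneg hT (hhalf _ L')
    linarith
  · rintro τ fr ⟨lo', hi', B', L'⟩ hb
    have e21 : τ.I 21 = th := by rw [fr.I 21 rfl, hth]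
    simp only [evals, e21, not_le] at hb
    refine (halveP_spec H hr hα hk hw B' L' rfl (by omega)).use ?_
    rintro υ m fr' ⟨h1, h2, hm⟩
    refine ⟨h1, ?_⟩
    have hb' : (th:ℝ) < τ.I 11 := by exact_mod_cast hb
    have h1' : (1:ℝ) ≤ τ.I 11 := by exact_mod_cast (by omega : 1 ≤ τ.I 11)
    have h2' : 256 * (υ.I 11 : ℝ) ≤ 255 * τ.I 11 := by exact_mod_cast h2
    have h3 := mul_le_mul_of_nonneg_left (halvings_step hth0 h1' hb' h2') hT
    simp only [costs]
    push_cast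
    linarith
  · rintro τ m fr ⟨lo', hi', B', L'⟩ hb hc
    have e21 : τ.I 21 = th := by rw [fr.I 21 rfl, hth]
    simp only [evals, e21, not_le, not_lt] at hb
    refine ⟨⟨lo', hi', B', L'⟩, hb, ?_⟩
    have : (0:ℝ) ≤ τ.I 11 := by exact_mod_cast L'.1
    have := mul_nonneg hT (hhalf _ L'.1)
    simp only [costs] at hc
    push_cast at hc
    linarith

/-- The time for a stage. -/
def stageCost (n k w : ℕ) : ℝ := 3000000 * n ^ 2 + 513 * testCost n k w

/-- The time for the last stage. -/
def lastStageCost (n k w : ℕ) : ℝ :=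
  3000000 * n ^ 2 + testCost n k w * (1 + 256 * log (9 * n ^ 2))

/-- At most `3n²` candidates for `2q` mean at most `9n²` for `q`, so the list costs O(n²) to build.
It is reduced to `3n²` again, or to nothing when `q = 1`. -/
theorem stageP_spec (H : Demands n φ D) (hr : 0 < r) (hα : 0 < α) (hk : 1 ≤ k) (hw : 1 ≤ w)
    (hX : X ≤ 2 * α * r) (B : Bracket n k w α r φ D X lo hi σ) (hq : σ.I 20 = q) (hq0 : 0 < q)
    (hc : candCount n k α r φ D (2 * q) lo hi (fun _ => True) ≤ 3 * n ^ 2) :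
    WP stageP (fun τ m => ∃ lo' hi', Bracket n k w α r φ D X lo' hi' τ ∧
      (candCount n k α r φ D q lo' hi' (fun _ => True) : ℤ) ≤ (if q ≤ 1 then 0 else 3 * (n:ℤ) ^ 2) ∧
      (m : ℝ) ≤ if q ≤ 1 then lastStageCost n k w else stageCost n k w) σ := by
  have hT := testCost_nonneg n k w
  have hn0 := H.pos
  have hn1 : (1:ℝ) ≤ n := by exact_mod_cast hn0
  have hn2 : (1:ℝ) ≤ n ^ 2 := one_le_pow₀ hn1
  have hhi0 : 0 < hi := B.nonneg.trans_lt B.lt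
  have hhi' := B.le.trans hX
  have hlen := candCount_le_two_mul (k := k) H hr hα hq0 B.nonneg hhi0 hhi'
  set N := candCount n k α r φ D q lo hi (fun _ => True) with hN
  have hN9 : (N:ℝ) ≤ 9 * n ^ 2 := by
    have : N ≤ 9 * n ^ 2 := by omega
    exact_mod_cast this
  unfold stageP
  rw [WP_seq]
  refine (buildP_spec H hr hα B.ready hq hq0 B.eq_lo B.eq_hi B.nonneg hhi0 hhi').use ?_
  rintro τ m fr ⟨L1, L2, hm⟩
  have B1 := B.of_frame fr rfl rfl rfl
  have e20 : τ.I 20 = q := by rw [fr.I 20 rfl, hq]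
  have L : Listed n k α r φ D q lo hi τ := ⟨L1, L2⟩
  have hlen' := L.length
  have hsr := B1.ready
  have fin : ∀ (th : ℤ) (c : ℕ) (C : ℝ), 0 ≤ th → c ≤ 20 →
      3000000 * n ^ 2 + testCost n k w * halvings th N ≤ C →
      WP pruneP (fun υ m' => ∃ lo' hi', Bracket n k w α r φ D X lo' hi' υ ∧
      (candCount n k α r φ D q lo' hi' (fun _ => True) : ℤ) ≤ th ∧
      ((m + (c + m') : ℕ) : ℝ) ≤ C) (τ.setI 21 th) := by
    intro th c C hth hc hC
    have B2 : Bracket n k w α r φ D X lo hi (τ.setI 21 th) :=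
      ⟨⟨by simpa [reads] using hsr.hn, by simpa [reads] using hsr.hk, by simpa [reads] using hsr.hw,
        by simpa [reads] using hsr.hα, by simpa [reads] using hsr.hr,
        by simpa [reads] using hsr.hpi, hsr.hφ, hsr.hD⟩, by simpa [reads] using B1.eq_lo,
        by simpa [reads] using B1.eq_hi, B.nonneg, B.lt, B.le, B.chain, B.not_chain⟩
    have L2 : Listed n k α r φ D q lo hi (τ.setI 21 th) := by
      simpa [Listed, reads] using L
    refine (pruneP_spec H hr hα hk hw B2 L2 (th := th) (by simp [reads]) hth).use ?_
    rintro υ m' fr' ⟨⟨lo', hi', B', L'⟩, hle, hm'⟩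
    refine ⟨lo', hi', B', by rw [← L'.length]; exact hle, ?_⟩
    have hc' : (c:ℝ) ≤ 20 := by exact_mod_cast hc
    simp only [reads, reduceIte, Nat.reduceEqDiff, hlen', Int.cast_natCast] at hm'
    push_cast
    linarith
  simp only [wps, evals, costs, e20, hsr.hn]
  refine ⟨fun h1 => ?_, fun h1 => ?_⟩
  · simp only [h1, if_true]
    refine fin 0 _ _ le_rfl (by norm_num) ?_
    unfold lastStageCost
    gcongr
    unfold halvings
    have h2 : 0 ≤ log (9 * (n:ℝ) ^ 2) := log_nonneg (by linarith)
    split_ifs with h3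
    · positivity
    · have : (0:ℝ) < N := by simpa [Nat.pos_iff_ne_zero] using h3
      simp only [Int.cast_zero, zero_le_one, max_eq_right, div_one]
      gcongr
  · simp only [h1, if_false]
    rw [show (3:ℤ) * n * n = 3 * n ^ 2 by ring]
    refine fin (3 * n ^ 2) _ _ (by positivity) (by norm_num) ?_
    unfold stageCost
    -- `513 = 1 + 256 * 2`: the list is at most three times as long as allowed, and `log 3 ≤ 2`.
    rw [mul_comm (513:ℝ)]
    gcongr
    unfold halvings
    split_ifs with h3
    · norm_num
    · rw [not_le] at h3
      push_cast at h3 ⊢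
      rw [max_eq_left (by linarith)]
      have : (N:ℝ) / (3 * n ^ 2) ≤ 3 := by
        rw [div_le_iff₀ (by linarith)]; linarith
      have h4 := log_le_log (by have : (0:ℝ) < N := by linarith
                                positivity) this
      have h5 : log (3:ℝ) ≤ 3 - 1 := log_le_sub_one_of_pos (by norm_num)
      linarith

/-- Once the power of two in register 20 is at least `k`, only `t = 0` counts and the bound `3n²`
holds trivially. Each stage re-establishes it for half the step; after the stage for step 1, the
integer division gives 0, which ends the loop. -/
theorem stagesP_spec (H : Demands n φ D) (hr : 0 < r) (hα : 0 < α) (hk : 1 ≤ k) (hw : 1 ≤ w)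
    (hX : X ≤ 2 * α * r) (B : Bracket n k w α r φ D X lo hi σ) :
    WP stagesP (fun τ m => ∃ lo' hi', Bracket n k w α r φ D X lo' hi' τ ∧
      candCount n k α r φ D 1 lo' hi' (fun _ => True) = 0 ∧
      (m : ℝ) ≤ (logb 2 k + 1) * (stageCost n k w + 20) + lastStageCost n k w + 60 + 10 * logb 2 k) σ := by
  have hT := testCost_nonneg n k w
  have hn0 := H.pos
  have hn1 : (1:ℝ) ≤ n := by exact_mod_cast hn0
  have hn2 : (1:ℝ) ≤ n ^ 2 := one_le_pow₀ hn1
  have hC1 : 0 ≤ stageCost n k w := by unfold stageCost; positivity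
  have hC2 : 0 ≤ lastStageCost n k w := by
    unfold lastStageCost
    have h2 : 0 ≤ log (9 * (n:ℝ) ^ 2) := log_nonneg (by linarith)
    positivity
  have hk' : (1:ℝ) ≤ k := by exact_mod_cast hk
  have hlog : ∀ e : ℕ, logb 2 ((2:ℝ) ^ e) = e := fun e => by
    rw [logb_pow, logb_self_eq_one (by norm_num), mul_one]
  unfold stagesP
  simp only [wps, evals, costs]
  refine WP_loop (fun τ => (∃ e : ℕ, τ.I 20 = 2 ^ e) ∧ τ.I 20 ≤ 2 * k)
    (fun τ => (logb 2 k + 1 - logb 2 (τ.I 20)) * 10) ?_ ?_ ?_ ?_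
  · simp only [reads, reduceIte]
    exact ⟨⟨0, rfl⟩, by omega⟩
  · rintro τ - ⟨⟨e, he⟩, h2⟩
    have h2' : (τ.I 20 : ℝ) ≤ 2 * k := by exact_mod_cast h2
    have h3 : (0:ℝ) < τ.I 20 := by rw [he]; positivity
    have := logb_le_logb_of_le (b := 2) (by norm_num) h3 h2'
    rw [logb_mul (by norm_num) (by positivity), logb_self_eq_one (by norm_num)] at this
    linarith
  · rintro τ fr ⟨⟨e, he⟩, h2⟩ hb
    have e1 : τ.I 1 = k := by rw [fr.I 1 rfl]; simpa [reads] using B.ready.hk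
    simp only [evals, e1, not_le] at hb
    simp only [wps, evals, costs, reads, reduceIte]
    refine ⟨⟨⟨e + 1, by rw [he]; ring⟩, by omega⟩, ?_⟩
    rw [he]
    push_cast
    rw [← pow_succ', hlog, hlog]
    push_cast
    linarith
  · rintro τ m fr ⟨⟨e, he⟩, h2⟩ hb hc
    have B1 : Bracket n k w α r φ D X lo hi τ := by
      have hsr := B.ready
      exact ⟨⟨by rw [fr.I 0 rfl]; simpa [reads] using hsr.hn,
        by rw [fr.I 1 rfl]; simpa [reads] using hsr.hk,
        by rw [fr.I 4 rfl]; simpa [reads] using hsr.hw,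
        by rw [fr.R 0 rfl]; simpa [reads] using hsr.hα,
        by rw [fr.R 1 rfl]; simpa [reads] using hsr.hr,
        by rw [fr.R 4 rfl]; simpa [reads] using hsr.hpi,
        by rw [fr.A 2 rfl]; exact hsr.hφ, by rw [fr.A 3 rfl]; exact hsr.hD⟩,
        by rw [fr.R 6 rfl]; simpa [reads] using B.eq_lo,
        by rw [fr.R 7 rfl]; simpa [reads] using B.eq_hi, B.nonneg, B.lt, B.le, B.chain,
        B.not_chain⟩
    simp only [evals, B1.ready.hk, not_le, not_lt] at hb
    have h2' : (τ.I 20 : ℝ) ≤ 2 * k := by exact_mod_cast h2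
    have h3 : (0:ℝ) < τ.I 20 := by rw [he]; positivity
    have hlq := logb_le_logb_of_le (b := 2) (by norm_num) h3 h2'
    rw [logb_mul (by norm_num) (by positivity), logb_self_eq_one (by norm_num)] at hlq
    have hlq0 : 0 ≤ logb 2 (τ.I 20) := by rw [he]; push_cast; rw [hlog]; positivity
    refine WP_loop (fun υ => ∃ lo' hi', Bracket n k w α r φ D X lo' hi' υ ∧
        ((∃ e : ℕ, υ.I 20 = 2 ^ e ∧
          candCount n k α r φ D (2 * 2 ^ e) lo' hi' (fun _ => True) ≤ 3 * n ^ 2) ∨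
        (υ.I 20 = 0 ∧ candCount n k α r φ D 1 lo' hi' (fun _ => True) = 0)))
      (fun υ => if υ.I 20 = 0 then 0 else
        logb 2 (υ.I 20) * (stageCost n k w + 20) + lastStageCost n k w + 20) ?_ ?_ ?_ ?_
    · refine ⟨lo, hi, B1, Or.inl ⟨e, he, candCount_le_of_le ?_⟩⟩
      rw [he] at hb
      have : (0:ℤ) < 2 ^ e := by positivity
      omega
    · rintro υ - ⟨lo', hi', -, ⟨e', he', -⟩ | ⟨h0, -⟩⟩
      · rw [if_neg (by rw [he']; positivity), he']
        push_cast
        rw [hlog]; positivity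
      · simp [h0]
    · rintro υ fr' ⟨lo', hi', B', ⟨e', he', hc'⟩ | ⟨h0, -⟩⟩ hb'
      · rw [if_neg (by rw [he']; positivity), WP_seq]
        refine (stageP_spec H hr hα hk hw hX B' he' (by positivity) hc').use ?_
        rintro x mx frx ⟨lo2, hi2, Bx, hcx, hmx⟩
        have ex : x.I 20 = 2 ^ e' := by rw [frx.I 20 rfl, he']
        have hsr := Bx.ready
        have By : ∀ z, Bracket n k w α r φ D X lo2 hi2 (x.setI 20 z) := fun z =>
          ⟨⟨by simpa [reads] using hsr.hn, by simpa [reads] using hsr.hk,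
            by simpa [reads] using hsr.hw, by simpa [reads] using hsr.hα,
            by simpa [reads] using hsr.hr, by simpa [reads] using hsr.hpi, hsr.hφ, hsr.hD⟩,
            by simpa [reads] using Bx.eq_lo, by simpa [reads] using Bx.eq_hi, Bx.nonneg, Bx.lt,
            Bx.le, Bx.chain, Bx.not_chain⟩
        simp only [wps, evals, costs, reads, reduceIte, ex, he',
          Int.fdiv_eq_ediv_of_nonneg _ (by norm_num : (0:ℤ) ≤ 2)]
        rcases Nat.eq_zero_or_pos e' with rfl | hpos
        · norm_num at hcx hmx ⊢
          refine ⟨⟨lo2, hi2, By 0, Or.inr hcx⟩, ?_⟩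
          linarith
        · obtain ⟨e2, rfl⟩ : ∃ e2, e' = e2 + 1 := ⟨e' - 1, by omega⟩
          have h5 : ((2:ℤ) ^ (e2 + 1)) / 2 = 2 ^ e2 := by
            rw [pow_succ, Int.mul_ediv_cancel _ (by norm_num)]
          have h6 : ¬ (2:ℤ) ^ (e2 + 1) ≤ 1 := by
            have : (0:ℤ) < 2 ^ e2 := by positivity
            rw [pow_succ]; omega
          rw [if_neg h6] at hcx hmx
          rw [h5]
          refine ⟨⟨lo2, hi2, By _, Or.inl ⟨e2, rfl, ?_⟩⟩, ?_⟩
          · rw [← pow_succ']; exact_mod_cast hcx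
          · rw [if_neg (by positivity)]
            push_cast
            rw [hlog, hlog]
            push_cast
            linarith
      · simp only [evals, h0] at hb'
        omega
    · rintro υ m' fr' ⟨lo', hi', B', ⟨e', he', -⟩ | ⟨h0, h0'⟩⟩ hb' hcost
      · simp only [evals, he'] at hb'
        have : (0:ℤ) < 2 ^ e' := by positivity
        omega
      · refine ⟨lo', hi', B', h0', ?_⟩
        rw [if_pos h0, if_neg (by rw [he]; positivity)] at hcost
        simp only [reads, reduceIte, Int.cast_one, logb_one, costs] at hc hcost
        have h7 : logb 2 (τ.I 20) * (stageCost n k w + 20) ≤ (logb 2 k + 1) * (stageCost n k w + 20) := by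
          gcongr; linarith
        push_cast at hc hcost ⊢
        linarith

end
end RealRAM
end

noncomputable section

namespace RealRAM
open Syn

/-! ## The program -/

/-- The program for at least two points. -/
def solveP : Program :=
  readP ;; I[4] ≔ .floor (.fn .sqrt (.toReal (iv 0))) ;; R[8] ≔ rv 5 ;; testP ;;
  .ite (.intLe (ic 1) (iv 7)) (R[0] ≔ rv 5)
    (R[6] ≔ rc 0 ;; R[7] ≔ rv 5 ;; stagesP ;; R[0] ≔ rv 6)

/-- The program for the circular obnoxious facility location problem. -/
def circP : Program := .ite (.intLe (iv 1) (ic 1)) (R[0] ≔ rc 0) solveP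

/-- The time of `solveP`. -/
def solveCost (n k w : ℕ) : ℝ :=
  500 * n ^ 2 + testCost n k w + (logb 2 k + 1) * (stageCost n k w + 20) + lastStageCost n k w +
    10 * logb 2 k + 100

/-- The upper bound `X` is decided first. If it is feasible, it is the optimum; if not, `0` and `X`
form the first bracket, where `lo = 0` needs no chain since the objective is nonnegative. -/
theorem solveP_spec {n k : ℕ} {α r : ℝ} (hn : 1 ≤ n) (hk : 2 ≤ k) (hα : 0 < α) (hr : 0 < r)
    (o : Plane) (p : Fin n → Plane) (σ : Store) (h0 : σ.I 0 = n) (h1 : σ.I 1 = k)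
    (hR0 : σ.R 0 = α) (hR1 : σ.R 1 = r) (hR2 : σ.R 2 = o 0) (hR3 : σ.R 3 = o 1)
    (hA0 : ∀ i : Fin n, σ.A 0 i = p i 0) (hA1 : ∀ i : Fin n, σ.A 1 i = p i 1) :
    WP solveP (fun τ m => IsCircOptimum α o r p k (τ.R 0) ∧
      (m : ℝ) ≤ solveCost n k ⌊√(n:ℝ)⌋₊) σ := by
  have hn1 : (1:ℝ) ≤ n := by exact_mod_cast hn
  have hk1 : (1:ℝ) ≤ k := by exact_mod_cast (by omega : 1 ≤ k)
  set w := ⌊√(n:ℝ)⌋₊ with hw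
  have hw1 : 1 ≤ w := Nat.le_floor (by simpa using hn1)
  have hT := testCost_nonneg n k w
  unfold solveP
  rw [WP_seq]
  refine (readP_spec hn hr o p σ h0 h1 hR0 hR1 hR2 hR3 hA0 hA1).use ?_
  rintro τ m fr ⟨φ, D, H, hA, hpi, hm⟩
  have hX0 := H.pos hk hα hr
  have hX := H.cap_le' hα hr
  set X := τ.R 5 with hX'
  have e0 : τ.I 0 = n := by rw [fr.I 0 rfl, h0]
  have ew : ⌊√(n:ℝ)⌋ = (w:ℤ) := (Int.natCast_floor_eq_floor (Real.sqrt_nonneg _)).symm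
  simp only [wps, evals, costs, reads, e0, Int.cast_natCast, ew]
  have S : Ready n k w α r φ D ((τ.setI 4 w).setR 8 (τ.R 5)) :=
    ⟨by simpa [reads] using e0, by simp [reads, fr.I 1 rfl, h1], by simp [reads],
      by simp [reads, fr.R 0 rfl, hR0], by simp [reads, fr.R 1 rfl, hR1], by simpa [reads] using hpi,
      fun u hu hu' => (hA u hu hu').1, fun u hu hu' => (hA u hu hu').2⟩
  have e8 : ((τ.setI 4 w).setR 8 (τ.R 5)).R 8 = X := by simp [reads, hX']
  refine (testP_spec H.demands (by omega) hw1 S (by rw [e8]; exact stepAngle_pos hr hα hX0)).use ?_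
  rintro υ m' fr' ⟨h7, hm'⟩
  rw [e8] at h7
  change (m':ℝ) ≤ testCost n k w at hm'
  have f5 : υ.R 5 = X := by rw [fr'.R 5 rfl]; simp [reads, hX']
  have S' := S.of_frame fr' rfl
  have hlb : 0 ≤ logb 2 (k:ℝ) := logb_nonneg (by norm_num) hk1
  have hn2 : (1:ℝ) ≤ n ^ 2 := one_le_pow₀ hn1
  have hC1 : 0 ≤ stageCost n k w := by unfold stageCost; positivity
  have hC2 : 0 ≤ lastStageCost n k w := by
    unfold lastStageCost
    have h2 : 0 ≤ log (9 * (n:ℝ) ^ 2) := log_nonneg (by linarith)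
    positivity
  simp only [h7, f5, reads, reduceIte, Nat.reduceEqDiff, Rat.cast_zero]
  refine ⟨fun hyes => ?_, fun hno => ?_⟩
  · have hch : HasChain (Demands.free φ D r X) (stepAngle r α X) k := by
      by_contra h; rw [if_neg h] at hyes; omega
    refine ⟨H.isCircOptimum_of_hasChain hk hα hr hch, ?_⟩
    have : 0 ≤ (logb 2 (k:ℝ) + 1) * (stageCost n k w + 20) := by positivity
    unfold solveCost
    push_cast; linarith
  · have hch : ¬ HasChain (Demands.free φ D r X) (stepAngle r α X) k := by
      intro h; rw [if_pos h] at hno; omega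
    have B : Bracket n k w α r φ D X 0 X ((υ.setR 6 0).setR 7 X) :=
      ⟨⟨by simpa [reads] using S'.hn, by simpa [reads] using S'.hk, by simpa [reads] using S'.hw,
        by simpa [reads] using S'.hα, by simpa [reads] using S'.hr, by simpa [reads] using S'.hpi,
        S'.hφ, S'.hD⟩, by simp [reads], by simp [reads], le_rfl, hX0, le_rfl, Or.inl rfl, hch⟩
    refine (stagesP_spec H.demands hr hα (by omega) hw1 hX B).use ?_
    rintro x mx frx ⟨lo, hi, B', hc, hmx⟩
    rw [B'.eq_lo]
    refine ⟨H.isCircOptimum_of_no_candidate hk hα hr B'.nonneg B'.le B'.lt B'.chain B'.not_chain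
      fun i j t => not_candidate_of_candCount hc i j t, ?_⟩
    unfold solveCost
    push_cast; linarith

/-! ### Estimates of the running time -/

theorem testCost_le (n k w : ℕ) (hn : 1 ≤ n) : testCost n k w ≤ 1300 * n ^ 2 := by
  have hn1 : (1:ℝ) ≤ n := by exact_mod_cast hn
  have h1 := min_le_right (k * (42 * ((n:ℝ) / w) + 10 * w + 150)) (200 * (n:ℝ) + 200)
  have h2 := mul_le_mul_of_nonneg_left h1 (show (0:ℝ) ≤ n by positivity)
  unfold testCost
  nlinarith

/-- Either there are few points, or `log n` is comparable to `log k`. -/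
theorem testCost_mul_log_le (n k : ℕ) (hn : 1 ≤ n) (hk : 2 ≤ k) :
    testCost n k ⌊√(n:ℝ)⌋₊ * log n ≤ 10000 * (n ^ 2 * log k) := by
  have hn1 : (1:ℝ) ≤ n := by exact_mod_cast hn
  have hk2 : (2:ℝ) ≤ k := by exact_mod_cast hk
  have hl : 1 / 2 ≤ log k := by
    have h1 := log_le_log (by norm_num) hk2
    have h2 := Real.log_two_gt_d9
    linarith
  have hln : 0 ≤ log n := log_nonneg hn1
  rcases le_or_gt (log n) (4 * log k) with h | h
  · have h1 := mul_le_mul_of_nonneg_right (testCost_le n k ⌊√(n:ℝ)⌋₊ hn) hln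
    have h2 := mul_le_mul_of_nonneg_left h (show (0:ℝ) ≤ 1300 * n ^ 2 by positivity)
    have h3 : 0 ≤ (n:ℝ) ^ 2 * log k := by positivity
    linarith
  -- Here `s = n^(1/4)`. The case gives `k ≤ s`, and `w` lies between `s²/2` and `s²`, so a decision
  -- costs O(n s³); with `log n ≤ 4s` the product is O(n s⁴) = O(n²).
  · obtain ⟨s, hs, hs1⟩ : ∃ s : ℝ, s ^ 4 = n ∧ 1 ≤ s := by
      refine ⟨√(√n), ?_, ?_⟩
      · rw [show √(√(n:ℝ)) ^ 4 = (√(√(n:ℝ)) ^ 2) ^ 2 by ring, Real.sq_sqrt (Real.sqrt_nonneg _),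
          Real.sq_sqrt (by positivity)]
      · rw [Real.one_le_sqrt, Real.one_le_sqrt]; exact hn1
    have hs0 : 0 < s := by linarith
    have hsq : √(n:ℝ) = s ^ 2 := by
      rw [← hs, show s ^ 4 = (s ^ 2) ^ 2 by ring, Real.sqrt_sq (by positivity)]
    have hlog : log n = 4 * log s := by rw [← hs, log_pow]; norm_num
    have hks : k ≤ s := by
      have : log k < log s := by linarith
      exact ((log_lt_log_iff (by positivity) hs0).1 this).le
    have hlogs : log s ≤ s := (log_le_sub_one_of_pos hs0).trans (by linarith)
    set w := ⌊√(n:ℝ)⌋₊ with hw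
    have hw1 : 1 ≤ w := Nat.le_floor (by simpa using hn1)
    have hw1' : (1:ℝ) ≤ w := by exact_mod_cast hw1
    have hws : (w:ℝ) ≤ s ^ 2 := by rw [← hsq]; exact Nat.floor_le (Real.sqrt_nonneg _)
    have hws' : s ^ 2 ≤ 2 * w := by
      have := Nat.lt_floor_add_one (√(n:ℝ))
      rw [← hw, hsq] at this
      linarith
    have hs2 : 1 ≤ s ^ 2 := one_le_pow₀ hs1
    have h1 : (n:ℝ) / w ≤ 2 * s ^ 2 := by
      rw [div_le_iff₀ (by linarith), ← hs]
      nlinarith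
    have h2 : (k:ℝ) * (42 * ((n:ℝ) / w) + 10 * w + 150) ≤ s * (244 * s ^ 2) := by
      gcongr
      linarith
    have h3 : testCost n k w ≤ 900 * n + n * (244 * s ^ 3) := by
      unfold testCost
      have := (min_le_left _ (200 * (n:ℝ) + 200)).trans h2
      have := mul_le_mul_of_nonneg_left this (show (0:ℝ) ≤ n by positivity)
      linarith [show (n:ℝ) * (s * (244 * s ^ 2)) = n * (244 * s ^ 3) by ring]
    have hsn : s ≤ n := by rw [← hs]; exact le_self_pow₀ hs1 (by norm_num)
    have hlogs0 : 0 ≤ 4 * log s := by linarith [log_nonneg hs1]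
    calc testCost n k w * log n ≤ (900 * n + n * (244 * s ^ 3)) * (4 * s) := by
          rw [hlog]
          gcongr
      _ = 3600 * (n * s) + 976 * (n * s ^ 4) := by ring
      _ ≤ 3600 * (n * n) + 976 * (n * n) := by rw [hs]; gcongr
      _ ≤ 10000 * (n ^ 2 * (1 / 2)) := by nlinarith
      _ ≤ 10000 * (n ^ 2 * log k) := by gcongr

/-- As `log k ≥ 1/2` for `k ≥ 2`, all terms of order `n²` are absorbed by `n² log k`. The stages
contribute O(log k) times O(n²), and the logarithmic factor of the last stage is handled by
`testCost_mul_log_le`. -/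
theorem solveCost_le (n k : ℕ) (hn : 1 ≤ n) (hk : 2 ≤ k) :
    solveCost n k ⌊√(n:ℝ)⌋₊ ≤ 100000000 * (n ^ 2 * log k) := by
  have hn1 : (1:ℝ) ≤ n := by exact_mod_cast hn
  have hk2 : (2:ℝ) ≤ k := by exact_mod_cast hk
  have h2 := Real.log_two_gt_d9
  have hl : 1 / 2 ≤ log k := by
    have h1 := log_le_log (by norm_num) hk2
    linarith
  set T := testCost n k ⌊√(n:ℝ)⌋₊ with hT
  have hT0 : 0 ≤ T := testCost_nonneg _ _ _
  have hT1 : T ≤ 1300 * n ^ 2 := testCost_le _ _ _ hn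
  have hT2 : T * log n ≤ 10000 * (n ^ 2 * log k) := testCost_mul_log_le n k hn hk
  have hlb : logb 2 k ≤ 2 * log k := by
    unfold logb
    rw [div_le_iff₀ (by linarith)]
    nlinarith
  have hlb0 : 0 ≤ logb 2 k := logb_nonneg (by norm_num) (by linarith)
  have hn2 : (1:ℝ) ≤ n ^ 2 := one_le_pow₀ hn1
  have h9 : log (9 * (n:ℝ) ^ 2) ≤ 8 + 2 * log n := by
    rw [log_mul (by norm_num) (by positivity), log_pow]
    have : log (9:ℝ) ≤ 9 - 1 := log_le_sub_one_of_pos (by norm_num)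
    push_cast; linarith
  have hS : (n:ℝ) ^ 2 ≤ 2 * (n ^ 2 * log k) := by nlinarith
  have hlS : log k ≤ n ^ 2 * log k := by nlinarith
  have hlT : log k * T ≤ 1300 * (n ^ 2 * log k) := by nlinarith
  have hstage : (logb 2 k + 1) * (stageCost n k ⌊√(n:ℝ)⌋₊ + 20) ≤
      4 * log k * (3000000 * n ^ 2 + 513 * T + 20) := by
    unfold stageCost
    rw [← hT]
    gcongr
    linarith
  have hlast : T * (1 + 256 * log (9 * (n:ℝ) ^ 2)) ≤ T * (1 + 256 * (8 + 2 * log n)) := by gcongr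
  unfold solveCost lastStageCost
  rw [← hT]
  linarith

/-- The program finds the optimal value within the claimed time. -/
theorem circP_spec {n k : ℕ} (hn : 1 ≤ n) (hk : 1 ≤ k) {α r : ℝ} (hα : 0 < α) (hr : 0 < r)
    (o : Plane) (p : Fin n → Plane) :
    WP circP (fun τ m => IsCircOptimum α o r p k (τ.R 0) ∧
      (m : ℝ) ≤ 100000000 * (circTime n k + 1)) (inputStore α o r p k) := by
  have hn1 : (1:ℝ) ≤ n := by exact_mod_cast hn
  have hk1 : (1:ℝ) ≤ k := by exact_mod_cast hk
  have hlk : 0 ≤ log (k:ℝ) := log_nonneg hk1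
  have hS : 0 ≤ (n:ℝ) ^ 2 * log k := by positivity
  -- The time is bounded by the first summand alone; the second is merely nonnegative.
  have htime : (n:ℝ) ^ 2 * log k ≤ circTime n k := by
    unfold circTime
    have : 0 ≤ log ((n:ℝ) ^ 2 + k) := log_nonneg (by nlinarith)
    have : 0 ≤ n * (log (n:ℝ) ^ 2 + log k) * log ((n:ℝ) ^ 2 + k) := by positivity
    linarith
  have e1 : (inputStore α o r p k).I 1 = k := rfl
  unfold circP
  simp only [Syn.ic, Syn.iv, wps, evals, costs, e1]
  refine ⟨fun h => ?_, fun h => ?_⟩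
  · obtain rfl : k = 1 := by omega
    simp only [reads, reduceIte, Rat.cast_zero]
    exact ⟨isCircOptimum_one hn hα o r, by push_cast; linarith⟩
  · have hk2 : 2 ≤ k := by omega
    refine (solveP_spec hn hk2 hα hr o p _ rfl e1 rfl rfl rfl rfl (fun i => ?_) fun i => ?_).use ?_
    · simp [Store.A, inputStore]
    · simp [Store.A, inputStore]
    · rintro τ m - ⟨h1, h2⟩
      refine ⟨h1, ?_⟩
      have := solveCost_le n k hn hk2
      push_cast
      linarith

end RealRAM

end

theorem mainTheorem2 :
    ∃ (P : RealRAM.Program) (C : ℝ), ∀ (n k : ℕ), 1 ≤ n → 1 ≤ k →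
      ∀ (α r : ℝ), 0 < α → 0 < r → ∀ (o : Plane) (p : Fin n → Plane),
        ∃ (σ : RealRAM.Store) (m : ℕ),
          RealRAM.Runs P (RealRAM.inputStore α o r p k) σ m ∧
          IsCircOptimum α o r p k σ.output ∧
          (m : ℝ) ≤ C * (circTime n k + 1) := by
  refine ⟨RealRAM.circP, 100000000, fun n k hn hk α r hα hr o p => ?_⟩
  obtain ⟨τ, m, h1, h2, h3⟩ := RealRAM.circP_spec hn hk hα hr o p
  exact ⟨τ, m, h1, h2, h3⟩
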